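/- **Setting.** Let $k$ be a commutative ring. A (graded $k$-)quiver $\mathfrak a$ consists of a set of objects and $\mathbb Z$-graded $k$-modules $\mathfrak a(A,A')$. Write $(\Sigma^sV)^d=V^{d+s}$. Let $\mathbf C_{br}(\mathfrak a)=[T(\Sigma\mathfrak a),\Sigma\mathfrak a]=\prod_{n\ge0}[(\Sigma\mathfrak a)^{\otimes n},\Sigma\mathfrak a]$ with its brace operations $\phi\{\phi_1,\dots,\phi_r\}=\sum\phi(1\otimes\dots\otimes\phi_1\otimes1\otimes\dots\otimes\phi_r\otimes1\otimes\dots\otimes 1)$ (Koszul signs). Let $\mathbf C(\mathfrak a)=\Sigma^{-1}\mathbf C_{br}(\mathfrak a)$ be the Hochschild object, $\mathbf C^p(\mathfrak a)=\prod_{n\ge 0}\prod_{A_0,\dots,A_n}[\mathfrak a(A_{n-1},A_n)\otimes\dots\otimes\mathfrak a(A_0,A_1),\mathfrak a(A_0,A_n)]^{p-n}$, with the braces transported along $(\sigma^{1-n}\phi)(\sigma f_n,\dots,\sigma f_1)=(-1)^{n|\phi|+(n-1)|f_n|+\dots+|f_2|}\sigma\phi(f_n,\dots,f_1)$. Write $\phi_n$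 for the arity $n$ component of a cochain $\phi$. The quiver $\mathsf{Free}(\mathfrak a)$ has as objects the formal coproducts $M=\oplus_{i\in I}\Sigma^{m_i}A_i$ (with $A_i\in\mathfrak a$, $m_i\in\mathbb Z$, $I$ any set), and $\mathsf{Free}(\mathfrak a)(\oplus_i\Sigma^{m_i}A_i,\oplus_j\Sigma^{n_j}B_j)=\prod_i\oplus_j\Sigma^{n_j-m_i}\mathfrak a(A_i,B_j)$. The quiver $\mathsf{Tw_{free}}(\mathfrak a)$ has as objects the pairs $(M,\delta_M)$ with $M\in\mathsf{Free}(\mathfrak a)$ and $\delta_M\in\mathsf{Free}(\mathfrak a)(M,M)^1$, and the morphisms of $\mathsf{Free}(\mathfrak a)$; an object $A$ of $\mathfrak a$ is identified with $(\Sigma^0A,0)$. Every $\phi\in\mathbf C^p(\mathfrak a)$ extends canonically to a cochain of $\mathsf{Tw_{free}}(\mathfrak a)$, again denoted $\phi$, by the matrix formula $$\phi_n(f_n,\dots,f_1)_{ji}=\sum_{k_{n-1},\dots,k_1}(-1)^{\epsilon}\phi_n\big((f_n)_{jk_{n-1}},\dots,(f_1)_{k_1i}\big),\qquad \epsilon=(s_1+\dots+s_n)(p-n)+\sum_{l<r}s_l\,|(f_r)_{k_rk_{r-1}}|,$$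 where $k_0=i$, $k_n=j$, $s_l$ is the shift of $k_l$ minus the shift of $k_{l-1}$, and $|(f_r)_{k_rk_{r-1}}|$ is the degree in $\mathfrak a$. Let $\mathfrak a$ be a topological quiver: the modules $\mathfrak a(A,A')^d$ are complete Hausdorff topological $k$-modules ($k$ discrete; e.g. all $\mathfrak a(A,A')^d$ are discrete). Give $\prod_i\oplus_j\mathfrak a(A_i,B_j)^{d+n_j-m_i}$ the product over $i$ of the box topologies on the direct sums over $j$. Let $\mathfrak a\subset\mathsf{Tw}(\mathfrak a)\subset\mathsf{Tw_{free}}(\mathfrak a)$ be a full subquiver, let $\delta\in\mathbf C^1(\mathsf{Tw}(\mathfrak a))$ be the canonical arity zero cochain with components $\delta_M$, and give $\mathbf C(\mathsf{Tw}(\mathfrak a))$ the topology of pointwise convergence. Assume: 1. for every homogeneous $\phi\in\mathbf C(\mathfrak a)$ and $r\ge0$, the operation $(\psi_1,\dots,\psi_r)\mapsto\phi\{\psi_1,\dots,\psi_r\}$ on homogeneous components of $\mathbf C(\mathsf{Tw}(\mathfrak a))$ preserves Cauchy nets; 2. $\mathsf{Tw}(\mathfrak a)$ is a quiver of twisted objects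 over $\mathfrak a$, that is, for every $p$ and every $\phi\in\mathbf C^p(\mathfrak a)$, the partial sums of $\sum_{m\ge0}\phi\{\delta^{\otimes m}\}$ form a Cauchy sequence in $\mathbf C^p(\mathsf{Tw}(\mathfrak a))$. **Proposition.** For every $p$ and every $\phi\in\mathbf C^p(\mathfrak a)$ the series $$\mathrm{embr}_\delta(\phi)=\sum_{m=0}^{\infty}\phi\{\delta^{\otimes m}\}$$ converges in $\mathbf C^p(\mathsf{Tw}(\mathfrak a))$. The resulting map $\mathrm{embr}_\delta:\mathbf C(\mathfrak a)\to\mathbf C(\mathsf{Tw}(\mathfrak a))$ is $k$-linear of degree $0$, preserves all brace operations, and is a section of the canonical projection (restriction of cochains) $\pi:\mathbf C(\mathsf{Tw}(\mathfrak a))\to\mathbf C(\mathfrak a)$. For $M=(M,\delta_M)\in\mathsf{Tw}(\mathfrak a)$ and $\phi\in\mathbf C^p(\mathfrak a)$, the arity zero component of $\mathrm{embr}_\delta(\phi)$ at $M$ is the convergent sum $$(\mathrm{embr}_\delta(\phi))_M=\sum_{m=0}^{\infty}(-1)^{\alpha}\phi_m(\delta_M^{\otimes m})\in\mathsf{Tw}(\mathfrak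 a)(M,M)^p,\qquad\alpha=m\big((p-m)+(m-1)/2\big).$$ -/

import Mathlib

open Filter Topology Uniformity

universe u v w x

/-- A graded `k`-quiver: a type of objects and, for any two objects, a `ℤ`-graded `k`-module
(given by its homogeneous components). -/
structure GradedQuiver (k : Type u) [CommRing k] where
  Ob : Type v
  Hom : Ob → Ob → ℤ → Type w
  [addCommGroup : ∀ A B d, AddCommGroup (Hom A B d)]
  [module : ∀ A B d, Module k (Hom A B d)]

attribute [instance] GradedQuiver.addCommGroup GradedQuiver.module

namespace GradedQuiver

variable {k : Type u} [CommRing k]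

/-- Transport of a homogeneous morphism along an equality of degrees. -/
def castHom (a : GradedQuiver.{u, v, w} k) {A B : a.Ob} {d d' : ℤ} (h : d = d') :
    a.Hom A B d ≃ₗ[k] a.Hom A B d' := by
  subst h
  exact LinearEquiv.refl k _

/-! ### Composable sequences -/

/-- Composable sequences `(f_n, …, f_1)` of homogeneous morphisms from `A` to `B`; `cons f s` puts
`f` on the left of `s`. The index in `ℤ` is the degree of `σf_n ⊗ … ⊗ σf_1` in the tensor
cocategory `T(Σa)`, i.e. `∑ (|f_i| - 1)`. -/
inductive Seq (a : GradedQuiver.{u, v, w} k) (A : a.Ob) : a.Ob → ℤ → Type (max v w)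
  | nil {e : ℤ} (h : e = 0) : Seq a A A e
  | cons {B C : a.Ob} {d e t : ℤ} (f : a.Hom B C d) (s : Seq a A B e) (h : d - 1 + e = t) :
      Seq a A C t

namespace Seq

variable {a : GradedQuiver.{u, v, w} k} {A : a.Ob}

/-- The number `n` of morphisms of `(f_n, …, f_1)`. -/
def length : {B : a.Ob} → {e : ℤ} → Seq a A B e → ℕ
  | _, _, nil _ => 0
  | _, _, cons _ s _ => s.length + 1

/-- The exponent `(n-1)|f_n| + (n-2)|f_{n-1}| + … + |f_2|` of `(f_n, …, f_1)`. -/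
def suspExp : {B : a.Ob} → {e : ℤ} → Seq a A B e → ℤ
  | _, _, nil _ => 0
  | _, _, cons (d := d) _ s _ => s.length * d + s.suspExp

/-- Transport along an equality of degrees. -/
def cast {B : a.Ob} {e t : ℤ} (h : e = t) : Seq a A B e → Seq a A B t
  | nil h' => nil (h.symm.trans h')
  | cons f s h' => cons f s (h'.trans h)

/-- Concatenation. -/
def append {B : a.Ob} {e : ℤ} :
    {C : a.Ob} → {d t : ℤ} → Seq a B C d → Seq a A B e → d + e = t → Seq a A C t
  | _, _, _, nil h₀, s, h => s.cast (by omega)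
  | _, _, _, cons (e := e₁) f u _, s, h => cons f (append (t := e₁ + e) u s rfl) (by omega)

/-- `LinRel c x y z`: the sequences `x`, `y`, `z` agree except in one place, where their entries
are `f`, `g` and `f + c • g`, of the same degree. -/
inductive LinRel (c : k) :
    {B : a.Ob} → {e : ℤ} → Seq a A B e → Seq a A B e → Seq a A B e → Prop
  | head {B C : a.Ob} {d e t : ℤ} (f g : a.Hom B C d) (s : Seq a A B e) (h : d - 1 + e = t) :
      LinRel c (cons f s h) (cons g s h) (cons (f + c • g) s h)
  | tail {B C : a.Ob} {d e t : ℤ} (f : a.Hom B C d) {x y z : Seq a A B e} (h : d - 1 + e = t) :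
      LinRel c x y z → LinRel c (cons f x h) (cons f y h) (cons f z h)

/-- A function on composable sequences is `k`-multilinear if it is `k`-linear in each entry. -/
def IsMultilinear {B : a.Ob} {e : ℤ} {G : Type*} [AddCommGroup G] [Module k G]
    (F : Seq a A B e → G) : Prop :=
  ∀ (c : k) (x y z : Seq a A B e), LinRel c x y z → F z = F x + c • F y

/-- Sum of `F u v` over all ways to split `s` as a concatenation of `u` (on the left) and `v`. -/
def splitSum {G : Type*} [AddCommGroup G] : {B : a.Ob} → {e : ℤ} → Seq a A B e →
    (∀ (C : a.Ob) (d d' : ℤ), d + d' = e → Seq a C B d → Seq a A C d' → G) → G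
  | _, _, nil h, F => F A 0 _ (zero_add _) (nil rfl) (nil h)
  | B, t, cons (d := d) f s h, F =>
      F B 0 t (zero_add t) (nil rfl) (cons f s h) +
        splitSum s fun C d₁ d₂ h' u v =>
          F C (d - 1 + d₁) d₂ (by omega) (cons f u rfl) v

section lemmas

variable {B : a.Ob} {e : ℤ} {G : Type*} [AddCommGroup G] [Module k G] {c : k}

theorem LinRel.length_eq {B : a.Ob} {e : ℤ} {x y z : Seq a A B e} (h : LinRel c x y z) :
    x.length = z.length ∧ y.length = z.length := by
  induction h with
  | head => exact ⟨rfl, rfl⟩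
  | tail f h _ ih => exact ⟨congrArg (· + 1) ih.1, congrArg (· + 1) ih.2⟩

theorem LinRel.suspExp_eq {B : a.Ob} {e : ℤ} {x y z : Seq a A B e} (h : LinRel c x y z) :
    x.suspExp = z.suspExp ∧ y.suspExp = z.suspExp := by
  induction h with
  | head => exact ⟨rfl, rfl⟩
  | tail f h hr ih => simp [suspExp, ih.1, ih.2, hr.length_eq.1, hr.length_eq.2]

theorem LinRel.cast {B : a.Ob} {e t : ℤ} {x y z : Seq a A B e} (h : LinRel c x y z)
    (he : e = t) : LinRel c (x.cast he) (y.cast he) (z.cast he) := by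
  cases h with
  | head f g s h => exact .head f g s _
  | tail f h hr => exact .tail f _ hr

theorem LinRel.append_left {B C : a.Ob} {d e t : ℤ} {x y z : Seq a B C d}
    (hr : LinRel c x y z) (s : Seq a A B e) (h : d + e = t) :
    LinRel c (x.append s h) (y.append s h) (z.append s h) := by
  induction hr generalizing t with
  | head f g u h' => exact .head f g _ _
  | tail f h' _ ih => exact .tail f _ (ih rfl)

theorem LinRel.append_right {B C : a.Ob} {d e t : ℤ} (u : Seq a B C d) {x y z : Seq a A B e}
    (hr : LinRel c x y z) (h : d + e = t) :
    LinRel c (u.append x h) (u.append y h) (u.append z h) := by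
  induction u generalizing t with
  | nil => exact hr.cast _
  | cons f u h' ih => exact .tail f _ (ih rfl)

theorem splitSum_lin (s : Seq a A B e)
    {F F₁ F₂ : ∀ (C : a.Ob) (d d' : ℤ), d + d' = e → Seq a C B d → Seq a A C d' → G}
    (hF : ∀ C d d' h u v, F C d d' h u v = F₁ C d d' h u v + c • F₂ C d d' h u v) :
    splitSum s F = splitSum s F₁ + c • splitSum s F₂ := by
  induction s with
  | nil => exact hF _ _ _ _ _ _
  | cons f s h ih =>
    simp only [splitSum]
    rw [hF, ih fun C d d' h u v => hF C _ _ _ _ _]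
    simp only [smul_add]
    abel

theorem splitSum_multilinear
    (F : ∀ (C : a.Ob) (d d' : ℤ), d + d' = e → Seq a C B d → Seq a A C d' → G)
    (hl : ∀ C d d' h v, IsMultilinear fun u => F C d d' h u v)
    (hr : ∀ C d d' h u, IsMultilinear fun v => F C d d' h u v) :
    IsMultilinear fun s => splitSum s F := by
  intro c x y z hrel
  induction hrel with
  | head f g s h =>
    have h₁ := hr _ _ _ (zero_add _) (nil rfl) c _ _ _ (.head f g s h)
    have h₂ := splitSum_lin s (c := c) fun C d₁ d₂ h' u v =>
      hl C _ d₂ (by omega) v c _ _ _ (.head f g u rfl)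
    simp only [splitSum] at h₁ ⊢
    rw [h₁, h₂]
    simp only [smul_add]
    abel
  | tail f h hrel ih =>
    have h₁ := hr _ _ _ (zero_add _) (nil rfl) c _ _ _ (.tail f h hrel)
    have h₂ := ih (fun C d₁ d₂ h' u v => F C _ d₂ (by omega) (cons f u rfl) v)
      (fun C d d' h v c x y z hh => hl C _ _ _ v c _ _ _ (.tail f rfl hh))
      (fun C d d' h u => hr _ _ _ _ _)
    simp only [splitSum] at h₁ h₂ ⊢
    rw [h₁, h₂]
    simp only [smul_add]
    abel

end lemmas

end Seq

/-! ### Hochschild cochains -/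

/-- Hochschild cochains of Hochschild degree `p`, as a submodule of the module of all families.
The arity `n` component of a cochain is a family of `k`-multilinear maps
`a(A_{n-1}, A_n)^{d_n} × … × a(A_0, A_1)^{d_1} → a(A_0, A_n)^t` with `t = (p - n) + ∑ d_i`,
so it has degree `p - n`; all arities occur simultaneously (the product over the arities). -/
def cochains (a : GradedQuiver.{u, v, w} k) (p : ℤ) :
    Submodule k (∀ (A B : a.Ob) (e : ℤ) (_ : Seq a A B e) (t : {t : ℤ // e + p = t}),
      a.Hom A B t) where
  carrier := {φ | ∀ A B e t, Seq.IsMultilinear fun s => φ A B e s t}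
  add_mem' := by
    intro φ ψ hφ hψ A B e t c x y z h
    simp only [Pi.add_apply, hφ A B e t c x y z h, hψ A B e t c x y z h, smul_add]
    abel
  zero_mem' := by
    intro A B e t c x y z _
    simp
  smul_mem' := by
    intro r φ hφ A B e t c x y z h
    simp only [Pi.smul_apply, hφ A B e t c x y z h, smul_add, smul_comm r c]

/-- The component `C^p(a)` of the Hochschild object `C(a)`. -/
abbrev Cochain (a : GradedQuiver.{u, v, w} k) (p : ℤ) : Type _ := ↥(a.cochains p)

namespace Cochain

variable {a : GradedQuiver.{u, v, w} k}

/-- The value of a cochain on a composable sequence. -/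
def eval {p : ℤ} (φ : a.Cochain p) {A B : a.Ob} {e t : ℤ} (s : Seq a A B e) (h : e + p = t) :
    a.Hom A B t :=
  φ.1 A B e s ⟨t, h⟩

theorem eval_multilinear {p : ℤ} (φ : a.Cochain p) {A B : a.Ob} {e t : ℤ} (h : e + p = t) :
    Seq.IsMultilinear fun s : Seq a A B e => φ.eval s h :=
  φ.2 A B e ⟨t, h⟩

/-- Transport along an equality of degrees. -/
def cast {p q : ℤ} (h : p = q) (φ : a.Cochain p) : a.Cochain q :=
  ⟨fun _ _ _ s t => φ.eval s (h ▸ t.2), fun _ _ _ _ => φ.eval_multilinear _⟩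

/-- The identification of `C^p(a)` with `C_br^{p-1}(a) = [T(Σa), Σa]^{p-1}`:
for `φ` of arity `n` and degree `i = p - n`,
`(σ^{1-n}φ)(σf_n, …, σf_1) = (-1)^{n i + (n-1)|f_n| + … + |f_2|} σ φ(f_n, …, f_1)`.
The result is again written without the symbols `σ`, so this map is its own inverse. -/
def susp {p : ℤ} (φ : a.Cochain p) : a.Cochain p :=
  ⟨fun _ _ _ s t => (s.length * (p - s.length) + s.suspExp : ℤ).negOnePow • φ.eval s t.2, by
    intro A B e t c x y z h
    simp only [h.length_eq.1, h.length_eq.2, h.suspExp_eq.1, h.suspExp_eq.2,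
      φ.eval_multilinear t.2 c x y z h, smul_add, smul_comm _ c]⟩

/-- The total degree `∑ (q_j - 1)` of a list of cochains in `C_br(a)`. -/
def totalDeg (ψs : List (Σ q, a.Cochain q)) : ℤ := (ψs.map fun ψ => ψ.1 - 1).sum

/-- Sum of `± K (1 ⊗ … ⊗ ψ_1 ⊗ 1 ⊗ … ⊗ ψ_r ⊗ 1 ⊗ … ⊗ 1)(s)` over all ways to apply the
`ψ_j`, in this order from left to right, to disjoint segments (possibly empty) of `s`, with Koszul
signs in `T(Σa)`: each `ψ_j`, of degree `q_j - 1`, moves past all entries of `s` on the left of its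
segment. Here `u` is the part of `s` on the left of the segment `x` of the first cochain `ψ`. -/
def insertSum {G : Type*} [AddCommGroup G] : (ψs : List (Σ q, a.Cochain q)) →
    {A B : a.Ob} → {e : ℤ} → Seq a A B e →
    (∀ t, e + totalDeg ψs = t → Seq a A B t → G) → G
  | [], _, _, e, s, K => K e (by simp [totalDeg]) s
  | ψ :: ψs, _, _, e, s, K =>
      s.splitSum fun _ d d' h u r => r.splitSum fun _ d₁ d₂ h' x v =>
        ((ψ.1 - 1) * d + totalDeg ψs * (d + d₁)).negOnePow •
          insertSum ψs v fun t ht y =>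
            K (d + (d₁ + ψ.1 - 1 + t)) (by simp only [totalDeg, List.map_cons, List.sum_cons] at *; omega)
              (u.append (Seq.cons (ψ.2.eval x rfl) y rfl) rfl)

section lemmas

variable {A B : a.Ob} {e : ℤ} {G : Type*} [AddCommGroup G] [Module k G]

theorem insertSum_lin {c : k} (ψs : List (Σ q, a.Cochain q)) {A B : a.Ob} {e : ℤ}
    (s : Seq a A B e) {K K₁ K₂ : ∀ t, e + totalDeg ψs = t → Seq a A B t → G}
    (hK : ∀ t h y, K t h y = K₁ t h y + c • K₂ t h y) :
    insertSum ψs s K = insertSum ψs s K₁ + c • insertSum ψs s K₂ := by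
  induction ψs generalizing A B e with
  | nil => exact hK _ _ _
  | cons ψ ψs ih =>
    refine Seq.splitSum_lin _ fun C d d' h u r => Seq.splitSum_lin _ fun C d₁ d₂ h' x v => ?_
    rw [smul_comm c, ← smul_add]
    exact congrArg _ (ih _ fun t ht y => hK _ _ _)

theorem insertSum_multilinear (ψs : List (Σ q, a.Cochain q)) {A B : a.Ob} {e : ℤ}
    (K : ∀ t, e + totalDeg ψs = t → Seq a A B t → G)
    (hK : ∀ t h, Seq.IsMultilinear (K t h)) :
    Seq.IsMultilinear fun s => insertSum ψs s K := by
  induction ψs generalizing A B e with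
  | nil => exact hK _ _
  | cons ψ ψs ih =>
    refine Seq.splitSum_multilinear _ ?_ ?_
    · intro C d d' h r c x y z hrel
      refine Seq.splitSum_lin _ fun C d₁ d₂ h' x v => ?_
      rw [smul_comm c, ← smul_add]
      exact congrArg _ (insertSum_lin _ _ fun t ht s => hK _ _ c _ _ _ (hrel.append_left _ rfl))
    · intro C d d' h u
      refine Seq.splitSum_multilinear _ ?_ ?_
      · intro C d₁ d₂ h' v c x y z hrel
        have hz := ψ.2.eval_multilinear rfl c x y z hrel
        simp only at hz ⊢
        rw [smul_comm c, ← smul_add]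
        refine congrArg _ (insertSum_lin _ _ fun t ht s => ?_)
        rw [hz]
        exact hK _ _ c _ _ _ (.append_right u (.head _ _ s rfl) rfl)
      · intro C d₁ d₂ h' x c y z w hrel
        simp only
        rw [smul_comm c, ← smul_add]
        exact congrArg _ (ih (e := d₂) (fun t ht y => K (d + (d₁ + ψ.1 - 1 + t))
            (by simp only [totalDeg, List.map_cons, List.sum_cons] at *; omega)
            (u.append (Seq.cons (ψ.2.eval x rfl) y rfl) rfl))
          (fun t ht c y z w hrel => hK _ _ c _ _ _
            (.append_right u (.tail _ rfl hrel) rfl)) c y z w hrel)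

end lemmas

/-- The brace operations of `C_br(a) = [T(Σa), Σa]`,
`φ{ψ_1, …, ψ_r} = ∑ φ(1 ⊗ … ⊗ ψ_1 ⊗ 1 ⊗ … ⊗ ψ_r ⊗ 1 ⊗ … ⊗ 1)`
(all cochains are written as in `Cochain.susp`). -/
def suspBrace {p t : ℤ} (φ : a.Cochain p) (ψs : List (Σ q, a.Cochain q))
    (h : p + totalDeg ψs = t) : a.Cochain t :=
  ⟨fun _ _ _ s t' => insertSum ψs s fun _ hy y => φ.eval y (by have := t'.2; omega),
    fun _ _ _ _ => insertSum_multilinear _ _ fun _ _ => φ.eval_multilinear _⟩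

/-- The brace operations `φ{ψ_1, …, ψ_r}` of the Hochschild object `C(a)`, transported from
`C_br(a)`. -/
def brace {p : ℤ} {r : ℕ} {q : Fin r → ℤ} (φ : a.Cochain p) (ψ : ∀ j, a.Cochain (q j)) :
    a.Cochain (p + ∑ j, (q j - 1)) :=
  (φ.susp.suspBrace (List.ofFn fun j => ⟨q j, (ψ j).susp⟩)
    (by simp [totalDeg, List.map_ofFn, List.sum_ofFn, Function.comp_def])).susp

end Cochain

/-! ### Twisted objects -/

/-- A formal coproduct `⊕_{i ∈ I} Σ^{m_i} A_i` of shifts of objects. -/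
structure FreeOb (a : GradedQuiver.{u, v, w} k) where
  I : Type x
  obj : I → a.Ob
  deg : I → ℤ

/-- The quiver `Free(a)`, with `Free(a)(M, N) = ∏_i ⊕_j Σ^{n_j - m_i} a(A_i, B_j)`, the product
and the direct sum of graded modules being taken degreewise, and `(Σ^s V)^d = V^{d+s}`.
`f i j` is the matrix entry `f_{ji}`, standing for `σ^{n_j - m_i} f_{ji}`. -/
def Free (a : GradedQuiver.{u, v, w} k) :
    GradedQuiver.{u, max v (x + 1), max w x} k where
  Ob := FreeOb.{u, v, w, x} a
  Hom M N d := ∀ i : M.I, Π₀ j : N.I, a.Hom (M.obj i) (N.obj j) (d + N.deg j - M.deg i)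

section pathSum

theorem dfinsuppSum_lin {J : Type*} [DecidableEq J] {X : J → Type*} [∀ j, AddCommGroup (X j)]
    [∀ j, Module k (X j)] [∀ j (y : X j), Decidable (y ≠ 0)] {G : Type*} [AddCommGroup G]
    [Module k G] (c : k) (F : ∀ j, X j → G) (hF : ∀ j y z, F j (y + c • z) = F j y + c • F j z)
    (hF0 : ∀ j, F j 0 = 0) (f g : Π₀ j, X j) :
    (f + c • g).sum F = f.sum F + c • g.sum F := by
  have key : ∀ S : Finset J, ∀ h : Π₀ j, X j, h.support ⊆ S → h.sum F = ∑ j ∈ S, F j (h j) :=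
    fun S h hS => Finset.sum_subset hS fun j _ hj => by
      rw [DFinsupp.notMem_support_iff.1 hj, hF0]
  let S := (f + c • g).support ∪ f.support ∪ g.support
  rw [key S _ (by grind), key S f (by grind), key S g (by grind)]
  simp only [DFinsupp.add_apply, DFinsupp.smul_apply, hF, Finset.sum_add_distrib, Finset.smul_sum]

variable {a : GradedQuiver.{u, v, w} k}

open Classical in
/-- Sum, over all `i = k_0, k_1, …, k_{n-1}, k_n = j` (with `i` fixed), of
`± K j ((f_n)_{j k_{n-1}}, …, (f_1)_{k_1 i})`, for `s = (f_n, …, f_1)` in `Free(a)`.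
Only the finitely many paths with nonzero matrix entries occur. The sign is the Koszul sign
`∏_{l < r} (-1)^{s_l |f_r|}` that comes from moving the shifts `σ^{s_l}` to the left in
`(σ^{s_n} f_n, …, σ^{s_1} f_1)`, with `s_l = deg k_l - deg k_{l-1}`; here `|f_r|` is the degree of
the matrix entry of `f_r` in `a`. -/
noncomputable def pathSum {M : (Free.{u, v, w, x} a).Ob} (i : M.I) {G : Type*} [AddCommGroup G] :
    {N : (Free.{u, v, w, x} a).Ob} → {e : ℤ} → Seq (Free a) M N e →
    (∀ (j : N.I) (t : ℤ), e + N.deg j - M.deg i = t → Seq a (M.obj i) (N.obj j) t → G) → G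
  | _, _, .nil h, K => K i 0 (by omega) (.nil rfl)
  | N, _, .cons (B := Q) (d := d) f s h, K =>
      pathSum i s fun l t ht y => (f l).sum fun j g =>
        ((d + N.deg j - Q.deg l) * (Q.deg l - M.deg i)).negOnePow •
          K j (d + N.deg j - Q.deg l - 1 + t) (by omega) (.cons g y rfl)

variable {G : Type*} [AddCommGroup G] [Module k G] {M : (Free.{u, v, w, x} a).Ob} {i : M.I}

theorem pathSum_lin {c : k} {N : (Free.{u, v, w, x} a).Ob} {e : ℤ} (s : Seq (Free a) M N e)
    {K K₁ K₂ : ∀ (j : N.I) (t : ℤ), e + N.deg j - M.deg i = t →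
      Seq a (M.obj i) (N.obj j) t → G}
    (hK : ∀ j t h y, K j t h y = K₁ j t h y + c • K₂ j t h y) :
    pathSum i s K = pathSum i s K₁ + c • pathSum i s K₂ := by
  classical
  induction s with
  | nil => exact hK _ _ _ _
  | cons f s h ih =>
    refine ih fun l t ht y => ?_
    simp only [hK, DFinsupp.sum, smul_add, Finset.sum_add_distrib, Finset.smul_sum, smul_comm _ c]

theorem pathSum_multilinear {N : (Free.{u, v, w, x} a).Ob} {e : ℤ}
    (K : ∀ (j : N.I) (t : ℤ), e + N.deg j - M.deg i = t → Seq a (M.obj i) (N.obj j) t → G)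
    (hK : ∀ j t h, Seq.IsMultilinear (K j t h)) :
    Seq.IsMultilinear fun s : Seq (Free a) M N e => pathSum i s K := by
  classical
  intro c x y z hrel
  induction hrel with
  | @head Q N d e t f g s h =>
    refine pathSum_lin s fun l t ht y => ?_
    have hlin : ∀ (c : k) (j : N.I) g₁ g₂,
        K j (d + N.deg j - Q.deg l - 1 + t) (by omega) (.cons (g₁ + c • g₂) y rfl) =
          K j _ (by omega) (.cons g₁ y rfl) + c • K j _ (by omega) (.cons g₂ y rfl) :=
      fun c j g₁ g₂ => hK j _ _ c _ _ _ (.head g₁ g₂ y rfl)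
    refine dfinsuppSum_lin c _ (fun j g₁ g₂ => ?_) (fun j => ?_) (f l) (g l)
    · rw [hlin, smul_add, smul_comm c]
    · have h0 := hlin (-1) j 0 0
      rw [smul_zero, add_zero, neg_one_smul, add_neg_cancel] at h0
      rw [h0, smul_zero]
  | tail f h hrel ih =>
    refine ih _ fun l t ht c x y z hrel => ?_
    refine (Finset.sum_congr rfl fun j _ => ?_).trans
      (Finset.sum_add_distrib.trans (congrArg _ Finset.smul_sum.symm))
    rw [smul_comm c, ← smul_add]
    exact congrArg _ (hK j _ _ c _ _ _ (.tail _ rfl hrel))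

end pathSum

variable {a : GradedQuiver.{u, v, w} k}

open Classical in
/-- The canonical extension of a cochain of `a` to a cochain of `Free(a)`,
`φ(f_n, …, f_1)_{ji} = ∑ ± φ((f_n)_{j k_{n-1}}, …, (f_1)_{k_1 i})`, with the signs of the canonical
isomorphisms `[a(A_{n-1}, A_n) ⊗ …, a(A_0, A_n)] ≅ [Σ^{s_n} a(A_{n-1}, A_n) ⊗ …, Σ^s a(A_0, A_n)]`,
`s = s_1 + … + s_n`: moving `σ^s` past `φ`, of degree `p - n`, gives `(-1)^{s (p - n)}`, and the
remaining sign is the one of `pathSum`. -/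
noncomputable def Cochain.extend {p : ℤ} (φ : a.Cochain p) : (Free.{u, v, w, x} a).Cochain p :=
  ⟨fun M N e s t i => pathSum i s fun j t' h y => DFinsupp.single j
      (((N.deg j - M.deg i) * (p - s.length)).negOnePow •
        φ.eval y (t := t + N.deg j - M.deg i) (by have := t.2; omega)), by
    intro M N e t c x y z hrel
    funext i
    have := pathSum_multilinear (i := i) (N := N) (e := e) (fun j t' h y => DFinsupp.single j
      (((N.deg j - M.deg i) * (p - z.length)).negOnePow •
        φ.eval y (t := t + N.deg j - M.deg i) (by have := t.2; omega)))
      (fun j t' h c x y z hr => by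
        have h1 := φ.eval_multilinear (t := t + N.deg j - M.deg i) (by have := t.2; omega)
          c x y z hr
        simp only at h1 ⊢
        rw [h1, smul_add, smul_comm _ c, DFinsupp.single_add, DFinsupp.single_smul c]) c x y z hrel
    simp only [hrel.length_eq.1, hrel.length_eq.2]
    exact this⟩

/-- The quiver with objects `X` and the morphisms of `b` between the `F x`; for injective `F` this
is a full subquiver of `b`. -/
def full (b : GradedQuiver.{u, v, w} k) {X : Type x} (F : X → b.Ob) : GradedQuiver.{u, x, w} k where
  Ob := X
  Hom A B d := b.Hom (F A) (F B) d

section full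

variable {b : GradedQuiver.{u, v, w} k} {X : Type x} {F : X → b.Ob}

/-- A composable sequence of `full b F`, seen in `b`. -/
def Seq.ofFull {A : (full b F).Ob} :
    {B : (full b F).Ob} → {e : ℤ} → Seq (full b F) A B e → Seq b (F A) (F B) e
  | _, _, .nil h => .nil h
  | _, _, .cons (B := B) (C := C) (d := d) f s h =>
      .cons (show b.Hom (F B) (F C) d from f) s.ofFull h

theorem Seq.LinRel.ofFull {c : k} {A B : (full b F).Ob} {e : ℤ} {x y z : Seq (full b F) A B e}
    (h : LinRel c x y z) : LinRel c x.ofFull y.ofFull z.ofFull := by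
  induction h with
  | head f g s h => exact .head (a := b) f g s.ofFull h
  | tail f h _ ih => exact .tail (a := b) f h ih

/-- Restriction of cochains to a full subquiver. -/
def Cochain.toFull {p : ℤ} (φ : b.Cochain p) : (full b F).Cochain p :=
  ⟨fun _ _ _ s t => φ.eval s.ofFull t.2, fun _ _ _ t c _ _ _ h =>
    φ.eval_multilinear t.2 c _ _ _ h.ofFull⟩

end full

/-- Objects `(M, δ_M)` of `Tw_free(a)`: an object `M` of `Free(a)` with `δ_M ∈ Free(a)(M, M)^1`. -/
structure TwOb (a : GradedQuiver.{u, v, w} k) where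
  base : (Free.{u, v, w, x} a).Ob
  δ : (Free.{u, v, w, x} a).Hom base base 1

/-- An object `A` of `a`, seen as the object `Σ^0 A` of `Free(a)`. -/
def FreeOb.ofOb (A : a.Ob) : (Free.{u, v, w, x} a).Ob :=
  { I := PUnit, obj := fun _ => A, deg := fun _ => 0 : FreeOb a }

/-- An object `A` of `a`, seen as the object `(Σ^0 A, 0)` of `Tw_free(a)`. -/
def TwOb.ofOb (A : a.Ob) : TwOb.{u, v, w, x} a where
  base := FreeOb.ofOb A
  δ := 0

/-- The full subquiver of `Tw_free(a)` on a set `P` of objects; the morphisms from `(M, δ_M)` to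
`(N, δ_N)` are those of `Free(a)` from `M` to `N`. -/
def Tw (P : Set (TwOb.{u, v, w, x} a)) :
    GradedQuiver.{u, max v w (x + 1), max w x} k :=
  full (Free.{u, v, w, x} a) fun M : P => M.1.base

section Tw

variable (P : Set (TwOb.{u, v, w, x} a))

/-- The canonical extension `φ ↦ φ` of cochains from `a` to `Tw(a)` (not involving the `δ_M`). -/
noncomputable def Cochain.extendTw {p : ℤ} (φ : a.Cochain p) : (Tw P).Cochain p :=
  φ.extend.toFull

/-- The canonical cochain `δ ∈ C^1(Tw(a))`: of arity zero, with components the `δ_M`. -/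
def canonicalδ : (Tw P).Cochain 1 :=
  ⟨fun A _ _ s t => match s with
    | .nil h => castHom (Tw P) (by have := t.2; omega)
        (show (Tw P).Hom A A 1 from (show P from A).1.δ)
    | .cons _ _ _ => 0, by
    intro A B e t c x y z h
    cases h <;> simp⟩

/-- The cochain `φ{δ^{⊗m}}` of `Tw(a)`. -/
noncomputable def twTerm {p : ℤ} (φ : a.Cochain p) (m : ℕ) : (Tw P).Cochain p :=
  ((φ.extendTw P).brace fun _ : Fin m => canonicalδ P).cast (by simp)

/-- The `m`-tuple `(δ_M, …, δ_M)`. -/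
def δSeq (M : (Tw P).Ob) : ℕ → Seq (Tw P) M M 0
  | 0 => .nil rfl
  | m + 1 => .cons (d := 1) (show (Tw P).Hom M M 1 from (show P from M).1.δ) (δSeq M m) (by simp)

variable {P} (hP : ∀ A : a.Ob, TwOb.ofOb A ∈ P)

/-- The inclusion of `a` into `Tw(a)`: on objects. -/
def inclOb (A : a.Ob) : (Tw P).Ob := show P from ⟨TwOb.ofOb A, hP A⟩

/-- The inclusion of `a` into `Tw(a)`: on morphisms (as `1 × 1`-matrices). -/
def inclHom {A B : a.Ob} {d : ℤ} (f : a.Hom A B d) : (Tw P).Hom (inclOb hP A) (inclOb hP B) d :=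
  fun _ : PUnit.{x + 1} => (DFinsupp.single PUnit.unit (a.castHom (by simp) f) :
    Π₀ _ : PUnit.{x + 1}, a.Hom A B (d + 0 - 0))

/-- The inclusion of `a` into `Tw(a)`: on composable sequences. -/
def inclSeq {A : a.Ob} : {B : a.Ob} → {e : ℤ} → Seq a A B e →
    Seq (Tw P) (inclOb hP A) (inclOb hP B) e
  | _, _, .nil h => .nil h
  | _, _, .cons f s h => .cons (inclHom hP f) (inclSeq s) h

theorem inclHom_lin {A B : a.Ob} {d : ℤ} (c : k) (f g : a.Hom A B d) :
    inclHom hP (f + c • g) = inclHom hP f + c • inclHom hP g := by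
  funext i
  simp only [inclHom, map_add, map_smul]
  rw [DFinsupp.single_add, DFinsupp.single_smul]
  rfl

theorem inclSeq_linRel {c : k} {A B : a.Ob} {e : ℤ} {x y z : Seq a A B e}
    (h : Seq.LinRel c x y z) :
    Seq.LinRel c (inclSeq hP x) (inclSeq hP y) (inclSeq hP z) := by
  induction h with
  | head f g s h =>
    simp only [inclSeq, inclHom_lin]
    exact .head _ _ _ _
  | tail f h _ ih => exact .tail _ _ ih

/-- The inverse of `inclHom`: the entry of a `1 × 1`-matrix. -/
def entry {A B : a.Ob} {d : ℤ} : (Tw P).Hom (inclOb hP A) (inclOb hP B) d →ₗ[k] a.Hom A B d where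
  toFun f := a.castHom (show d + 0 - 0 = d by simp)
    ((show PUnit.{x + 1} → Π₀ _ : PUnit.{x + 1}, a.Hom A B (d + 0 - 0) from f) PUnit.unit PUnit.unit)
  map_add' f g := by
    rw [← map_add]
    rfl
  map_smul' c f := by
    rw [RingHom.id_apply, ← map_smul]
    rfl

/-- The canonical projection `π : C(Tw(a)) → C(a)`, the restriction of cochains along the inclusion
of `a` as a full subquiver of `Tw(a)`. -/
def proj {p : ℤ} (φ : (Tw P).Cochain p) : a.Cochain p :=
  ⟨fun _ _ _ s t => entry hP (φ.eval (inclSeq hP s) t.2), by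
    intro A B e t c x y z h
    have := φ.eval_multilinear t.2 c _ _ _ (inclSeq_linRel hP h)
    simp only at this ⊢
    rw [this, map_add, map_smul]⟩

end Tw

/-! ### Topology -/

/-- A uniform structure on each module of homogeneous morphisms of a quiver. -/
class UniformQuiver (a : GradedQuiver.{u, v, w} k) where
  uniformSpace : ∀ A B d, UniformSpace (a.Hom A B d)

attribute [instance, reducible] UniformQuiver.uniformSpace

/-- A topological quiver: the `a(A, A')^d` are complete Hausdorff topological `k`-modules
(`k` being discrete), with the uniform structure of their topological additive group. -/
class IsTopologicalQuiver (a : GradedQuiver.{u, v, w} k) [UniformQuiver a] : Prop where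
  isUniformAddGroup : ∀ A B d, IsUniformAddGroup (a.Hom A B d)
  continuousConstSMul : ∀ A B d, ContinuousConstSMul k (a.Hom A B d)
  completeSpace : ∀ A B d, CompleteSpace (a.Hom A B d)
  t2Space : ∀ A B d, T2Space (a.Hom A B d)

attribute [instance] IsTopologicalQuiver.isUniformAddGroup IsTopologicalQuiver.continuousConstSMul
  IsTopologicalQuiver.completeSpace IsTopologicalQuiver.t2Space

/-- The uniform structure of a direct sum `⊕_j X_j`, with basis of entourages
`{(x, y) | ∀ j, (x_j, y_j) ∈ V_j}`, for arbitrary families of entourages `V_j` of the `X_j`. If the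
`X_j` are discrete, then so is the direct sum. -/
@[reducible] def boxUniformSpace {J : Type*} (X : J → Type*) [∀ j, Zero (X j)] [∀ j, UniformSpace (X j)] :
    UniformSpace (Π₀ j, X j) :=
  .ofCore <| .mkOfBasis
    { sets := {S | ∃ V : ∀ j, Set (X j × X j), (∀ j, V j ∈ 𝓤 (X j)) ∧
        S = {p | ∀ j, (p.1 j, p.2 j) ∈ V j}}
      nonempty := ⟨_, fun _ => Set.univ, fun _ => univ_mem, rfl⟩
      inter_sets := by
        rintro _ _ ⟨V, hV, rfl⟩ ⟨W, hW, rfl⟩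
        exact ⟨_, ⟨fun j => V j ∩ W j, fun j => inter_mem (hV j) (hW j), rfl⟩,
          fun p hp => ⟨fun j => (hp j).1, fun j => (hp j).2⟩⟩ }
    (by
      rintro _ ⟨V, hV, rfl⟩ x j
      exact refl_mem_uniformity (hV j))
    (by
      rintro _ ⟨V, hV, rfl⟩
      exact ⟨_, ⟨fun j => Prod.swap ⁻¹' V j, fun j => symm_le_uniformity (hV j), rfl⟩,
        fun p hp j => hp j⟩)
    (by
      rintro _ ⟨V, hV, rfl⟩
      choose W hW hWV using fun j => comp_mem_uniformity_sets (hV j)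
      refine ⟨_, ⟨W, hW, rfl⟩, ?_⟩
      rintro ⟨y, z⟩ ⟨r, h₁, h₂⟩ j
      exact hWV j ⟨r j, h₁ j, h₂ j⟩)

instance Free.uniformQuiver [UniformQuiver a] : UniformQuiver (Free.{u, v, w, x} a) where
  uniformSpace M N d :=
    letI := fun i : M.I => boxUniformSpace fun j : N.I =>
      a.Hom (M.obj i) (N.obj j) (d + N.deg j - M.deg i)
    Pi.uniformSpace _

/-- The topology on the morphisms of `Tw(a)` is the one of
`∏_i ⊕_j a(A_i, B_j)^{d + n_j - m_i}`. The cochains of `Tw(a)` then carry, as families of functions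
with values in these modules, the pointwise uniform structure. -/
instance Tw.uniformQuiver [UniformQuiver a] (P : Set (TwOb.{u, v, w, x} a)) :
    UniformQuiver (Tw P) where
  uniformSpace M N d :=
    (Free.uniformQuiver (a := a)).uniformSpace (show P from M).1.base (show P from N).1.base d

/-- `Tw(a)` is a quiver of twisted objects over `a`: it contains `a` and, for every cochain `φ` of
`a`, the partial sums of `∑_m φ{δ^{⊗m}}` are Cauchy for the pointwise topology of `C(Tw(a))`; in
other words, the partial sums of `e^δ = ∑_m δ^{⊗m}` are Cauchy for the initial structure of the maps
`φ{-}`, i.e. `e^δ` converges in the completion for that structure. -/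
structure IsQuiverOfTwistedObjects [UniformQuiver a] (P : Set (TwOb.{u, v, w, x} a)) : Prop where
  ofOb_mem : ∀ A : a.Ob, TwOb.ofOb A ∈ P
  cauchySeq : ∀ (p : ℤ) (φ : a.Cochain p),
    CauchySeq fun n => ∑ m ∈ Finset.range n, twTerm P φ m

/-- For every cochain `φ` of `a`, the brace operation `(ψ_1, …, ψ_r) ↦ φ{ψ_1, …, ψ_r}` on
`C(Tw(a))` preserves Cauchy filters (equivalently Cauchy nets) for the pointwise topology. -/
def BracesPreserveCauchy [UniformQuiver a] (P : Set (TwOb.{u, v, w, x} a)) : Prop :=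
  ∀ (p : ℤ) (φ : a.Cochain p) (r : ℕ) (q : Fin r → ℤ)
    (ℱ : Filter (∀ j, (Tw P).Cochain (q j))), Cauchy ℱ →
      Cauchy (ℱ.map fun ψ => (φ.extendTw P).brace ψ)

end GradedQuiver

open GradedQuiver

/-! Regroup the series by arity of `φ` instead of by number of copies of `δ`. On a sequence of
length `n`, the term `φ{δ^{⊗m}}` only sees `φ_{m+n}`, and it sums `φ_{m+n}` over all ways to enlarge
the sequence by `m` entries `δ`. Write `φ^(N)` for the cochain that enlarges a sequence to length
`N` in all ways and applies `φ_N` (`twist`, `twistTw`). Then `∑_m φ{δ^{⊗m}}` and `∑_N φ^(N)` have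
the same pointwise limits (`tendsto_twTerm_iff`). A limit exists because `C(Tw(a))` is complete: box
sums and products of complete Hausdorff modules are complete, and multilinearity is a closed
condition (`box_completeSpace`, `completeSpace`). Restriction to `a` only keeps the term `m = 0`,
since `δ` vanishes on objects of `a`.

Braces rest on a finite identity (`ins_insertSum`, `twist_brace`, `twistTw_brace`): with `ψ_{l,j}`
the arity `j` component of `ψ_l`, `(φ{ψ_{1,j_1}, …, ψ_{r,j_r}})^(N) = φ^(N + r - ∑ j_l){ψ_1^(j_1),
…, ψ_r^(j_r)}`. Both sides run over the same pictures: entries `δ` are inserted, each `ψ_l` swallows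
a segment of length `j_l`, and `φ` is applied to the rest. The entries `δ` have degree `0` in
`T(Σa)`, so they cause no signs. The canonical extension to `Tw(a)` also respects braces
(`extend_brace`, `toFull_brace`).

It remains to sum the identity over all `(N, j)`, and this needs unconditional convergence. Here the
hypothesis on twisted objects is applied to more cochains than `φ{ψ}`: for every set `S` of indices
`(N, j)`, the terms in `S` assemble to a cochain of `a` (`subseries`), because `C(a)` is a product
over the arities and each arity receives finitely many terms. So every subseries is Cauchy, and the
whole family is summable (`summable_of_forall_cauchySeq`). It may therefore be reindexed and summed
first over `j`, then over `N`. The sum over `j` is computed by continuity of `χ ↦ φ^(N){χ}`, which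
follows from the hypothesis on Cauchy nets (`continuous_eval_twistTw_brace`). The sum over `N` needs
no hypothesis, since at a given sequence a brace is a finite sum of values of its outer cochain. -/

namespace GradedQuiver

variable {k : Type u} [CommRing k] {a : GradedQuiver.{u, v, w} k}

/-! ### Transport of degrees and sums over splittings -/

namespace Seq

variable {A B : a.Ob} {e : ℤ}

@[simp]
theorem cast_rfl (s : Seq a A B e) : s.cast rfl = s := by
  cases s <;> rfl

theorem apply_cast {X : Sort*} {e' : ℤ} {p : ℤ → Prop} (K : ∀ t, p t → Seq a A B t → X)
    (s : Seq a A B e) (h : e = e') (h₁ : p e') (h₂ : p e) : K e' h₁ (s.cast h) = K e h₂ s := by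
  subst h
  rw [cast_rfl]

theorem apply_cons {X : Sort*} {C : a.Ob} {d t t' : ℤ} {p : ℤ → Prop}
    (K : ∀ t, p t → Seq a A C t → X) (f : a.Hom B C d) (s : Seq a A B e) (ht : t = t')
    (h : d - 1 + e = t) (h' : d - 1 + e = t') (h₁ : p t) (h₂ : p t') :
    K t h₁ (cons f s h) = K t' h₂ (cons f s h') := by
  subst ht
  rfl

section splitSum

variable {G H : Type*} [AddCommGroup G] [AddCommGroup H]

/-- The length relation is included so that arguments which truncate by arity can bound the segments
that occur. -/
theorem splitSum_congr (s : Seq a A B e)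
    {F F' : ∀ (C : a.Ob) (d d' : ℤ), d + d' = e → Seq a C B d → Seq a A C d' → G}
    (h : ∀ C d d' h u v, u.length + v.length = s.length → F C d d' h u v = F' C d d' h u v) :
    splitSum s F = splitSum s F' := by
  induction s with
  | nil => exact h _ _ _ _ _ _ rfl
  | cons f s hs ih =>
    simp only [splitSum]
    rw [h _ _ _ _ (nil rfl) (cons f s hs) (by simp [length])]
    refine congrArg _ (ih fun C d d' h' u v huv => h _ _ _ _ _ _ ?_)
    simp only [length]
    omega

theorem map_splitSum (L : G →+ H) (s : Seq a A B e)
    (F : ∀ (C : a.Ob) (d d' : ℤ), d + d' = e → Seq a C B d → Seq a A C d' → G) :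
    L (splitSum s F) = splitSum s fun C d d' h u v => L (F C d d' h u v) := by
  induction s with
  | nil => rfl
  | cons f s hs ih => simp only [splitSum, map_add, ih]

theorem splitSum_add (s : Seq a A B e)
    (F F' : ∀ (C : a.Ob) (d d' : ℤ), d + d' = e → Seq a C B d → Seq a A C d' → G) :
    splitSum s (fun C d d' h u v => F C d d' h u v + F' C d d' h u v) =
      splitSum s F + splitSum s F' := by
  induction s with
  | nil => rfl
  | cons f s hs ih =>
    simp only [splitSum, ih]
    abel

theorem splitSum_smul (c : ℤˣ) (s : Seq a A B e)
    (F : ∀ (C : a.Ob) (d d' : ℤ), d + d' = e → Seq a C B d → Seq a A C d' → G) :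
    splitSum s (fun C d d' h u v => c • F C d d' h u v) = c • splitSum s F :=
  (map_splitSum (DistribSMul.toAddMonoidHom G c) s F).symm

theorem splitSum_zero (s : Seq a A B e) :
    splitSum s (fun _ _ _ _ _ _ => (0 : G)) = 0 :=
  (map_splitSum (0 : G →+ G) s fun _ _ _ _ _ _ => 0).symm

end splitSum

theorem IsMultilinear.head_add {G : Type*} [AddCommGroup G] [Module k G] {C : a.Ob} {d t : ℤ}
    {F : Seq a A C t → G} (hF : IsMultilinear F) (f g : a.Hom B C d) (s : Seq a A B e)
    (h : d - 1 + e = t) : F (cons (f + g) s h) = F (cons f s h) + F (cons g s h) := by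
  simpa using hF 1 _ _ _ (.head f g s h)

theorem IsMultilinear.head_zero {G : Type*} [AddCommGroup G] [Module k G] {C : a.Ob} {d t : ℤ}
    {F : Seq a A C t → G} (hF : IsMultilinear F) (s : Seq a A B e)
    (h : d - 1 + e = t) : F (cons (0 : a.Hom B C d) s h) = 0 := by
  simpa using hF.head_add 0 0 s h

theorem IsMultilinear.tail {G : Type*} [AddCommGroup G] [Module k G] {C : a.Ob} {d t : ℤ}
    {F : Seq a A C t → G} (hF : IsMultilinear F) (f : a.Hom B C d) (h : d - 1 + e = t) :
    IsMultilinear fun s : Seq a A B e => F (cons f s h) :=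
  fun c _ _ _ hr => hF c _ _ _ (.tail f h hr)

end Seq

/-! ### The recursion for insertion of cochains -/

namespace Cochain

variable {A B : a.Ob} {e : ℤ} {G H : Type*} [AddCommGroup G] [AddCommGroup H]

@[simp]
theorem totalDeg_nil : totalDeg ([] : List (Σ q, a.Cochain q)) = 0 := rfl

@[simp]
theorem totalDeg_cons (ψ : Σ q, a.Cochain q) (ψs : List (Σ q, a.Cochain q)) :
    totalDeg (ψ :: ψs) = ψ.1 - 1 + totalDeg ψs := by
  simp [totalDeg]

theorem map_insertSum (L : G →+ H) (ψs : List (Σ q, a.Cochain q)) {A B : a.Ob} {e : ℤ}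
    (s : Seq a A B e) (K : ∀ t, e + totalDeg ψs = t → Seq a A B t → G) :
    L (insertSum ψs s K) = insertSum ψs s fun t h y => L (K t h y) := by
  induction ψs generalizing A B e with
  | nil => rfl
  | cons ψ ψs ih =>
    simp only [insertSum, Seq.map_splitSum, ← ih]
    refine Seq.splitSum_congr _ fun _ _ _ _ _ _ _ => Seq.splitSum_congr _ fun _ _ _ _ _ _ _ => ?_
    exact (map_zsmul L _ _)

theorem insertSum_smul (c : ℤˣ) (ψs : List (Σ q, a.Cochain q))
    (s : Seq a A B e) (K : ∀ t, e + totalDeg ψs = t → Seq a A B t → G) :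
    insertSum ψs s (fun t h y => c • K t h y) = c • insertSum ψs s K :=
  (map_insertSum (DistribSMul.toAddMonoidHom G c) ψs s K).symm

theorem insertSum_add (ψs : List (Σ q, a.Cochain q)) {A B : a.Ob} {e : ℤ}
    (s : Seq a A B e) (K K' : ∀ t, e + totalDeg ψs = t → Seq a A B t → G) :
    insertSum ψs s (fun t h y => K t h y + K' t h y) = insertSum ψs s K + insertSum ψs s K' := by
  induction ψs generalizing A B e with
  | nil => rfl
  | cons ψ ψs ih => simp only [insertSum, ih, smul_add, Seq.splitSum_add]

/-- The part of `insertSum (ψ :: ψs) s K` where the segment of `ψ` is an initial one. -/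
def headSum (ψ : Σ q, a.Cochain q) (ψs : List (Σ q, a.Cochain q)) (s : Seq a A B e)
    (K : ∀ t, e + totalDeg (ψ :: ψs) = t → Seq a A B t → G) : G :=
  s.splitSum fun _ d₁ d₂ h x v => (totalDeg ψs * d₁).negOnePow •
    insertSum ψs v fun t ht y => K (d₁ + ψ.1 - 1 + t)
      (by simp only [totalDeg_cons]; omega) (Seq.cons (ψ.2.eval x rfl) y rfl)

theorem headSum_eq (ψ : Σ q, a.Cochain q) (ψs : List (Σ q, a.Cochain q)) (s : Seq a A B e)
    (K : ∀ t, e + totalDeg (ψ :: ψs) = t → Seq a A B t → G) :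
    (s.splitSum fun _ d₁ d₂ h x v => ((ψ.1 - 1) * 0 + totalDeg ψs * (0 + d₁)).negOnePow •
      insertSum ψs v fun t ht y => K (0 + (d₁ + ψ.1 - 1 + t))
        (by simp only [totalDeg_cons]; omega)
        ((Seq.nil rfl : Seq a B B 0).append (Seq.cons (ψ.2.eval x rfl) y rfl) rfl)) =
      headSum ψ ψs s K := by
  refine Seq.splitSum_congr _ fun C d₁ d₂ h x v _ => ?_
  simp only [mul_zero, zero_add]
  congr 2
  funext t ht y
  exact Seq.apply_cast K _ _ _ _

theorem insertSum_cons_nil (ψ : Σ q, a.Cochain q) (ψs : List (Σ q, a.Cochain q)) (h : e = 0)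
    (K : ∀ t, e + totalDeg (ψ :: ψs) = t → Seq a A A t → G) :
    insertSum (ψ :: ψs) (Seq.nil h) K = headSum ψ ψs (Seq.nil h) K :=
  headSum_eq ψ ψs (Seq.nil h) K

/-- Either the segment of `ψ` starts at the left end, or `f` stays outside all segments. In the
second case every cochain of the list moves past `σf`, of degree `d - 1`, which explains the sign.
The later comparisons of brace sums run along this recursion. -/
theorem insertSum_cons_cons (ψ : Σ q, a.Cochain q) (ψs : List (Σ q, a.Cochain q)) {C : a.Ob}
    {d t : ℤ} (f : a.Hom B C d) (s : Seq a A B e) (h : d - 1 + e = t)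
    (K : ∀ t', t + totalDeg (ψ :: ψs) = t' → Seq a A C t' → G) :
    insertSum (ψ :: ψs) (Seq.cons f s h) K = headSum ψ ψs (Seq.cons f s h) K +
      (totalDeg (ψ :: ψs) * (d - 1)).negOnePow • insertSum (ψ :: ψs) s fun t' ht y =>
        K (d - 1 + t') (by omega) (Seq.cons f y rfl) := by
  rw [← headSum_eq]
  conv_lhs => rw [insertSum, Seq.splitSum]
  refine congrArg _ ?_
  rw [insertSum, ← Seq.splitSum_smul]
  refine Seq.splitSum_congr _ fun C d₁ d₂ h x v _ => ?_
  rw [← Seq.splitSum_smul]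
  refine Seq.splitSum_congr _ fun C d₃ d₄ h x v _ => ?_
  rw [smul_smul, ← Int.negOnePow_add]
  congr 2
  · simp only [totalDeg_cons]
    ring
  · funext t' ht y
    simp only [Seq.append]
    have : d - 1 + d₁ + (d₃ + ψ.1 - 1 + t') = d - 1 + (d₁ + (d₃ + ψ.1 - 1 + t')) := by ring
    exact Seq.apply_cons K _ _ this _ _ _ _

end Cochain

/-! ### Inserting entries `δ` into a sequence -/

namespace Seq

variable (δ : ∀ A : a.Ob, a.Hom A A 1) {A B : a.Ob} {e : ℤ} {G H : Type*} [AddCommGroup G]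
  [AddCommGroup H]

/-- `δ_B` put on the left of `s`. -/
def consδ (s : Seq a A B e) : Seq a A B e :=
  cons (δ B) s (by omega)

@[simp]
theorem length_consδ (s : Seq a A B e) : (consδ δ s).length = s.length + 1 := rfl

variable {δ} in
theorem IsMultilinear.consδ [Module k G] {K : Seq a A B e → G} (hK : IsMultilinear K) :
    IsMultilinear fun s => K (consδ δ s) :=
  hK.tail (δ B) (by omega)

/-- Sum of `K y` over all sequences `y` of length `N` that arise from `s` by inserting
morphisms `δ_C`. -/
def insNat : ℕ → {B : a.Ob} → {e : ℤ} → Seq a A B e → (Seq a A B e → G) → G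
  | 0, _, _, nil h, K => K (nil h)
  | 0, _, _, cons _ _ _, _ => 0
  | N + 1, _, _, nil h, K => insNat N (nil h) fun y => K (consδ δ y)
  | N + 1, _, _, cons f s h, K => (insNat N s fun y => K (cons f y h)) +
      insNat N (cons f s h) fun y => K (consδ δ y)

/-- `insNat` for an integral length. -/
def ins (N : ℤ) {B : a.Ob} {e : ℤ} (s : Seq a A B e) (K : Seq a A B e → G) : G :=
  if 0 ≤ N then insNat δ N.toNat s K else 0

theorem ins_of_neg {N : ℤ} (hN : N < 0) (s : Seq a A B e) (K : Seq a A B e → G) :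
    ins δ N s K = 0 :=
  if_neg (by omega)

theorem ins_natCast (N : ℕ) (s : Seq a A B e) (K : Seq a A B e → G) :
    ins δ N s K = insNat δ N s K :=
  if_pos (by omega)

/-- Integral lengths make the recursion uniform, with zero at negative `N`. They are also needed
because the length `N + r - ∑ j_l` in the brace identity may be negative. -/
theorem ins_nil (N : ℤ) (h : e = 0) (K : Seq a A A e → G) :
    ins δ N (nil h) K = (if N = 0 then K (nil h) else 0) +
      ins δ (N - 1) (nil h) fun y => K (consδ δ y) := by
  rcases lt_or_ge N 0 with hN | hN
  · rw [ins_of_neg _ hN, ins_of_neg _ (by omega), if_neg hN.ne, add_zero]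
  lift N to ℕ using hN
  cases N with
  | zero =>
    rw [ins_of_neg (N := _ - 1) _ (by omega), ins_natCast, add_zero]
    rfl
  | succ N =>
    rw [if_neg (by omega), Nat.cast_succ, add_sub_cancel_right, zero_add]
    rfl

theorem ins_cons (N : ℤ) {C : a.Ob} {d t : ℤ} (f : a.Hom B C d) (s : Seq a A B e)
    (h : d - 1 + e = t) (K : Seq a A C t → G) :
    ins δ N (cons f s h) K = (ins δ (N - 1) s fun y => K (cons f y h)) +
      ins δ (N - 1) (cons f s h) fun y => K (consδ δ y) := by
  rcases lt_or_ge N 0 with hN | hN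
  · rw [ins_of_neg _ hN, ins_of_neg _ (by omega), ins_of_neg _ (by omega), add_zero]
  lift N to ℕ using hN
  cases N with
  | zero =>
    rw [ins_of_neg (N := _ - 1) _ (by omega), ins_of_neg (N := _ - 1) _ (by omega), ins_natCast,
      add_zero]
    rfl
  | succ N =>
    rw [Nat.cast_succ, add_sub_cancel_right]
    rfl

theorem ins_zero_nil (h : e = 0) (K : Seq a A A e → G) : ins δ 0 (nil h) K = K (nil h) := by
  rw [ins_nil, if_pos rfl, ins_of_neg _ (by omega), add_zero]

theorem ins_zero_cons {C : a.Ob} {d t : ℤ} (f : a.Hom B C d) (s : Seq a A B e)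
    (h : d - 1 + e = t) (K : Seq a A C t → G) : ins δ 0 (cons f s h) K = 0 := by
  rw [ins_cons, ins_of_neg _ (by omega), ins_of_neg _ (by omega), add_zero]

/-- Induction along the recursion of `ins`. -/
theorem ins_induction {motive : ∀ {B : a.Ob} {e : ℤ} (_ : ℤ), Seq a A B e → Prop}
    (neg : ∀ (N : ℤ) {B e} (s : Seq a A B e), N < 0 → motive N s)
    (nil : ∀ (N : ℤ) {e} (h : e = 0), motive (N - 1) (nil h) → motive N (nil h))
    (cons : ∀ (N : ℤ) {B C e d t} (f : a.Hom B C d) (s : Seq a A B e) (h : d - 1 + e = t),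
      motive (N - 1) s → motive (N - 1) (cons f s h) → motive N (cons f s h))
    (N : ℤ) (s : Seq a A B e) : motive N s := by
  rcases lt_or_ge N 0 with hN | hN
  · exact neg N s hN
  lift N to ℕ using hN
  have key : ∀ (n : ℕ) {B e} (s : Seq a A B e), motive ((n : ℤ) - 1) s := by
    intro n
    induction n with
    | zero => exact fun s => neg _ s (by simp)
    | succ n ih =>
      intro B e s
      rw [Nat.cast_succ, add_sub_cancel_right]
      cases s with
      | nil h => exact nil _ h (ih _)
      | cons f s h => exact cons _ f s h (ih _) (ih _)
  simpa using key (N + 1) s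

theorem ins_congr (N : ℤ) (s : Seq a A B e) {K K' : Seq a A B e → G}
    (h : ∀ y, (y.length : ℤ) = N → s.length ≤ y.length → K y = K' y) :
    ins δ N s K = ins δ N s K' := by
  induction N, s using ins_induction with
  | neg N s hN => rw [ins_of_neg _ hN, ins_of_neg _ hN]
  | nil N he ih =>
    rw [ins_nil _ N, ins_nil _ N]
    congr 1
    · exact ite_congr rfl (fun hN => h _ hN.symm le_rfl) fun _ => rfl
    · exact ih fun y hy _ => h _ (by rw [length_consδ]; omega) (Nat.zero_le _)
  | cons N f s he ih ih' =>
    rw [ins_cons _ N, ins_cons _ N]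
    congr 1
    · exact ih fun y hy hy' => h _ (by simp [length, hy]) (by simpa [length] using hy')
    · exact ih' fun y hy hy' => h _ (by rw [length_consδ]; omega) (by rw [length_consδ]; omega)

theorem map_ins (L : G →+ H) (N : ℤ) (s : Seq a A B e) (K : Seq a A B e → G) :
    L (ins δ N s K) = ins δ N s fun y => L (K y) := by
  induction N, s using ins_induction with
  | neg N s hN => rw [ins_of_neg _ hN, ins_of_neg _ hN, map_zero]
  | nil N he ih =>
    rw [ins_nil _ N, ins_nil _ N, map_add, ih, apply_ite L, map_zero]
  | cons N f s he ih ih' => rw [ins_cons _ N, ins_cons _ N, map_add, ih, ih']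

theorem ins_zero (N : ℤ) (s : Seq a A B e) : ins δ N s (fun _ => (0 : G)) = 0 :=
  (map_ins δ (0 : G →+ G) N s fun _ => 0).symm

theorem ins_add (N : ℤ) (s : Seq a A B e) (K K' : Seq a A B e → G) :
    ins δ N s (fun y => K y + K' y) = ins δ N s K + ins δ N s K' := by
  induction N, s using ins_induction with
  | neg N s hN => simp only [ins_of_neg _ hN, add_zero]
  | nil N he ih =>
    simp only [ins_nil _ N, ih]
    split_ifs <;> abel
  | cons N f s he ih ih' =>
    simp only [ins_cons _ N, ih, ih']
    abel

theorem ins_smul {R : Type*} [Monoid R] [DistribMulAction R G] (c : R) (N : ℤ) (s : Seq a A B e)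
    (K : Seq a A B e → G) : ins δ N s (fun y => c • K y) = c • ins δ N s K :=
  (map_ins δ (DistribSMul.toAddMonoidHom G c) N s K).symm

theorem ins_multilinear [Module k G] (N : ℤ) {K : Seq a A B e → G} (hK : IsMultilinear K) :
    IsMultilinear fun s => ins δ N s K := by
  intro c x y z h
  -- The recursion runs on three related sequences at once, so a bound on `N` replaces
  -- `ins_induction`.
  suffices ∀ (n : ℕ) (N : ℤ), N < n → ∀ {B e} {K : Seq a A B e → G}, IsMultilinear K →
      ∀ {x y z}, LinRel c x y z → ins δ N z K = ins δ N x K + c • ins δ N y K from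
    this (N.toNat + 1) N (by omega) hK h
  intro n
  induction n with
  | zero =>
    intro N hN B e K hK x y z h
    simp only [ins_of_neg _ hN, smul_zero, add_zero]
  | succ n ih =>
    intro N hN B e K hK x y z h
    have hN' : N - 1 < n := by push_cast at hN; omega
    cases h with
    | head f g s h =>
      simp only [ins_cons _ N]
      rw [ih _ hN' hK.consδ (.head f g s h), ← ins_smul]
      have : ∀ y, K (cons (f + c • g) y h) = K (cons f y h) + c • K (cons g y h) :=
        fun y => hK c _ _ _ (.head f g y h)
      simp only [this, ins_add, ins_smul, smul_add]
      abel
    | tail f h hr =>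
      simp only [ins_cons _ N]
      rw [ih _ hN' hK.consδ (.tail f h hr), ih _ hN' (hK.tail f h) hr]
      simp only [smul_add]
      abel

/-- Compatibility of `ins` with the decomposition of sequences into a left part of length `j` and
a right part. -/
theorem ins_splitSum (j : ℕ) (N : ℤ) (s : Seq a A B e)
    (F : ∀ (C : a.Ob) (d d' : ℤ), d + d' = e → Seq a C B d → Seq a A C d' → G) :
    (ins δ N s fun y => splitSum y fun C d d' h u v =>
        if u.length = j then F C d d' h u v else 0) =
      splitSum s fun C d d' h u v => ins δ j u fun u' => ins δ (N - j) v fun v' =>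
        F C d d' h u' v' := by
  -- A `δ` at the left end belongs to the left part unless that part is empty.
  have key : ∀ {B e} (y : Seq a A B e)
      (F : ∀ (C : a.Ob) (d d' : ℤ), d + d' = e → Seq a C B d → Seq a A C d' → G),
      splitSum (consδ δ y) F = F B 0 e (by omega) (.nil rfl) (consδ δ y) +
        splitSum y fun C d d' h u v => F C d d' h (consδ δ u) v := by
    intro B e y F
    refine congrArg _ (splitSum_congr _ fun C d d' h u v _ => ?_)
    exact apply_cons (fun t ht (z : Seq a C B t) => F C t d' ht z v) _ _ (by omega) _ _ _ _
  induction N, s using ins_induction generalizing j with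
  | neg N s hN =>
    simp only [ins_of_neg _ hN, ins_of_neg _ (show N - j < 0 by omega), ins_zero, splitSum_zero]
  | nil N he ih =>
    cases j with
    -- Only the split with empty left part has a left part of length `0`, and no `δ` can be inserted
    -- there.
    | zero =>
      simp only [ins_nil _ N, key, length_consδ, Nat.add_eq_zero_iff, one_ne_zero, and_false,
        if_false, splitSum_zero, add_zero, splitSum, length, if_true, Nat.cast_zero, sub_zero,
        ins_zero_nil]
    | succ j =>
      have e₁ : ((j + 1 : ℕ) : ℤ) - 1 = j := by omega
      have e₂ : N - ((j + 1 : ℕ) : ℤ) = N - 1 - j := by omega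
      have e₃ : ¬((j + 1 : ℕ) : ℤ) = 0 := by omega
      simp only [ins_nil _ N, key, length_consδ, Nat.add_right_cancel_iff, splitSum, length,
        (Nat.succ_ne_zero j).symm, if_false, zero_add, ite_self, ih, ins_nil _ ((j + 1 : ℕ) : ℤ)]
      rw [if_neg e₃, zero_add, e₁, e₂]
  | cons N f s he ih ih' =>
    cases j with
    | zero =>
      simp only [ins_cons _ N, key, length_consδ, Nat.add_eq_zero_iff, one_ne_zero, and_false,
        if_false, splitSum_zero, add_zero, splitSum, length, if_true, Nat.cast_zero, sub_zero,
        ins_zero_nil, ins_zero_cons]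
    | succ j =>
      have e₁ : ((j + 1 : ℕ) : ℤ) - 1 = j := by omega
      have e₂ : N - ((j + 1 : ℕ) : ℤ) = N - 1 - j := by omega
      have e₃ : ¬((j + 1 : ℕ) : ℤ) = 0 := by omega
      simp only [ins_cons _ N, key, length_consδ, Nat.add_right_cancel_iff, splitSum, length,
        (Nat.succ_ne_zero j).symm, if_false, zero_add, ih, ih', ins_cons _ ((j + 1 : ℕ) : ℤ),
        ins_nil _ ((j + 1 : ℕ) : ℤ), splitSum_add]
      rw [if_neg e₃, zero_add, e₁, e₂]
      abel
end Seq

/-! ### Insertion of `δ` against braces -/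

namespace Cochain

variable {A B : a.Ob} {e : ℤ} {G H : Type*} [AddCommGroup G] [AddCommGroup H]

@[ext]
theorem ext {p : ℤ} {φ ψ : a.Cochain p} (h : ∀ {A B : a.Ob} {e t : ℤ} (s : Seq a A B e)
    (ht : e + p = t), φ.eval s ht = ψ.eval s ht) : φ = ψ := by
  refine Subtype.ext ?_
  funext A B e s t
  exact h s t.2

@[simp]
theorem eval_add {p t : ℤ} (φ ψ : a.Cochain p) (s : Seq a A B e) (h : e + p = t) :
    (φ + ψ).eval s h = φ.eval s h + ψ.eval s h := rfl

@[simp]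
theorem eval_smul {p t : ℤ} (c : k) (φ : a.Cochain p) (s : Seq a A B e) (h : e + p = t) :
    (c • φ).eval s h = c • φ.eval s h := rfl

@[simp]
theorem eval_zero {p t : ℤ} (s : Seq a A B e) (h : e + p = t) :
    (0 : a.Cochain p).eval s h = 0 := rfl

/-- Evaluation at a composable sequence, as a linear map. -/
def evalₗ {p t : ℤ} (s : Seq a A B e) (h : e + p = t) : a.Cochain p →ₗ[k] a.Hom A B t where
  toFun φ := φ.eval s h
  map_add' _ _ := rfl
  map_smul' _ _ := rfl

@[simp]
theorem eval_sum {ι : Type*} {p t : ℤ} (S : Finset ι) (φ : ι → a.Cochain p) (s : Seq a A B e)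
    (h : e + p = t) : (∑ i ∈ S, φ i).eval s h = ∑ i ∈ S, (φ i).eval s h :=
  map_sum (evalₗ s h) φ S

/-- The arity `j` component of a cochain. -/
def arity {p : ℤ} (j : ℕ) : a.Cochain p →ₗ[k] a.Cochain p where
  toFun φ := ⟨fun _ _ _ s t => if s.length = j then φ.eval s t.2 else 0, by
    intro A B e t c x y z h
    simp only [h.length_eq.1, h.length_eq.2, φ.eval_multilinear t.2 c x y z h]
    split_ifs <;> simp⟩
  map_add' φ ψ := by
    ext A B e t s h
    change (if s.length = j then φ.eval s h + ψ.eval s h else 0) =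
      (if s.length = j then φ.eval s h else 0) + if s.length = j then ψ.eval s h else 0
    split_ifs <;> simp
  map_smul' c φ := by
    ext A B e t s h
    change (if s.length = j then c • φ.eval s h else 0) =
      c • if s.length = j then φ.eval s h else 0
    split_ifs <;> simp

theorem eval_arity {p t : ℤ} (j : ℕ) (φ : a.Cochain p) (s : Seq a A B e) (h : e + p = t) :
    (φ.arity j).eval s h = if s.length = j then φ.eval s h else 0 := rfl

variable (δ : ∀ A : a.Ob, a.Hom A A 1)

/-- The cochain `s ↦ ∑ φ(y)`, where `y` runs over the sequences of length `N` that arise from `s`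
by inserting morphisms `δ_C`. -/
def insert {p : ℤ} (N : ℤ) : a.Cochain p →ₗ[k] a.Cochain p where
  toFun φ := ⟨fun _ _ _ s t => s.ins δ N fun y => φ.eval y t.2, fun _ _ _ t =>
    Seq.ins_multilinear δ N (φ.eval_multilinear t.2)⟩
  map_add' φ ψ := by
    ext A B e t s h
    exact Seq.ins_add δ N s _ _
  map_smul' c φ := by
    ext A B e t s h
    exact Seq.ins_smul δ c N s _

theorem eval_insert {p t : ℤ} (N : ℤ) (φ : a.Cochain p) (s : Seq a A B e) (h : e + p = t) :
    (φ.insert δ N).eval s h = s.ins δ N fun y => φ.eval y h := rfl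

/-- `InsertRel δ L L' n`: `L` consists of arity `j` components of cochains, `L'` of the cochains
obtained from them by `insert δ j`, and `n` is the sum of the `1 - j`. -/
inductive InsertRel : List (Σ q, a.Cochain q) → List (Σ q, a.Cochain q) → ℤ → Prop
  | nil : InsertRel [] [] 0
  | cons {L L' : List (Σ q, a.Cochain q)} {n : ℤ} {q : ℤ} (j : ℕ) (ψ : a.Cochain q)
      (h : InsertRel L L' n) :
      InsertRel (⟨q, ψ.arity j⟩ :: L) (⟨q, ψ.insert δ j⟩ :: L') (n + 1 - j)

variable {δ} in
theorem InsertRel.totalDeg_eq {L L' : List (Σ q, a.Cochain q)} {n : ℤ} (h : InsertRel δ L L' n) :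
    totalDeg L' = totalDeg L := by
  induction h with
  | nil => rfl
  | cons j ψ h ih => simp only [totalDeg_cons, ih]

/-- As `σδ` has degree `0`, cochains pass it without sign. -/
theorem insertSum_consδ (ψ : Σ q, a.Cochain q) (ψs : List (Σ q, a.Cochain q))
    (s : Seq a A B e) (K : ∀ t, e + totalDeg (ψ :: ψs) = t → Seq a A B t → G) :
    insertSum (ψ :: ψs) (s.consδ δ) K = headSum ψ ψs (s.consδ δ) K +
      insertSum (ψ :: ψs) s fun t ht y => K t ht (y.consδ δ) := by
  rw [Seq.consδ, insertSum_cons_cons]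
  simp only [show totalDeg (ψ :: ψs) * (1 - 1) = 0 by ring, Int.negOnePow_zero, one_smul]
  congr 2
  funext t ht y
  exact Seq.apply_cons K _ _ (by omega) _ _ _ _

theorem insertSum_zero (ψs : List (Σ q, a.Cochain q)) (s : Seq a A B e) :
    insertSum ψs s (fun _ _ _ => (0 : G)) = 0 :=
  (map_insertSum (0 : G →+ G) ψs s fun _ _ _ => 0).symm

/-- Two enumerations of the same pictures. On the left, all entries `δ` are inserted first, giving
length `N`, and the cochains then take segments of lengths `j`. On the right, each cochain fills up
its own segment to length `j`, and the entries `δ` outside the segments come afterwards; a segment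
of length `j` has become one entry, so the outer length is `N + ∑ (1 - j)`. -/
theorem ins_insertSum [Module k G] {L L' : List (Σ q, a.Cochain q)} {n : ℤ}
    (hL : InsertRel δ L L' n) (N : ℤ) (s : Seq a A B e)
    (K : ∀ t, e + totalDeg L = t → Seq a A B t → G) (hK : ∀ t h, Seq.IsMultilinear (K t h)) :
    (s.ins δ N fun y => insertSum L y K) =
      insertSum L' s fun t ht y => y.ins δ (N + n) (K t (hL.totalDeg_eq ▸ ht)) := by
  induction hL generalizing A B e N with
  | nil => simp only [insertSum, add_zero]
  | @cons L L' n q j ψ hL ih =>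
    -- The pictures in which the segment of `ψ` is initial. There `ins_splitSum` separates the
    -- entries `δ` inside the segment from those to its right.
    have head : ∀ {A B e} (N : ℤ) (s : Seq a A B e)
        (K : ∀ t, e + totalDeg (⟨q, ψ.arity j⟩ :: L) = t → Seq a A B t → G)
        (hK : ∀ t h, Seq.IsMultilinear (K t h)),
        (s.ins δ N fun y => headSum ⟨q, ψ.arity j⟩ L y K) =
          s.splitSum fun _ d₁ d₂ h x v => (totalDeg L' * d₁).negOnePow •
            insertSum L' v fun t ht y => y.ins δ (N + n - j) fun y' => K (d₁ + q - 1 + t)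
              (by rw [hL.totalDeg_eq] at ht; simp only [totalDeg_cons]; omega)
              (Seq.cons ((ψ.insert δ j).eval x rfl) y' rfl) := by
      intro A B e N s K hK
      trans s.ins δ N fun y => y.splitSum fun _ d₁ d₂ h x v => if x.length = j then
        (totalDeg L * d₁).negOnePow • insertSum L v fun t ht y => K (d₁ + q - 1 + t)
          (by simp only [totalDeg_cons]; omega) (Seq.cons (ψ.eval x rfl) y rfl) else 0
      · refine Seq.ins_congr δ N s fun y _ _ => Seq.splitSum_congr _ fun C d d' h x v _ => ?_
        simp only [eval_arity]
        split_ifs with hx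
        · rfl
        · simp only [(hK _ _).head_zero, insertSum_zero, smul_zero]
      rw [Seq.ins_splitSum]
      refine Seq.splitSum_congr _ fun C d d' h x v _ => ?_
      simp only [Seq.ins_smul, hL.totalDeg_eq]
      congr 1
      have ih' : ∀ g : a.Hom C B (d + q), _ := fun g => ih (N - j) v (fun t ht y =>
        K (d + q - 1 + t) (by simp only [totalDeg_cons]; omega) (Seq.cons g y rfl))
        (fun t ht => (hK _ _).tail g rfl)
      simp only [ih', sub_add_eq_add_sub]
      -- Everything to the right of the segment depends additively on the value `g` of `ψ`, so the
      -- sum over insertions inside the segment can be pulled into that value.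
      let S (g : a.Hom C B (d + q)) : G := insertSum L' v fun t ht y => y.ins δ (N + n - j) fun y' =>
        K (d + q - 1 + t) (by rw [hL.totalDeg_eq] at ht; simp only [totalDeg_cons]; omega)
          (Seq.cons g y' rfl)
      have hS : ∀ g g', S (g + g') = S g + S g' := by
        intro g g'
        simp only [S, (hK _ _).head_add, Seq.ins_add, insertSum_add]
      exact (Seq.map_ins δ (AddMonoidHom.mk' S hS) j x fun x' => ψ.eval x' rfl).symm
    -- Neither of the lengths `N` and `N + n + 1 - j` bounds the other, so `m` bounds both. At `m =
    -- 0` both are negative and both sides vanish.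
    suffices ∀ (m : ℕ) {A B e} (N : ℤ) (s : Seq a A B e)
        (K : ∀ t, e + totalDeg (⟨q, ψ.arity j⟩ :: L) = t → Seq a A B t → G)
        (hK : ∀ t h, Seq.IsMultilinear (K t h)), N < m → N + n + 1 - j < m →
        (s.ins δ N fun y => insertSum (⟨q, ψ.arity j⟩ :: L) y K) =
          insertSum (⟨q, ψ.insert δ j⟩ :: L') s fun t ht y => y.ins δ (N + (n + 1 - j))
            (K t ((hL.cons j ψ).totalDeg_eq ▸ ht)) from
      this ((max N (N + n + 1 - j)).toNat + 1) N s K hK (by omega) (by omega)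
    intro m
    induction m with
    | zero =>
      intro A B e N s K hK h₁ h₂
      simp only [Seq.ins_of_neg _ h₁, Seq.ins_of_neg δ (show N + (n + 1 - j) < 0 by omega),
        insertSum_zero]
    | succ m ihm =>
      intro A B e N s K hK h₁ h₂
      have hδ := ihm (N - 1) s (fun t ht y => K t ht (y.consδ δ))
        (fun t ht => (hK t ht).consδ) (by omega) (by omega)
      rw [← add_sub_assoc] at hδ ⊢
      have hi : N - 1 + (n + 1) - j = N + (n + 1) - j - 1 := by omega
      -- Once `ψ` has swallowed an initial segment, its value is leftmost or some outer `δ` stands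
      -- to its left. The first case is `head`.
      have hhead : ∀ {A B e} (s : Seq a A B e)
          (K : ∀ t, e + totalDeg (⟨q, ψ.arity j⟩ :: L) = t → Seq a A B t → G)
          (hK : ∀ t h, Seq.IsMultilinear (K t h)),
          headSum ⟨q, ψ.insert δ j⟩ L' s (fun t ht y => y.ins δ (N + (n + 1) - j)
            (K t ((hL.cons j ψ).totalDeg_eq ▸ ht))) =
          (s.ins δ N fun y => headSum ⟨q, ψ.arity j⟩ L y K) +
            headSum ⟨q, ψ.insert δ j⟩ L' s fun t ht y => y.ins δ (N - 1 + (n + 1) - j)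
              fun y' => K t ((hL.cons j ψ).totalDeg_eq ▸ ht) (y'.consδ δ) := by
        intro A B e s K hK
        rw [head N s K hK, headSum]
        simp only [Seq.ins_cons _ (N + (n + 1) - j), insertSum_add, smul_add, Seq.splitSum_add]
        congr 1
        · simp only [show N + (n + 1) - j - 1 = N + n - j by omega]
        · simp only [hi, headSum]
      -- The leftmost item of a picture is the segment of `ψ`, an outer `δ`, or the first entry `f`
      -- of `s`; the three cases are `hhead`, `hδ` and `hf`.
      cases s with
      | nil he =>
        rw [insertSum_cons_nil, hhead _ _ hK, Seq.ins_nil _ N, Seq.ins_nil _ N]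
        simp only [insertSum_consδ, Seq.ins_add, insertSum_cons_nil] at hδ ⊢
        rw [hδ, add_assoc]
      | @cons _ _ d _ _ f s he =>
        have hsgn : (totalDeg (⟨q, ψ.arity j⟩ :: L) * (d - 1)).negOnePow =
            (totalDeg (⟨q, ψ.insert δ j⟩ :: L') * (d - 1)).negOnePow := by
          rw [(hL.cons j ψ).totalDeg_eq]
        have hf := ihm (N - 1) s (fun t ht y => K _ (by omega) (Seq.cons f y rfl))
          (fun t ht => (hK _ _).tail f rfl) (by omega) (by omega)
        rw [← add_sub_assoc] at hf
        rw [insertSum_cons_cons, hhead _ _ hK, Seq.ins_cons _ N, Seq.ins_cons _ N]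
        simp only [insertSum_consδ, insertSum_cons_cons, Seq.ins_add, Seq.ins_smul, hf]
        rw [hδ, insertSum_cons_cons]
        simp only [Seq.ins_cons _ (N + (n + 1) - j), insertSum_add, smul_add, hi]
        rw [hsgn]
        abel

end Cochain

theorem Seq.splitSum_sum {A B : a.Ob} {e : ℤ} {G : Type*} [AddCommGroup G] {ι : Type*}
    (S : Finset ι) (s : Seq a A B e)
    (F : ι → ∀ (C : a.Ob) (d d' : ℤ), d + d' = e → Seq a C B d → Seq a A C d' → G) :
    splitSum s (fun C d d' h u v => ∑ l ∈ S, F l C d d' h u v) = ∑ l ∈ S, splitSum s (F l) := by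
  classical
  induction S using Finset.induction_on with
  | empty => exact splitSum_zero s
  | insert l S hl ih => simp only [Finset.sum_insert hl, splitSum_add, ih]

theorem Cochain.insertSum_sum {A B : a.Ob} {e : ℤ} {G : Type*} [AddCommGroup G] {ι : Type*}
    (S : Finset ι) (ψs : List (Σ q, a.Cochain q)) (s : Seq a A B e)
    (K : ι → ∀ t, e + totalDeg ψs = t → Seq a A B t → G) :
    insertSum ψs s (fun t h y => ∑ l ∈ S, K l t h y) = ∑ l ∈ S, insertSum ψs s (K l) := by
  classical
  induction S using Finset.induction_on with
  | empty => exact insertSum_zero ψs s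
  | insert l S hl ih => simp only [Finset.sum_insert hl, insertSum_add, ih]

/-! ### Matrix sums with the signs of the bar construction -/

section barPathSum

variable {M : (Free.{u, v, w, x} a).Ob} (i : M.I) {G H : Type*} [AddCommGroup G] [AddCommGroup H]

open Classical in
/-- The sum of `pathSum`, with the Koszul signs for the shifted degrees `|f_r| - 1`. -/
noncomputable def barPathSum {M : (Free.{u, v, w, x} a).Ob} (i : M.I) {G : Type*}
    [AddCommGroup G] : {N : (Free.{u, v, w, x} a).Ob} → {e : ℤ} → Seq (Free a) M N e →
    (∀ (j : N.I) (t : ℤ), e + N.deg j - M.deg i = t → Seq a (M.obj i) (N.obj j) t → G) → G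
  | _, _, .nil h, K => K i 0 (by omega) (.nil rfl)
  | N, _, .cons (B := Q) (d := d) f s h, K =>
      barPathSum i s fun l t ht y => (f l).sum fun j g =>
        ((d + N.deg j - Q.deg l - 1) * (Q.deg l - M.deg i)).negOnePow •
          K j (d + N.deg j - Q.deg l - 1 + t) (by omega) (.cons g y rfl)

variable {N : (Free.{u, v, w, x} a).Ob} {e : ℤ}

theorem barPathSum_congr (s : Seq (Free a) M N e)
    {K K' : ∀ (j : N.I) (t : ℤ), e + N.deg j - M.deg i = t → Seq a (M.obj i) (N.obj j) t → G}
    (h : ∀ j t ht y, y.length = s.length → K j t ht y = K' j t ht y) :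
    barPathSum i s K = barPathSum i s K' := by
  classical
  induction s with
  | nil he => exact h _ _ _ _ rfl
  | cons f s he ih =>
    refine ih fun l t ht y hy => Finset.sum_congr rfl fun j _ => ?_
    exact congrArg _ (h _ _ _ _ (by simp only [Seq.length, hy]))

theorem pathSum_congr (s : Seq (Free a) M N e)
    {K K' : ∀ (j : N.I) (t : ℤ), e + N.deg j - M.deg i = t → Seq a (M.obj i) (N.obj j) t → G}
    (h : ∀ j t ht y, y.length = s.length → K j t ht y = K' j t ht y) :
    pathSum i s K = pathSum i s K' := by
  classical
  induction s with
  | nil he => exact h _ _ _ _ rfl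
  | cons f s he ih =>
    refine ih fun l t ht y hy => Finset.sum_congr rfl fun j _ => ?_
    exact congrArg _ (h _ _ _ _ (by simp only [Seq.length, hy]))

theorem map_barPathSum (L : G →+ H) (s : Seq (Free a) M N e)
    (K : ∀ (j : N.I) (t : ℤ), e + N.deg j - M.deg i = t → Seq a (M.obj i) (N.obj j) t → G) :
    L (barPathSum i s K) = barPathSum i s fun j t h y => L (K j t h y) := by
  classical
  induction s with
  | nil he => rfl
  | cons f s he ih =>
    refine (ih _).trans (barPathSum_congr i s fun l t ht y _ => ?_)
    exact (map_sum L _ _).trans (Finset.sum_congr rfl fun j _ => map_zsmul L _ _)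

theorem barPathSum_add (s : Seq (Free a) M N e)
    (K K' : ∀ (j : N.I) (t : ℤ), e + N.deg j - M.deg i = t → Seq a (M.obj i) (N.obj j) t → G) :
    barPathSum i s (fun j t h y => K j t h y + K' j t h y) =
      barPathSum i s K + barPathSum i s K' := by
  classical
  induction s with
  | nil he => rfl
  | cons f s he ih =>
    refine (barPathSum_congr i s fun l t ht y _ => ?_).trans (ih _ _)
    simp only [DFinsupp.sum, smul_add, Finset.sum_add_distrib]

theorem barPathSum_smul (c : ℤˣ) (s : Seq (Free a) M N e)
    (K : ∀ (j : N.I) (t : ℤ), e + N.deg j - M.deg i = t → Seq a (M.obj i) (N.obj j) t → G) :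
    barPathSum i s (fun j t h y => c • K j t h y) = c • barPathSum i s K :=
  (map_barPathSum i (DistribSMul.toAddMonoidHom G c) s K).symm

/-- Replacing `|f_r|` by `|f_r| - 1` contributes `∑ (deg k_l - deg k_0)` over the intermediate
indices, that is `∑ (n - r) s_r`. The suspension exponents of the path and of `s` differ by `∑ (r -
1) s_r`, and the two sums add up to `(n - 1) ∑ s_r`. -/
theorem pathSum_eq_barPathSum (s : Seq (Free a) M N e)
    (K : ∀ (j : N.I) (t : ℤ), e + N.deg j - M.deg i = t → Seq a (M.obj i) (N.obj j) t → G) :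
    pathSum i s K = barPathSum i s fun j t h y =>
      (y.suspExp - s.suspExp + (s.length - 1) * (N.deg j - M.deg i)).negOnePow • K j t h y := by
  classical
  induction s with
  | nil he => simp [pathSum, barPathSum, Seq.suspExp]
  | @cons Q N d e t f s he ih =>
    refine (ih _).trans (barPathSum_congr i s fun l t ht y hy => ?_)
    simp only [DFinsupp.sum, Finset.smul_sum, smul_smul, ← Int.negOnePow_add]
    refine Finset.sum_congr rfl fun j _ => ?_
    congr 1
    rw [Int.negOnePow_eq_iff]
    simp only [Seq.suspExp, Seq.length, hy]
    push_cast
    exact ⟨-s.length * (N.deg j - Q.deg l), by ring⟩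

/-- A path along `s` is a path along `v` followed by one along `u`. The sign moves the total shift
of the first past the second, of bar degree `t`. -/
theorem barPathSum_splitSum (s : Seq (Free a) M N e)
    (F : ∀ (j : N.I) (t : ℤ), e + N.deg j - M.deg i = t → ∀ (C : a.Ob) (d d' : ℤ), d + d' = t →
      Seq a C (N.obj j) d → Seq a (M.obj i) C d' → G) :
    (barPathSum i s fun j t h y => y.splitSum (F j t h)) =
      s.splitSum fun (Q : (Free.{u, v, w, x} a).Ob) D D' _ u v => barPathSum i v fun l t' _ v' => barPathSum l u fun j t _ u' =>
        (t * (Q.deg l - M.deg i)).negOnePow •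
          F j (t + t') (by omega) _ t t' rfl u' v' := by
  classical
  have hF : ∀ {N : (Free.{u, v, w, x} a).Ob} {e : ℤ} (F : ∀ (j : N.I) (t : ℤ),
      e + N.deg j - M.deg i = t → ∀ (C : a.Ob) (d d' : ℤ), d + d' = t →
      Seq a C (N.obj j) d → Seq a (M.obj i) C d' → G) j t₁ t₂ (_ : t₁ = t₂) h₁ h₂ C d d' p₁ p₂ u v,
      F j t₁ h₁ C d d' p₁ u v = F j t₂ h₂ C d d' p₂ u v := by
    intro N e F j t₁ t₂ ht h₁ h₂ C d d' p₁ p₂ u v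
    subst ht
    rfl
  induction s with
  | nil he =>
    simp only [barPathSum, Seq.splitSum, zero_mul, Int.negOnePow_zero, one_smul]
    rfl
  | @cons Q N d e t f s he ih =>
    trans (barPathSum i (.cons f s he) fun j t h y => F j t h _ 0 t (zero_add t) (.nil rfl) y) +
      barPathSum i s fun l t ht y => y.splitSum fun C d₁ d₂ h' u v => (f l).sum fun j g =>
        ((d + N.deg j - Q.deg l - 1) * (Q.deg l - M.deg i)).negOnePow •
          F j (d + N.deg j - Q.deg l - 1 + t) (by omega) C (d + N.deg j - Q.deg l - 1 + d₁) d₂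
            (by omega) (.cons g u rfl) v
    · rw [barPathSum, barPathSum, ← barPathSum_add]
      refine barPathSum_congr i s fun l t ht y _ => ?_
      simp only [DFinsupp.sum, Seq.splitSum, Seq.splitSum_sum, Seq.splitSum_smul, smul_add,
        Finset.sum_add_distrib]
    rw [Seq.splitSum, ih]
    congr 1
    · refine barPathSum_congr i _ fun l t' ht y _ => ?_
      simp only [barPathSum, zero_mul, Int.negOnePow_zero, one_smul]
      exact hF F l _ _ (zero_add t').symm _ _ _ _ _ _ _ _ _
    · refine Seq.splitSum_congr _ fun C d₁ d₂ h u v _ => barPathSum_congr i v fun l t ht y _ => ?_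
      rw [barPathSum]
      refine barPathSum_congr l u fun l' t' ht' y' _ => ?_
      simp only [DFinsupp.sum, Finset.smul_sum, smul_smul, ← Int.negOnePow_add]
      refine Finset.sum_congr rfl fun j _ => ?_
      rw [hF F j (d + N.deg j - Q.deg l' - 1 + (t' + t)) (d + N.deg j - Q.deg l' - 1 + t' + t)
        (by ring)]
      · congr 2
        ring
      · omega
      · rfl

end barPathSum

/-! ### The canonical extension to `Free(a)` preserves braces -/

namespace Cochain

open Classical in
/-- The relation between a cochain `ψ` and its canonical extension to `Free(a)`, both written as
in `Cochain.susp`. -/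
def IsBarExtension {q : ℤ} (ψ : a.Cochain q) (ψ' : (Free.{u, v, w, x} a).Cochain q) : Prop :=
  ∀ {M N : (Free.{u, v, w, x} a).Ob} {e t : ℤ} (s : Seq (Free a) M N e) (h : e + q = t) (i : M.I),
    ψ'.eval s h i = barPathSum i s fun j t' _ y => DFinsupp.single j
      (((N.deg j - M.deg i) * (q - 1)).negOnePow •
        ψ.eval y (t := t + N.deg j - M.deg i) (by omega))

/-- The suspension signs on `a` and on `Free(a)` absorb the dependence on the arity: `p - n` becomes
`q - 1`. This uniform sign is why braces are compared in bar form. -/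
theorem isBarExtension_susp {q : ℤ} (ψ : a.Cochain q) :
    IsBarExtension ψ.susp (Cochain.extend.{u, v, w, x} ψ).susp := by
  classical
  intro M N e t s h i
  trans (s.length * (q - s.length) + s.suspExp : ℤ).negOnePow •
    pathSum i s (G := Π₀ j : N.I, a.Hom (M.obj i) (N.obj j) (t + N.deg j - M.deg i))
      fun j t' _ y => DFinsupp.single j (((N.deg j - M.deg i) * (q - s.length)).negOnePow •
        ψ.eval y (t := t + N.deg j - M.deg i) (by omega))
  · rfl
  rw [pathSum_eq_barPathSum, ← barPathSum_smul]
  refine barPathSum_congr i s fun j t' ht' y hy => ?_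
  rw [← DFinsupp.single_smul, ← DFinsupp.single_smul]
  refine congrArg (DFinsupp.single j) ?_
  change _ = _ • ((y.length * (q - y.length) + y.suspExp : ℤ).negOnePow • ψ.eval y _)
  simp only [smul_smul, ← Int.negOnePow_add, hy]
  congr 2
  ring

/-- `ExtendRel L L'`: the list `L'` consists of the canonical extensions of the cochains in `L`,
written as in `Cochain.susp`. -/
inductive ExtendRel : List (Σ q, a.Cochain q) → List (Σ q, (Free.{u, v, w, x} a).Cochain q) → Prop
  | nil : ExtendRel [] []
  | cons {L : List (Σ q, a.Cochain q)} {L' : List (Σ q, (Free.{u, v, w, x} a).Cochain q)} {q : ℤ}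
      (ψ : a.Cochain q) (ψ' : (Free.{u, v, w, x} a).Cochain q) (hψ : IsBarExtension ψ ψ')
      (h : ExtendRel L L') : ExtendRel (⟨q, ψ⟩ :: L) (⟨q, ψ'⟩ :: L')

theorem ExtendRel.totalDeg_eq {L : List (Σ q, a.Cochain q)}
    {L' : List (Σ q, (Free.{u, v, w, x} a).Cochain q)} (h : ExtendRel L L') :
    totalDeg L' = totalDeg L := by
  induction h with
  | nil => rfl
  | cons ψ ψ' hψ h ih => simp only [totalDeg_cons, ih]

/-- As in matrix multiplication, the indices strictly inside the segment of a cochain are summed by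
its extension, and the remaining indices by the outer path sum. Moving the total shift `N.deg j -
M.deg i` past all inserted cochains gives the sign on the left. -/
theorem barPathSum_insertSum {G : Type*} [AddCommGroup G] [Module k G]
    {L : List (Σ q, a.Cochain q)} {L' : List (Σ q, (Free.{u, v, w, x} a).Cochain q)}
    (hL : ExtendRel L L') {M N : (Free.{u, v, w, x} a).Ob} {e : ℤ} (i : M.I)
    (s : Seq (Free a) M N e)
    (K : ∀ (j : N.I) (t : ℤ), e + totalDeg L + N.deg j - M.deg i = t →
      Seq a (M.obj i) (N.obj j) t → G) (hK : ∀ j t h, Seq.IsMultilinear (K j t h)) :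
    (barPathSum i s fun j t _ y => (totalDeg L * (N.deg j - M.deg i)).negOnePow •
        insertSum L y fun t' _ y' => K j t' (by omega) y') =
      insertSum L' s fun t ht y => barPathSum i y fun j t' ht' y' => K j t'
        (by rw [hL.totalDeg_eq] at ht; omega) y' := by
  classical
  induction hL generalizing N e with
  | nil => simp [insertSum]
  | @cons L L' q ψ ψ' hψ hL ih =>
    have head : ∀ {N : (Free.{u, v, w, x} a).Ob} {e : ℤ} (s : Seq (Free a) M N e)
        (K : ∀ (j : N.I) (t : ℤ), e + totalDeg (⟨q, ψ⟩ :: L) + N.deg j - M.deg i = t →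
          Seq a (M.obj i) (N.obj j) t → G) (hK : ∀ j t h, Seq.IsMultilinear (K j t h)),
        (barPathSum i s fun j t _ y =>
          (totalDeg (⟨q, ψ⟩ :: L) * (N.deg j - M.deg i)).negOnePow •
            headSum ⟨q, ψ⟩ L y fun t' _ y' => K j t' (by omega) y') =
          headSum ⟨q, ψ'⟩ L' s fun t ht y => barPathSum i y fun j t' ht' y' => K j t'
            (by rw [(hL.cons ψ ψ' hψ).totalDeg_eq] at ht; omega) y' := by
      intro N e s K hK
      simp only [headSum, ← Seq.splitSum_smul, barPathSum_splitSum]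
      refine Seq.splitSum_congr _ fun (Q : (Free.{u, v, w, x} a).Ob) D D' h x v _ => ?_
      simp only [barPathSum]
      have hK' : ∀ (l : Q.I) (j : N.I) (g₁ g₂ : a.Hom (Q.obj l) (N.obj j)
          (D + q + N.deg j - Q.deg l)) t (ht : D' + totalDeg L + Q.deg l - M.deg i = t)
          (y : Seq a (M.obj i) (Q.obj l) t), _ := fun l j g₁ g₂ t ht y =>
        (hK j (D + q + N.deg j - Q.deg l - 1 + t) (by simp only [totalDeg_cons]; omega)).head_add
          g₁ g₂ y rfl
      have hK₀ : ∀ (l : Q.I) (j : N.I) t (ht : D' + totalDeg L + Q.deg l - M.deg i = t)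
          (y : Seq a (M.obj i) (Q.obj l) t), _ := fun l j t ht y =>
        (hK j (D + q + N.deg j - Q.deg l - 1 + t) (by simp only [totalDeg_cons]; omega)).head_zero
          (d := D + q + N.deg j - Q.deg l) y rfl
      have hsum : ∀ (l : Q.I) (f g : Π₀ j, a.Hom (Q.obj l) (N.obj j) (D + q + N.deg j - Q.deg l))
          t (ht : D' + totalDeg L + Q.deg l - M.deg i = t) (y : Seq a (M.obj i) (Q.obj l) t),
          ((f + g).sum fun j g =>
            ((D + q + N.deg j - Q.deg l - 1) * (Q.deg l - M.deg i)).negOnePow •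
              K j (D + q + N.deg j - Q.deg l - 1 + t) (by simp only [totalDeg_cons]; omega)
                (.cons g y rfl)) =
          (f.sum fun j g =>
            ((D + q + N.deg j - Q.deg l - 1) * (Q.deg l - M.deg i)).negOnePow •
              K j (D + q + N.deg j - Q.deg l - 1 + t) (by simp only [totalDeg_cons]; omega)
                (.cons g y rfl)) +
          (g.sum fun j g =>
            ((D + q + N.deg j - Q.deg l - 1) * (Q.deg l - M.deg i)).negOnePow •
              K j (D + q + N.deg j - Q.deg l - 1 + t) (by simp only [totalDeg_cons]; omega)
                (.cons g y rfl)) := by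
        intro l f g t ht y
        refine DFinsupp.sum_add_index (fun j => ?_) fun j b₁ b₂ => ?_
        · rw [hK₀ l j t ht y, smul_zero]
        · rw [hK' l j b₁ b₂ t ht y, smul_add]
      have ih' := ih v (fun l t ht y => (ψ'.eval x rfl l).sum fun j g =>
        ((D + q + N.deg j - Q.deg l - 1) * (Q.deg l - M.deg i)).negOnePow •
        K j (D + q + N.deg j - Q.deg l - 1 + t) (by simp only [totalDeg_cons]; omega)
          (.cons g y rfl)) (by
            intro l t ht c y₁ y₂ y₃ hy
            simp only [DFinsupp.sum, Finset.smul_sum, ← Finset.sum_add_distrib]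
            refine Finset.sum_congr rfl fun j _ => ?_
            rw [smul_comm c, ← smul_add]
            exact congrArg _ (hK j _ _ c _ _ _ (.tail _ rfl hy)))
      refine Eq.trans ?_ (congrArg _ ih')
      rw [← barPathSum_smul]
      refine barPathSum_congr i v fun l t ht v' _ => ?_
      -- The rest of the expression is additive in column `l` of the value of `ψ'`, so the path sum
      -- which defines that column can be pulled out.
      let Φ : (Π₀ j, a.Hom (Q.obj l) (N.obj j) (D + q + N.deg j - Q.deg l)) →+ G :=
        AddMonoidHom.mk' (fun f => insertSum L v' fun t' ht' y => f.sum fun j g =>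
          ((D + q + N.deg j - Q.deg l - 1) * (Q.deg l - M.deg i)).negOnePow •
            K j (D + q + N.deg j - Q.deg l - 1 + t') (by simp only [totalDeg_cons]; omega)
              (.cons g y rfl)) fun f g =>
          (congrArg (insertSum L v') (by
            funext t' ht' y
            exact hsum l f g t' (by omega) y)).trans (insertSum_add L v' _ _)
      have hΦ := map_barPathSum l Φ x fun j t' _ y => DFinsupp.single j
        (((N.deg j - Q.deg l) * (q - 1)).negOnePow •
          ψ.eval y (t := D + q + N.deg j - Q.deg l) (by omega))
      rw [← hψ x rfl l] at hΦ
      refine Eq.trans ?_ (congrArg (fun z => (totalDeg L' * D).negOnePow •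
        (totalDeg L * (Q.deg l - M.deg i)).negOnePow • z) hΦ.symm)
      rw [← barPathSum_smul, ← barPathSum_smul]
      refine barPathSum_congr l x fun j t' ht' x' _ => ?_
      have hcast : ∀ d₁ d₂ (_ : d₁ = d₂) (h₁ : t' + q = d₁) (h₂ : t' + q = d₂) t''
          (ht'' : t + totalDeg L = t'') y,
          K j (d₁ - 1 + t'') (by simp only [totalDeg_cons]; omega) (.cons (ψ.eval x' h₁) y rfl) =
          K j (d₂ - 1 + t'') (by simp only [totalDeg_cons]; omega) (.cons (ψ.eval x' h₂) y rfl) := by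
        intro d₁ d₂ hd
        subst hd
        intros
        rfl
      have hu : ∀ (c : ℤˣ) f, Φ (c • f) = c • Φ f := fun c f => map_zsmul Φ _ _
      rw [DFinsupp.single_smul, hu]
      have hΦs : ∀ g, Φ (DFinsupp.single j g) = insertSum L v' fun t' ht' y =>
          ((D + q + N.deg j - Q.deg l - 1) * (Q.deg l - M.deg i)).negOnePow •
            K j (D + q + N.deg j - Q.deg l - 1 + t') (by simp only [totalDeg_cons]; omega)
              (.cons g y rfl) := by
        intro g
        refine congrArg (insertSum L v') ?_
        funext t' ht' y
        refine DFinsupp.sum_single_index ?_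
        rw [hK₀ l j t' (by omega) y, smul_zero]
      rw [hΦs, insertSum_smul]
      simp only [smul_smul, ← Int.negOnePow_add, hL.totalDeg_eq]
      congr 1
      · rw [Int.negOnePow_eq_iff]
        simp only [totalDeg_cons]
        subst ht'
        exact ⟨totalDeg L * (N.deg j - Q.deg l), by ring⟩
      · refine congrArg (insertSum L v') ?_
        funext t'' ht'' y
        exact hcast _ _ (by omega) _ _ _ (by omega) _
    induction s with
    | nil he =>
      rw [insertSum_cons_nil, ← head _ K hK]
      simp only [barPathSum, insertSum_cons_nil]
    | @cons Q N d e t f s he ihs =>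
      rw [insertSum_cons_cons, ← head _ K hK]
      have ihs' := ihs (fun l t ht y => (f l).sum fun j g =>
        ((d + N.deg j - Q.deg l - 1) * (Q.deg l - M.deg i)).negOnePow •
        K j (d + N.deg j - Q.deg l - 1 + t) (by omega) (.cons g y rfl)) (by
            intro l t ht c y₁ y₂ y₃ hy
            simp only [DFinsupp.sum, Finset.smul_sum, ← Finset.sum_add_distrib]
            refine Finset.sum_congr rfl fun j _ => ?_
            rw [smul_comm c, ← smul_add]
            exact congrArg _ (hK j _ _ c _ _ _ (.tail _ rfl hy)))
      refine Eq.trans ?_ (congrArg (fun z => _ + (totalDeg (⟨q, ψ'⟩ :: L') * (d - 1)).negOnePow • z)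
        ihs')
      rw [← barPathSum_smul]
      simp only [barPathSum]
      rw [← barPathSum_add]
      refine barPathSum_congr i s fun l t ht y _ => ?_
      simp only [DFinsupp.sum, insertSum_sum, Finset.smul_sum, insertSum_cons_cons, smul_add,
        ← Finset.sum_add_distrib, insertSum_smul]
      refine Finset.sum_congr rfl fun j _ => congrArg _ ?_
      simp only [smul_smul, ← Int.negOnePow_add]
      congr 1
      · rw [Int.negOnePow_eq_iff]
        simp only [totalDeg_cons, hL.totalDeg_eq]
        exact ⟨(q - 1 + totalDeg L) * (N.deg j - Q.deg l), by ring⟩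

theorem eval_susp {p : ℤ} (φ : a.Cochain p) {A B : a.Ob} {e t : ℤ} (s : Seq a A B e)
    (h : e + p = t) : φ.susp.eval s h =
      (s.length * (p - s.length) + s.suspExp : ℤ).negOnePow • φ.eval s h := rfl

@[simp]
theorem susp_susp {p : ℤ} (φ : a.Cochain p) : φ.susp.susp = φ := by
  ext A B e t s h
  rw [eval_susp, eval_susp, smul_smul, Int.units_mul_self, one_smul]

theorem susp_injective {p : ℤ} : Function.Injective (susp : a.Cochain p → a.Cochain p) :=
  Function.LeftInverse.injective susp_susp

theorem susp_add {p : ℤ} (φ ψ : a.Cochain p) : (φ + ψ).susp = φ.susp + ψ.susp := by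
  ext A B e t s h
  exact smul_add _ _ _

theorem susp_smul {p : ℤ} (c : k) (φ : a.Cochain p) : (c • φ).susp = c • φ.susp := by
  ext A B e t s h
  exact smul_comm _ c _

theorem susp_arity {p : ℤ} (j : ℕ) (φ : a.Cochain p) : (φ.arity j).susp = φ.susp.arity j := by
  ext A B e t s h
  rw [eval_arity, eval_susp, eval_susp, eval_arity, smul_ite, smul_zero]

theorem eval_suspBrace {p t : ℤ} (φ : a.Cochain p) (ψs : List (Σ q, a.Cochain q))
    (h : p + totalDeg ψs = t) {A B : a.Ob} {e t' : ℤ} (s : Seq a A B e) (h' : e + t = t') :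
    (φ.suspBrace ψs h).eval s h' = insertSum ψs s fun _ hy y => φ.eval y (by omega) := rfl

theorem totalDeg_ofFn {r : ℕ} {q : Fin r → ℤ} (ψ : ∀ j, a.Cochain (q j)) :
    totalDeg (List.ofFn fun j => (⟨q j, ψ j⟩ : Σ q, a.Cochain q)) = ∑ j, (q j - 1) := by
  simp [totalDeg, List.map_ofFn, List.sum_ofFn, Function.comp_def]

theorem susp_brace {p : ℤ} {r : ℕ} {q : Fin r → ℤ} (φ : a.Cochain p)
    (ψ : ∀ j, a.Cochain (q j)) : (φ.brace ψ).susp =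
      φ.susp.suspBrace (List.ofFn fun j => ⟨q j, (ψ j).susp⟩) (by rw [totalDeg_ofFn]) :=
  susp_susp _

/-! ### Braces and the canonical extension -/

theorem extendRel_ofFn {r : ℕ} {q : Fin r → ℤ} (ψ : ∀ j, a.Cochain (q j))
    (ψ' : ∀ j, (Free.{u, v, w, x} a).Cochain (q j)) (h : ∀ j, IsBarExtension (ψ j) (ψ' j)) :
    ExtendRel (List.ofFn fun j => ⟨q j, ψ j⟩) (List.ofFn fun j => ⟨q j, ψ' j⟩) := by
  induction r with
  | zero => simpa using ExtendRel.nil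
  | succ r ih =>
    rw [List.ofFn_succ, List.ofFn_succ]
    exact .cons _ _ (h 0) (ih _ _ fun j => h j.succ)

theorem extend_brace {p : ℤ} {r : ℕ} {q : Fin r → ℤ} (φ : a.Cochain p)
    (ψ : ∀ j, a.Cochain (q j)) : Cochain.extend.{u, v, w, x} (φ.brace ψ) =
      φ.extend.brace fun j => (ψ j).extend := by
  classical
  apply susp_injective
  rw [susp_brace]
  ext M N e t s h
  funext i
  rw [isBarExtension_susp, eval_suspBrace]
  have hL := extendRel_ofFn (fun j => (ψ j).susp) (fun j => (ψ j).extend.susp)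
    fun j => isBarExtension_susp.{u, v, w, x} (ψ j)
  -- Column `i` is taken before the path sums are compared; the value of `φ` is then placed in row
  -- `j`.
  let Φ : (Free.{u, v, w, x} a).Hom M N t →+
    Π₀ j : N.I, a.Hom (M.obj i) (N.obj j) (t + N.deg j - M.deg i) := AddMonoidHom.mk' (fun f => f i) fun _ _ => rfl
  refine Eq.trans ?_ (map_insertSum Φ _ s _).symm
  have hΦ : ∀ e' (h' : e' + p = t) (y : Seq (Free.{u, v, w, x} a) M N e'),
    Φ (φ.extend.susp.eval y h') = _ := fun e' h' y => isBarExtension_susp φ y h' i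
  simp only [hΦ]
  have hK := barPathSum_insertSum hL i s (fun j t' _ y => DFinsupp.single j
    (((N.deg j - M.deg i) * (p - 1)).negOnePow •
      φ.susp.eval y (t := t + N.deg j - M.deg i) (by rw [totalDeg_ofFn] at *; omega))) (by
    intro j t' ht c x y z hr
    have h := φ.susp.eval_multilinear (t := t + N.deg j - M.deg i)
      (by rw [totalDeg_ofFn] at *; omega) c x y z hr
    beta_reduce at h ⊢
    rw [h, smul_add, smul_comm _ c, DFinsupp.single_add,
      DFinsupp.single_smul c])
  refine Eq.trans ?_ hK
  refine barPathSum_congr i s fun j t' ht y _ => ?_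
  let Ψ : a.Hom (M.obj i) (N.obj j) (t + N.deg j - M.deg i) →+
    Π₀ j : N.I, a.Hom (M.obj i) (N.obj j) (t + N.deg j - M.deg i) :=
    DFinsupp.singleAddHom
      (fun j : N.I => a.Hom (M.obj i) (N.obj j) (t + N.deg j - M.deg i)) j
  rw [susp_brace, eval_suspBrace]
  have := map_insertSum Ψ (List.ofFn fun j => ⟨q j, (ψ j).susp⟩) y
    fun t'' ht'' y => ((N.deg j - M.deg i) * (p - 1)).negOnePow •
      φ.susp.eval y (t := t + N.deg j - M.deg i) (by rw [totalDeg_ofFn] at *; omega)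
  refine Eq.trans ?_ (congrArg _ this)
  rw [insertSum_smul]
  refine Eq.trans ?_ (DFinsupp.single_smul ..)
  rw [smul_smul, ← Int.negOnePow_add]
  refine congrArg (DFinsupp.single j) (congrArg (fun z => Int.negOnePow z • _) ?_)
  rw [totalDeg_ofFn]
  ring

end Cochain

/-! ### Restriction to full subquivers preserves braces -/

section full

variable {b : GradedQuiver.{u, v, w} k} {X : Type x} {F : X → b.Ob}

namespace Seq

variable {A B : (full b F).Ob} {e : ℤ}

@[simp]
theorem length_ofFull (s : Seq (full b F) A B e) : s.ofFull.length = s.length := by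
  induction s with
  | nil h => rfl
  | cons f s h ih => exact congrArg (· + 1) ih

@[simp]
theorem suspExp_ofFull (s : Seq (full b F) A B e) : s.ofFull.suspExp = s.suspExp := by
  induction s with
  | nil h => rfl
  | cons f s h ih => simp only [ofFull, suspExp, ih, length_ofFull]

theorem splitSum_ofFull {G : Type*} [AddCommGroup G] (s : Seq (full b F) A B e)
    (K : ∀ (C : b.Ob) (d d' : ℤ), d + d' = e → Seq b C (F B) d → Seq b (F A) C d' → G) :
    splitSum s.ofFull K =
      splitSum s fun C d d' h u v => K (F C) d d' h u.ofFull v.ofFull := by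
  induction s with
  | nil h => rfl
  | cons f s h ih =>
    rw [ofFull, splitSum, splitSum, ih]
    rfl

end Seq

namespace Cochain

theorem eval_toFull {p : ℤ} (φ : b.Cochain p) {A B : (full b F).Ob} {e t : ℤ}
    (s : Seq (full b F) A B e) (h : e + p = t) : φ.toFull.eval s h = φ.eval s.ofFull h := rfl

theorem susp_toFull {p : ℤ} (φ : b.Cochain p) :
    (φ.toFull (F := F)).susp = φ.susp.toFull := by
  ext A B e t s h
  rw [eval_susp, eval_toFull, eval_toFull, eval_susp, Seq.length_ofFull, Seq.suspExp_ofFull]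
  rfl

/-- `FullRel L L'`: the list `L'` consists of the restrictions of the cochains in `L`. -/
inductive FullRel : List (Σ q, b.Cochain q) → List (Σ q, (full b F).Cochain q) → Prop
  | nil : FullRel [] []
  | cons {L : List (Σ q, b.Cochain q)} {L' : List (Σ q, (full b F).Cochain q)} {q : ℤ}
      (ψ : b.Cochain q) (h : FullRel L L') : FullRel (⟨q, ψ⟩ :: L) (⟨q, ψ.toFull⟩ :: L')

theorem FullRel.totalDeg_eq {L : List (Σ q, b.Cochain q)}
    {L' : List (Σ q, (full b F).Cochain q)} (h : FullRel L L') : totalDeg L' = totalDeg L := by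
  induction h with
  | nil => rfl
  | cons ψ h ih => simp only [totalDeg_cons, ih]

theorem fullRel_ofFn {r : ℕ} {q : Fin r → ℤ} (ψ : ∀ j, b.Cochain (q j))
    (ψ' : ∀ j, (full b F).Cochain (q j)) (h : ∀ j, ψ' j = (ψ j).toFull) :
    FullRel (List.ofFn fun j => ⟨q j, ψ j⟩) (List.ofFn fun j => ⟨q j, ψ' j⟩) := by
  obtain rfl : ψ' = fun j => (ψ j).toFull := funext h
  clear h
  induction r with
  | zero => simpa using FullRel.nil
  | succ r ih =>
    rw [List.ofFn_succ, List.ofFn_succ]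
    exact .cons _ (ih fun j => ψ j.succ)

theorem insertSum_ofFull {G : Type*} [AddCommGroup G] {L : List (Σ q, b.Cochain q)}
    {L' : List (Σ q, (full b F).Cochain q)} (hL : FullRel L L') {A B : (full b F).Ob} {e : ℤ}
    (s : Seq (full b F) A B e) (K : ∀ t, e + totalDeg L = t → Seq b (F A) (F B) t → G) :
    insertSum L s.ofFull K = insertSum L' s fun t ht y => K t (hL.totalDeg_eq ▸ ht) y.ofFull := by
  induction hL generalizing A B e with
  | nil => rfl
  | @cons L L' q ψ hL ih =>
    have head : ∀ {A B : (full b F).Ob} {e : ℤ} (s : Seq (full b F) A B e)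
        (K : ∀ t, e + totalDeg (⟨q, ψ⟩ :: L) = t → Seq b (F A) (F B) t → G),
        headSum ⟨q, ψ⟩ L s.ofFull K = headSum ⟨q, ψ.toFull⟩ L' s fun t ht y =>
          K t ((hL.cons ψ).totalDeg_eq ▸ ht) y.ofFull := by
      intro A B e s K
      rw [headSum, Seq.splitSum_ofFull, headSum]
      refine Seq.splitSum_congr s fun C d d' h u v _ => ?_
      have hsgn : (totalDeg L * d).negOnePow = (totalDeg L' * d).negOnePow := by
        rw [hL.totalDeg_eq]
      rw [ih, hsgn]
      rfl
    induction s with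
    | nil h =>
      rw [Seq.ofFull, insertSum_cons_nil, insertSum_cons_nil, ← head]
      rfl
    | @cons Q B d e t f s h ihs =>
      have hsgn : (totalDeg (⟨q, ψ⟩ :: L) * (d - 1)).negOnePow =
          (totalDeg (⟨q, ψ.toFull⟩ :: L' : List (Σ q, (full b F).Cochain q)) *
            (d - 1)).negOnePow := by
        rw [(hL.cons ψ).totalDeg_eq]
      rw [Seq.ofFull, insertSum_cons_cons, ihs, insertSum_cons_cons, ← head, hsgn]
      rfl

theorem toFull_brace {p : ℤ} {r : ℕ} {q : Fin r → ℤ} (φ : b.Cochain p)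
    (ψ : ∀ j, b.Cochain (q j)) : (φ.brace ψ).toFull (F := F) =
      φ.toFull.brace fun j => (ψ j).toFull := by
  apply susp_injective
  rw [susp_brace, susp_toFull, susp_brace]
  ext A B e t s h
  rw [eval_toFull, eval_suspBrace, eval_suspBrace, susp_toFull]
  exact insertSum_ofFull (fullRel_ofFn _ _ fun j => susp_toFull (ψ j)) s _

theorem extendTw_brace (P : Set (TwOb.{u, v, w, x} a)) {p : ℤ} {r : ℕ} {q : Fin r → ℤ}
    (φ : a.Cochain p) (ψ : ∀ j, a.Cochain (q j)) : (φ.brace ψ).extendTw P =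
      (φ.extendTw P).brace fun j => (ψ j).extendTw P := by
  rw [extendTw, extend_brace, toFull_brace]
  rfl

end Cochain

end full

/-! ### The twist of a cochain by `δ`, one arity at a time -/

theorem Seq.ins_of_lt {δ : ∀ A : a.Ob, a.Hom A A 1} {A B : a.Ob} {e : ℤ} {G : Type*}
    [AddCommGroup G] {N : ℤ} {s : Seq a A B e} (h : N < s.length) (K : Seq a A B e → G) :
    ins δ N s K = 0 := by
  rw [ins_congr δ N s (K' := fun _ => 0) fun y _ _ => by omega, ins_zero]

theorem Seq.ins_length (δ : ∀ A : a.Ob, a.Hom A A 1) {A B : a.Ob} {e : ℤ} {G : Type*}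
    [AddCommGroup G] (s : Seq a A B e) (K : Seq a A B e → G) :
    ins δ s.length s K = K s := by
  induction s with
  | nil h => exact ins_zero_nil δ h K
  | cons f s h ih =>
    rw [ins_cons, ins_of_lt (s := cons f s h) (by omega), add_zero]
    simpa [length] using ih fun y => K (cons f y h)

namespace Cochain

section twist

variable (δ : ∀ A : a.Ob, a.Hom A A 1)

/-- The cochain `∑_m φ_N{δ^{⊗m}}`, where `φ_N` is the arity `N` component of `φ`. -/
def twist {p : ℤ} (N : ℤ) : a.Cochain p →ₗ[k] a.Cochain p where
  toFun φ := (φ.susp.insert δ N).susp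
  map_add' φ ψ := by rw [susp_add, map_add, susp_add]
  map_smul' c φ := by rw [susp_smul, map_smul, susp_smul, RingHom.id_apply]

theorem susp_twist {p : ℤ} (N : ℤ) (φ : a.Cochain p) :
    (φ.twist δ N).susp = φ.susp.insert δ N :=
  susp_susp _

theorem insertRel_ofFn {r : ℕ} {q : Fin r → ℤ} (ψ : ∀ j, a.Cochain (q j)) (n : Fin r → ℕ) :
    InsertRel δ (List.ofFn fun j => ⟨q j, ((ψ j).arity (n j)).susp⟩)
      (List.ofFn fun j => ⟨q j, ((ψ j).twist δ (n j)).susp⟩) (r - ∑ j, (n j : ℤ)) := by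
  induction r with
  | zero => simpa using InsertRel.nil
  | succ r ih =>
    rw [List.ofFn_succ, List.ofFn_succ, Fin.sum_univ_succ, susp_arity, susp_twist]
    have := (ih (fun j => ψ j.succ) fun j => n j.succ).cons (n 0) (ψ 0).susp
    convert this using 1
    push_cast
    ring

/-- This is `ins_insertSum` conjugated by `susp`: of `N` entries, the cochains consume `∑ n j` and
give back `r`. -/
theorem twist_brace {p : ℤ} {r : ℕ} {q : Fin r → ℤ} (φ : a.Cochain p)
    (ψ : ∀ j, a.Cochain (q j)) (n : Fin r → ℕ) (N : ℤ) :
    (φ.brace fun j => (ψ j).arity (n j)).twist δ N =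
      (φ.twist δ (N + (r - ∑ j, (n j : ℤ)))).brace fun j => (ψ j).twist δ (n j) := by
  apply susp_injective
  rw [susp_twist, susp_brace, susp_brace, susp_twist]
  ext A B e t s h
  exact ins_insertSum δ (insertRel_ofFn δ ψ n) N s _ fun _ _ => φ.susp.eval_multilinear _

theorem eval_twist_congr {p : ℤ} {φ ψ : a.Cochain p} {N : ℤ} {A B : a.Ob} {e t : ℤ}
    (s : Seq a A B e) (h : e + p = t)
    (hφ : ∀ y : Seq a A B e, (y.length : ℤ) = N → φ.eval y h = ψ.eval y h) :
    (φ.twist δ N).eval s h = (ψ.twist δ N).eval s h := by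
  refine congrArg _ (Seq.ins_congr δ N s fun y hy _ => ?_)
  rw [eval_susp, eval_susp, hφ y hy]

theorem eval_twist_of_lt {p : ℤ} (φ : a.Cochain p) {N : ℤ} {A B : a.Ob} {e t : ℤ}
    {s : Seq a A B e} (hN : N < s.length) (h : e + p = t) : (φ.twist δ N).eval s h = 0 :=
  (congrArg (fun z => (s.length * (p - s.length) + s.suspExp : ℤ).negOnePow • z)
    (Seq.ins_of_lt hN _)).trans (smul_zero _)

theorem twist_of_neg {p : ℤ} (φ : a.Cochain p) {N : ℤ} (hN : N < 0) : φ.twist δ N = 0 := by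
  ext A B e t s h
  exact eval_twist_of_lt δ φ (by omega) h

end twist

/-! ### Braces with arity zero cochains -/

section arityZero

/-- A cochain which is of arity zero, with components `δ_A`. -/
structure IsArityZero (Δ : a.Cochain 1) (δ : ∀ A : a.Ob, a.Hom A A 1) : Prop where
  eval_nil : ∀ A, Δ.eval (.nil rfl : Seq a A A 0) (zero_add 1) = δ A
  eval_cons : ∀ {A B C : a.Ob} {d e t t' : ℤ} (f : a.Hom B C d) (s : Seq a A B e)
    (h : d - 1 + e = t) (h' : t + 1 = t'), Δ.eval (.cons f s h) h' = 0

variable {Δ : a.Cochain 1} {δ : ∀ A : a.Ob, a.Hom A A 1} {A B : a.Ob}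
  {e : ℤ} {G : Type*} [AddCommGroup G] [Module k G]

theorem IsArityZero.susp (hΔ : IsArityZero Δ δ) : IsArityZero Δ.susp δ where
  eval_nil A := by
    rw [eval_susp, hΔ.eval_nil]
    simp [Seq.length, Seq.suspExp]
  eval_cons f s h h' := by rw [eval_susp, hΔ.eval_cons, smul_zero]

/-- Only the empty initial segment contributes, and applying `Δ` to it puts a `δ` on the left. -/
theorem IsArityZero.headSum (hΔ : IsArityZero Δ δ) (L : List (Σ q, a.Cochain q)) (s : Seq a A B e)
    (K : ∀ t, e + totalDeg (⟨1, Δ⟩ :: L) = t → Seq a A B t → G)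
    (hK : ∀ t h, Seq.IsMultilinear (K t h)) :
    headSum ⟨1, Δ⟩ L s K = insertSum L s fun t ht y => K t
      (by simp only [totalDeg_cons]; omega) (y.consδ δ) := by
  have key : ∀ (d₁ d₂ : ℤ) (h : d₁ + d₂ = e) (hd : d₁ = 0) (v : Seq a A B d₂),
      ((totalDeg L * d₁).negOnePow • insertSum L v fun t ht y => K (d₁ + 1 - 1 + t)
        (by simp only [totalDeg_cons]; omega)
          (Seq.cons (Δ.eval (.nil hd : Seq a B B d₁) rfl) y rfl)) =
      insertSum L (v.cast (by omega) : Seq a A B e) fun t ht y => K t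
        (by simp only [totalDeg_cons]; omega) (y.consδ δ) := by
    intro d₁ d₂ h hd v
    subst hd
    obtain rfl : e = d₂ := by omega
    rw [Seq.cast_rfl, mul_zero, Int.negOnePow_zero, one_smul]
    refine congrArg (insertSum L v) ?_
    funext t ht y
    refine (congrArg (fun g : a.Hom B B 1 => K (0 + 1 - 1 + t) _ (Seq.cons (d := 1) g y (by omega)))
      (hΔ.eval_nil B)).trans ?_
    exact Seq.apply_cons K _ _ (by omega) _ _ _ _
  rw [Cochain.headSum]
  cases s with
  | nil he =>
    refine (key 0 e (zero_add e) rfl (.nil he)).trans ?_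
    rfl
  | cons f s he =>
    rw [Seq.splitSum]
    refine (congrArg₂ _ (key 0 e (zero_add e) rfl (.cons f s he)) ?_).trans (add_zero _)
    refine Eq.trans (Seq.splitSum_congr s fun C d d' h u v _ => ?_) (Seq.splitSum_zero s)
    simp only [hΔ.eval_cons, (hK _ _).head_zero, insertSum_zero, smul_zero]

theorem totalDeg_replicate (Δ : a.Cochain 1) (m : ℕ) :
    totalDeg (List.replicate m (⟨1, Δ⟩ : Σ q, a.Cochain q)) = 0 := by
  simp [totalDeg]

/-- The copies of `Δ` are placed in order from left to right, so each way to insert `m` entries `δ`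
occurs once, without a factor `m!`, and the vanishing total degree removes all signs. -/
theorem IsArityZero.insertSum_replicate (hΔ : IsArityZero Δ δ) (m : ℕ) (s : Seq a A B e)
    (K : ∀ t, e + totalDeg (List.replicate m (⟨1, Δ⟩ : Σ q, a.Cochain q)) = t → Seq a A B t → G)
    (hK : ∀ t h, Seq.IsMultilinear (K t h)) :
    insertSum (List.replicate m ⟨1, Δ⟩) s K =
      s.ins δ (m + s.length) (K e (by rw [totalDeg_replicate, add_zero])) := by
  induction m generalizing A B e with
  | zero =>
    rw [Nat.cast_zero, zero_add, Seq.ins_length]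
    rfl
  | succ m ih =>
    change insertSum (⟨1, Δ⟩ :: List.replicate m ⟨1, Δ⟩) s K = _
    induction s with
    | nil he =>
      have e₁ : ((m + 1 : ℕ) : ℤ) + (Seq.nil he : Seq a A A _).length - 1 =
        m + (Seq.nil he : Seq a A A _).length := by omega
      rw [insertSum_cons_nil, hΔ.headSum _ _ _ hK, ih _ _ fun t ht => (hK _ _).consδ,
        Seq.ins_nil _ (((m + 1 : ℕ) : ℤ) + _), if_neg (by omega), zero_add, e₁]
    | @cons _ _ d _ _ f s he ihs =>
      have e₁ : ((m + 1 : ℕ) : ℤ) + (Seq.cons f s he).length - 1 =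
        m + (Seq.cons f s he).length := by omega
      have e₂ : (m : ℤ) + (Seq.cons f s he).length = (m + 1 : ℕ) + s.length := by
        simp only [Seq.length]
        omega
      have hT : totalDeg (⟨1, Δ⟩ :: List.replicate m ⟨1, Δ⟩) = 0 := totalDeg_replicate Δ (m + 1)
      have hsgn : (totalDeg (⟨1, Δ⟩ :: List.replicate m ⟨1, Δ⟩) * (d - 1)).negOnePow = 1 := by
        rw [hT, zero_mul, Int.negOnePow_zero]
      have := ihs (fun t ht y => K (d - 1 + t) (by omega) (.cons f y rfl))
        fun t ht => (hK _ _).tail f rfl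
      rw [insertSum_cons_cons, hΔ.headSum _ _ _ hK, ih _ _ fun t ht => (hK _ _).consδ,
        Seq.ins_cons _ (((m + 1 : ℕ) : ℤ) + _), e₁, hsgn, one_smul, add_comm]
      congr 1
      rw [e₂]
      subst he
      exact this

end arityZero

/-! ### Interleavings with copies of `δ` -/

section interleave

variable {J : Type*} {q : J → ℤ}

/-- The family `χ`, extended by `Δ`. -/
def withδ (Δ : a.Cochain 1) (χ : ∀ j, a.Cochain (q j)) : Option J → Σ q, a.Cochain q
  | none => ⟨1, Δ⟩
  | some j => ⟨q j, χ j⟩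

variable {Δ : a.Cochain 1} {δ : ∀ A : a.Ob, a.Hom A A 1} {A : a.Ob} {G : Type*} [AddCommGroup G]
  [Module k G]

/-- Applying cochains `χ_j` and then inserting `m` times `Δ` amounts to applying all interleavings
of the `χ_j` with `m` copies of `Δ`. -/
theorem exists_interleavings (hΔ : IsArityZero Δ δ) (m : ℕ) (l : List J) :
    ∃ (ι : Type) (_ : Fintype ι) (W : ι → List (Option J)), ∀ χ : ∀ j, a.Cochain (q j),
      (∀ i, totalDeg ((W i).map (withδ Δ χ)) =
        totalDeg (l.map fun j => (⟨q j, χ j⟩ : Σ q, a.Cochain q))) ∧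
      ∀ {B : a.Ob} {e : ℤ} (s : Seq a A B e) (K : ∀ t, Seq a A B t → G),
        (∀ t, Seq.IsMultilinear (K t)) →
        (insertSum (l.map fun j => ⟨q j, χ j⟩) s fun _ _ y =>
          insertSum (List.replicate m ⟨1, Δ⟩) y fun t _ y' => K t y') =
          ∑ i, insertSum ((W i).map (withδ Δ χ)) s fun t _ y => K t y := by
  induction m generalizing l with
  | zero =>
    refine ⟨Unit, inferInstance, fun _ => l.map some, fun χ => ?_⟩
    have hl : (l.map some).map (withδ Δ χ) = l.map fun j => ⟨q j, χ j⟩ := by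
      simp [withδ, Function.comp_def]
    refine ⟨fun _ => by rw [hl], fun s K _ => ?_⟩
    rw [Fintype.sum_unique, hl]
    rfl
  | succ m ihm =>
    induction l with
    | nil =>
      refine ⟨Unit, inferInstance, fun _ => List.replicate (m + 1) none, fun χ => ?_⟩
      have hl : (List.replicate (m + 1) none).map (withδ Δ χ) = List.replicate (m + 1) ⟨1, Δ⟩ := by
        simp [withδ]
      refine ⟨fun _ => by rw [hl, totalDeg_replicate]; rfl, fun s K _ => ?_⟩
      rw [Fintype.sum_unique, hl]
      rfl
    | cons j l ihl =>
      obtain ⟨ι₁, _, W₁, h₁⟩ := ihm (j :: l)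
      obtain ⟨ι₂, _, W₂, h₂⟩ := ihl
      -- The first cochain of an interleaving is `Δ` or `χ_j`. The words are chosen before `χ` and
      -- the sequence, as continuity in `χ` will require.
      refine ⟨ι₁ ⊕ ι₂, inferInstance, Sum.elim (fun i => none :: W₁ i) fun i => some j :: W₂ i,
        fun χ => ?_⟩
      obtain ⟨hd₁, h₁⟩ := h₁ χ
      obtain ⟨hd₂, h₂⟩ := h₂ χ
      have hT : ∀ m, totalDeg (List.replicate m ⟨1, Δ⟩) = 0 := totalDeg_replicate Δ
      refine ⟨?_, fun {B e} s K hK => ?_⟩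
      · rintro (i | i)
        · simpa [withδ] using hd₁ i
        · simpa [withδ] using hd₂ i
      rw [Fintype.sum_sum_type]
      -- the two recursions
      have rec₁ : ∀ {C C' : a.Ob} {d t t' : ℤ} (f : a.Hom C C' d) (y : Seq a A C t)
          (h : d - 1 + t = t') (K : ∀ t, Seq a A C' t → G) (_ : ∀ t, Seq.IsMultilinear (K t)),
          (insertSum (List.replicate (m + 1) ⟨1, Δ⟩) (.cons f y h) fun t _ y' => K t y') =
            (insertSum (List.replicate m ⟨1, Δ⟩) (.cons f y h) fun t _ y' => K t (y'.consδ δ)) +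
            insertSum (List.replicate (m + 1) ⟨1, Δ⟩) y fun t _ y' =>
              K (d - 1 + t) (.cons f y' rfl) := by
        intro C C' d t t' f y h K hK
        have hsgn : (totalDeg (⟨1, Δ⟩ :: List.replicate m ⟨1, Δ⟩) * (d - 1)).negOnePow = 1 := by
          rw [← List.replicate_succ, hT, zero_mul, Int.negOnePow_zero]
        rw [List.replicate_succ, insertSum_cons_cons, hΔ.headSum _ _ _ fun t _ => hK t, hsgn,
          one_smul]
      -- When the segment of `χ_j` is initial, the first `Δ` stands to the left of its value or all
      -- copies stand to the right.
      have head : ∀ {B : a.Ob} {e : ℤ} (s : Seq a A B e) (K : ∀ t, Seq a A B t → G),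
        (∀ t, Seq.IsMultilinear (K t)) →
        (headSum ⟨q j, χ j⟩ (l.map fun j => ⟨q j, χ j⟩) s fun _ _ y =>
          insertSum (List.replicate (m + 1) ⟨1, Δ⟩) y fun t _ y' => K t y') =
        (headSum ⟨q j, χ j⟩ (l.map fun j => ⟨q j, χ j⟩) s fun _ _ y =>
          insertSum (List.replicate m ⟨1, Δ⟩) y fun t _ y' => K t (y'.consδ δ)) +
        ∑ i, headSum ⟨q j, χ j⟩ ((W₂ i).map (withδ Δ χ)) s fun t _ y => K t y := by
        intro B e s K hK
        simp only [headSum]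
        rw [← Seq.splitSum_sum, ← Seq.splitSum_add]
        refine Seq.splitSum_congr s fun C d d' h x v _ => ?_
        have h₂' := h₂ v (fun t y => K (d + q j - 1 + t) (.cons ((χ j).eval x rfl) y rfl))
          fun t => (hK _).tail _ _
        simp only [rec₁ _ _ _ K hK, insertSum_add, smul_add, hd₂, h₂', Finset.smul_sum]
      have hd₁' : ∀ i, totalDeg (⟨1, Δ⟩ :: (W₁ i).map (withδ Δ χ)) =
          totalDeg (⟨q j, χ j⟩ :: l.map fun j => (⟨q j, χ j⟩ : Σ q, a.Cochain q)) := by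
        intro i
        simpa [withδ] using hd₁ i
      have hd₂' : ∀ i, totalDeg (⟨q j, χ j⟩ :: (W₂ i).map (withδ Δ χ)) =
          totalDeg (⟨q j, χ j⟩ :: l.map fun j => (⟨q j, χ j⟩ : Σ q, a.Cochain q)) := by
        intro i
        simpa [withδ] using hd₂ i
      change (insertSum (⟨q j, χ j⟩ :: l.map fun j => ⟨q j, χ j⟩) s fun _ _ y =>
          insertSum (List.replicate (m + 1) ⟨1, Δ⟩) y fun t _ y' => K t y') =
        (∑ i, insertSum (⟨1, Δ⟩ :: (W₁ i).map (withδ Δ χ)) s fun t _ y => K t y) +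
        ∑ i, insertSum (⟨q j, χ j⟩ :: (W₂ i).map (withδ Δ χ)) s fun t _ y => K t y
      have h₁' : ∀ {B e} (s : Seq a A B e) (K : ∀ t, Seq a A B t → G),
        (∀ t, Seq.IsMultilinear (K t)) →
        (insertSum (⟨q j, χ j⟩ :: l.map fun j => ⟨q j, χ j⟩) s fun _ _ y =>
          insertSum (List.replicate m ⟨1, Δ⟩) y fun t _ y' => K t (y'.consδ δ)) =
        ∑ i, insertSum ((W₁ i).map (withδ Δ χ)) s fun t _ y => K t (y.consδ δ) :=
        fun s K hK => h₁ s (fun t y => K t (y.consδ δ)) fun t => (hK t).consδ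
      induction s with
      | nil he =>
        have := h₁' (.nil he) K hK
        rw [insertSum_cons_nil] at this
        rw [insertSum_cons_nil, head _ K hK, this]
        simp only [insertSum_cons_nil, hΔ.headSum _ _ _ fun t _ => hK t]
      | @cons _ _ d _ _ f s he ihs =>
        have := h₁' (.cons f s he) K hK
        rw [insertSum_cons_cons] at this
        simp only [insertSum_cons_cons, hΔ.headSum _ _ _ fun t _ => hK t, hd₁', hd₂']
        rw [head _ K hK, Finset.sum_add_distrib, ← this, Finset.sum_add_distrib,
          ← Finset.smul_sum, ← Finset.smul_sum]
        simp only [rec₁ f _ _ K hK, insertSum_add, smul_add,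
          ihs (fun t y => K (d - 1 + t) (.cons f y rfl)) fun t => (hK _).tail f rfl]
        abel

end interleave

/-! ### Multilinearity of braces and truncation by arity -/

section multilinear

variable {A B : a.Ob} {e : ℤ} {G : Type*} [AddCommGroup G]

/-- The lists `L₁`, `L₂`, `L₃` agree except in one place, where their entries are `f`, `g` and
`f + c • g`. -/
inductive LinList (c : k) : List (Σ q, a.Cochain q) → List (Σ q, a.Cochain q) →
    List (Σ q, a.Cochain q) → Prop
  | head {q : ℤ} (f g : a.Cochain q) (L : List (Σ q, a.Cochain q)) :
      LinList c (⟨q, f⟩ :: L) (⟨q, g⟩ :: L) (⟨q, f + c • g⟩ :: L)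
  | tail (ψ : Σ q, a.Cochain q) {L₁ L₂ L₃ : List (Σ q, a.Cochain q)} (h : LinList c L₁ L₂ L₃) :
      LinList c (ψ :: L₁) (ψ :: L₂) (ψ :: L₃)

theorem LinList.totalDeg_eq {c : k} {L₁ L₂ L₃ : List (Σ q, a.Cochain q)}
    (h : LinList c L₁ L₂ L₃) : totalDeg L₁ = totalDeg L₃ ∧ totalDeg L₂ = totalDeg L₃ := by
  induction h with
  | head => simp
  | tail ψ h ih => simp [ih.1, ih.2]

theorem LinList.insertSum [Module k G] {c : k} {L₁ L₂ L₃ : List (Σ q, a.Cochain q)} (h : LinList c L₁ L₂ L₃)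
    (s : Seq a A B e) (K : ∀ t, Seq a A B t → G) (hK : ∀ t, Seq.IsMultilinear (K t)) :
    (insertSum L₃ s fun t _ y => K t y) =
      (insertSum L₁ s fun t _ y => K t y) + c • insertSum L₂ s fun t _ y => K t y := by
  induction h generalizing A B e with
  | head f g L =>
    refine Seq.splitSum_lin _ fun C d d' h u r => Seq.splitSum_lin _ fun C d₁ d₂ h' x v => ?_
    rw [smul_comm c, ← smul_add]
    exact congrArg _ (insertSum_lin _ _ fun t ht y =>
      hK _ c _ _ _ (.append_right u (.head _ _ y rfl) rfl))
  | @tail ψ L₁ L₂ L₃ h ih =>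
    refine Seq.splitSum_lin _ fun C d d' _ u r => Seq.splitSum_lin _ fun C d₁ d₂ h' x v => ?_
    have h₁ : ((ψ.1 - 1) * d + totalDeg L₁ * (d + d₁)).negOnePow =
      ((ψ.1 - 1) * d + totalDeg L₃ * (d + d₁)).negOnePow := by rw [h.totalDeg_eq.1]
    have h₂ : ((ψ.1 - 1) * d + totalDeg L₂ * (d + d₁)).negOnePow =
      ((ψ.1 - 1) * d + totalDeg L₃ * (d + d₁)).negOnePow := by rw [h.totalDeg_eq.2]
    rw [h₁, h₂, smul_comm c, ← smul_add]
    exact congrArg _ (ih v (fun t y => K (d + (d₁ + ψ.1 - 1 + t))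
      (u.append (Seq.cons (ψ.2.eval x rfl) y rfl) rfl)) fun t c y z w hrel => hK _ c _ _ _
        (.append_right u (.tail _ rfl hrel) rfl))

theorem linList_ofFn {c : k} {r : ℕ} {q : Fin r → ℤ} (ψ₁ ψ₂ ψ₃ : ∀ j, a.Cochain (q j)) (i : Fin r)
    (hi : ψ₃ i = ψ₁ i + c • ψ₂ i) (h₁ : ∀ j, j ≠ i → ψ₁ j = ψ₃ j) (h₂ : ∀ j, j ≠ i → ψ₂ j = ψ₃ j) :
    LinList c (List.ofFn fun j => ⟨q j, ψ₁ j⟩) (List.ofFn fun j => ⟨q j, ψ₂ j⟩)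
      (List.ofFn fun j => ⟨q j, ψ₃ j⟩) := by
  induction r with
  | zero => exact i.elim0
  | succ r ih =>
    rw [List.ofFn_succ, List.ofFn_succ, List.ofFn_succ]
    cases i using Fin.cases with
    | zero =>
      simp only [h₁ _ (Fin.succ_ne_zero _), h₂ _ (Fin.succ_ne_zero _), hi]
      exact .head _ _ _
    | succ i =>
      rw [h₁ 0 (Fin.succ_ne_zero i).symm, h₂ 0 (Fin.succ_ne_zero i).symm]
      exact .tail _ (ih (fun j => ψ₁ j.succ) (fun j => ψ₂ j.succ) (fun j => ψ₃ j.succ) i hi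
        (fun j hj => h₁ _ (by simpa using hj)) fun j hj => h₂ _ (by simpa using hj))

theorem brace_lin {c : k} {p : ℤ} {r : ℕ} {q : Fin r → ℤ} (φ : a.Cochain p)
    (ψ₁ ψ₂ ψ₃ : ∀ j, a.Cochain (q j)) (i : Fin r)
    (hi : ψ₃ i = ψ₁ i + c • ψ₂ i) (h₁ : ∀ j, j ≠ i → ψ₁ j = ψ₃ j) (h₂ : ∀ j, j ≠ i → ψ₂ j = ψ₃ j) :
    φ.brace ψ₃ = φ.brace ψ₁ + c • φ.brace ψ₂ := by
  apply susp_injective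
  rw [susp_add, susp_smul, susp_brace, susp_brace, susp_brace]
  ext A B e t s h
  rw [eval_add, eval_smul, eval_suspBrace, eval_suspBrace, eval_suspBrace]
  have hL := linList_ofFn (c := c) (fun j => (ψ₁ j).susp) (fun j => (ψ₂ j).susp)
    (fun j => (ψ₃ j).susp) i (by rw [hi, susp_add, susp_smul]) (fun j hj => by rw [h₁ j hj])
    fun j hj => by rw [h₂ j hj]
  -- Extending `φ` by zero to all degrees gives one integrand for the three lists, whose total
  -- degrees are only propositionally equal.
  have := hL.insertSum s (fun t' y => if h' : t' + p = t then φ.susp.eval y h' else 0) (by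
    intro t'
    by_cases h' : t' + p = t
    · simpa only [h', dif_pos] using φ.susp.eval_multilinear h'
    · intro c x y z _
      simp [h'])
  have hd : ∀ t', e + (∑ j, (q j - 1)) = t' → t' + p = t := fun t' h => by omega
  have hc : ∀ ψ : ∀ j, a.Cochain (q j), (Cochain.insertSum (List.ofFn fun j => ⟨q j, ψ j⟩) s
      fun t' _ y => if h' : t' + p = t then φ.susp.eval y h' else 0) =
      Cochain.insertSum (List.ofFn fun j => ⟨q j, ψ j⟩) s
        fun t' ht' y => φ.susp.eval y (by rw [totalDeg_ofFn] at ht'; omega) := by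
    intro ψ
    refine congrArg (Cochain.insertSum _ s) ?_
    funext t' ht' y
    rw [totalDeg_ofFn] at ht'
    rw [dif_pos (hd t' ht')]
  rw [hc, hc, hc] at this
  exact this

/-- The brace operation `(ψ_1, …, ψ_r) ↦ φ{ψ_1, …, ψ_r}`, as a multilinear map. -/
def braceₘ {p : ℤ} {r : ℕ} (q : Fin r → ℤ) (φ : a.Cochain p) :
    MultilinearMap k (fun j => a.Cochain (q j)) (a.Cochain (p + ∑ j, (q j - 1))) where
  toFun ψ := φ.brace ψ
  map_update_add' ψ i f g := by
    have := brace_lin (c := 1) φ (Function.update ψ i f) (Function.update ψ i g)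
      (Function.update ψ i (f + g)) i (by simp) (by simp +contextual) (by simp +contextual)
    simpa using this
  map_update_smul' ψ i c f := by
    -- With a zero entry, the brace satisfies `x = x + x`, hence vanishes.
    have h₀ := brace_lin (c := 1) φ (Function.update ψ i 0) (Function.update ψ i 0)
      (Function.update ψ i 0) i (by simp) (by simp) (by simp)
    have := brace_lin (c := c) φ (Function.update ψ i 0) (Function.update ψ i f)
      (Function.update ψ i (c • f)) i (by simp) (by simp +contextual) (by simp +contextual)
    rw [one_smul, left_eq_add] at h₀
    rwa [h₀, zero_add] at this

/-- `AgreeUpTo n L L'`: the lists `L` and `L'` have the same degrees, and their entries agree on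
sequences of length at most `n`. -/
inductive AgreeUpTo (n : ℕ) : List (Σ q, a.Cochain q) → List (Σ q, a.Cochain q) → Prop
  | nil : AgreeUpTo n [] []
  | cons {L L' : List (Σ q, a.Cochain q)} {q : ℤ} {ψ ψ' : a.Cochain q}
      (hψ : ∀ {A B : a.Ob} {e t : ℤ} (s : Seq a A B e) (h : e + q = t), s.length ≤ n →
        ψ.eval s h = ψ'.eval s h) (h : AgreeUpTo n L L') :
      AgreeUpTo n (⟨q, ψ⟩ :: L) (⟨q, ψ'⟩ :: L')

theorem AgreeUpTo.totalDeg_eq {n : ℕ} {L L' : List (Σ q, a.Cochain q)} (h : AgreeUpTo n L L') :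
    totalDeg L' = totalDeg L := by
  induction h with
  | nil => rfl
  | cons hψ h ih => simp [ih]

theorem AgreeUpTo.insertSum {n : ℕ} {L L' : List (Σ q, a.Cochain q)} (h : AgreeUpTo n L L')
    (s : Seq a A B e) (hs : s.length ≤ n) (K : ∀ t, e + totalDeg L = t → Seq a A B t → G) :
    insertSum L s K = insertSum L' s fun t ht y => K t (h.totalDeg_eq ▸ ht) y := by
  induction h generalizing A B e with
  | nil => rfl
  | cons hψ h ih =>
    simp only [Cochain.insertSum]
    refine Seq.splitSum_congr s fun C d d' _ u r hr =>
      Seq.splitSum_congr r fun C d₁ d₂ h' x v hv => ?_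
    rw [ih v (by omega), hψ x _ (by omega)]
    simp only [h.totalDeg_eq]

theorem agreeUpTo_ofFn {n r : ℕ} {q : Fin r → ℤ} (ψ ψ' : ∀ j, a.Cochain (q j))
    (h : ∀ j {A B : a.Ob} {e t : ℤ} (s : Seq a A B e) (h : e + q j = t), s.length ≤ n →
        (ψ j).eval s h = (ψ' j).eval s h) :
    AgreeUpTo n (List.ofFn fun j => ⟨q j, ψ j⟩) (List.ofFn fun j => ⟨q j, ψ' j⟩) := by
  induction r with
  | zero => simpa using AgreeUpTo.nil
  | succ r ih =>
    rw [List.ofFn_succ, List.ofFn_succ]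
    exact .cons (h 0) (ih _ _ fun j => h j.succ)

/-- The `ψ_j` are only applied to segments of `s`, so their components of arity above `s.length`
play no role. -/
theorem eval_brace_congr {p : ℤ} {r : ℕ} {q : Fin r → ℤ} (φ : a.Cochain p)
    {ψ ψ' : ∀ j, a.Cochain (q j)} {t : ℤ} (s : Seq a A B e) (h : e + (p + ∑ j, (q j - 1)) = t)
    (hψ : ∀ j {A B : a.Ob} {e t : ℤ} (y : Seq a A B e) (h : e + q j = t), y.length ≤ s.length →
        (ψ j).eval y h = (ψ' j).eval y h) :
    (φ.brace ψ).eval s h = (φ.brace ψ').eval s h := by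
  refine congrArg _ ((agreeUpTo_ofFn _ _ fun j A B e t y h hy => ?_).insertSum s le_rfl _)
  rw [eval_susp, eval_susp, hψ j y h hy]

/-- The value of `φ{ψ_1, …, ψ_r}`, as a linear function of `φ`. -/
def evalBraceₗ {p : ℤ} {r : ℕ} {q : Fin r → ℤ} (ψ : ∀ j, a.Cochain (q j)) {t : ℤ}
    (s : Seq a A B e) (h : e + (p + ∑ j, (q j - 1)) = t) : a.Cochain p →ₗ[k] a.Hom A B t :=
  have hlin : ∀ (c : k) (φ φ' : a.Cochain p), ((φ + c • φ').brace ψ).eval s h =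
      (φ.brace ψ).eval s h + c • (φ'.brace ψ).eval s h := by
    intro c φ φ'
    change _ • insertSum _ s _ = _ • insertSum _ s _ + c • _ • insertSum _ s _
    rw [smul_comm c, ← smul_add]
    refine congrArg _ (insertSum_lin _ s fun t ht y => ?_)
    rw [susp_add, susp_smul]
    rfl
  { toFun φ := (φ.brace ψ).eval s h
    map_add' φ φ' := by simpa using hlin 1 φ φ'
    map_smul' c φ := by
      have h₀ := hlin 1 0 0
      have := hlin c 0 φ
      rw [one_smul, one_smul, add_zero, left_eq_add] at h₀
      rwa [h₀, zero_add, zero_add] at this }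

end multilinear

/-! ### Continuity of braces in the outer cochain -/

section limits

theorem tendsto_splitSum {A B : a.Ob} {e : ℤ} {G : Type*} [AddCommGroup G] [TopologicalSpace G]
    [IsTopologicalAddGroup G] {ι : Type*} {l : Filter ι} (s : Seq a A B e)
    {F : ι → ∀ (C : a.Ob) (d d' : ℤ), d + d' = e → Seq a C B d → Seq a A C d' → G}
    {F' : ∀ (C : a.Ob) (d d' : ℤ), d + d' = e → Seq a C B d → Seq a A C d' → G}
    (h : ∀ C d d' h u v, Tendsto (fun i => F i C d d' h u v) l (𝓝 (F' C d d' h u v))) :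
    Tendsto (fun i => s.splitSum (F i)) l (𝓝 (s.splitSum F')) := by
  induction s with
  | nil he => exact h ..
  | cons f s he ih => exact (h ..).add (ih fun _ _ _ _ _ _ => h ..)

theorem _root_.Filter.Tendsto.units_int_smul {G : Type*} [AddCommGroup G] [TopologicalSpace G]
    [IsTopologicalAddGroup G] {ι : Type*} {l : Filter ι} {f : ι → G} {x : G}
    (h : Tendsto f l (𝓝 x)) (c : ℤˣ) : Tendsto (fun i => c • f i) l (𝓝 (c • x)) := by
  rcases Int.units_eq_one_or c with rfl | rfl
  · simpa using h
  · simpa using h.neg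

theorem tendsto_insertSum {G : Type*} [AddCommGroup G] [TopologicalSpace G]
    [IsTopologicalAddGroup G] {ι : Type*} {l : Filter ι} (ψs : List (Σ q, a.Cochain q))
    {A B : a.Ob} {e : ℤ} (s : Seq a A B e)
    {K : ι → ∀ t, e + totalDeg ψs = t → Seq a A B t → G}
    {K' : ∀ t, e + totalDeg ψs = t → Seq a A B t → G}
    (h : ∀ t ht y, Tendsto (fun i => K i t ht y) l (𝓝 (K' t ht y))) :
    Tendsto (fun i => insertSum ψs s (K i)) l (𝓝 (insertSum ψs s K')) := by
  induction ψs generalizing A B e with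
  | nil => exact h ..
  | cons ψ ψs ih =>
    exact tendsto_splitSum s fun _ _ _ _ _ r => tendsto_splitSum r fun _ _ _ _ _ v =>
      (ih v fun _ _ _ => h ..).units_int_smul _

/-- At `s`, the brace is a finite signed sum of values of `φ`, so pointwise convergence suffices. In
the `ψ_j` there is no such argument, as their values enter through `φ`. -/
theorem tendsto_eval_brace {A B : a.Ob} {e t : ℤ} [∀ t, TopologicalSpace (a.Hom A B t)]
    [∀ t, IsTopologicalAddGroup (a.Hom A B t)] {ι : Type*} {l : Filter ι} {p : ℤ} {r : ℕ}
    {q : Fin r → ℤ} {φ : ι → a.Cochain p} {φ' : a.Cochain p} (ψ : ∀ j, a.Cochain (q j))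
    (s : Seq a A B e) (h : e + (p + ∑ j, (q j - 1)) = t)
    (hφ : ∀ {e' : ℤ} (y : Seq a A B e') (h : e' + p = t),
      Tendsto (fun i => (φ i).eval y h) l (𝓝 (φ'.eval y h))) :
    Tendsto (fun i => ((φ i).brace ψ).eval s h) l (𝓝 ((φ'.brace ψ).eval s h)) :=
  (tendsto_insertSum _ s fun _ _ y => (hφ y _).units_int_smul _).units_int_smul _

end limits

/-! ### Linearity and arity of the extension to `Tw(a)` -/

section extendTw

variable (P : Set (TwOb.{u, v, w, x} a))

/-- The canonical extension of cochains from `a` to `Tw(a)`, as a linear map. -/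
noncomputable def extendTwₗ (p : ℤ) : a.Cochain p →ₗ[k] (Tw P).Cochain p :=
  have hlin : ∀ (c : k) (φ φ' : a.Cochain p),
      (φ + c • φ').extendTw P = φ.extendTw P + c • φ'.extendTw P := by
    intro c φ φ'
    classical
    ext A B e t s h
    funext i
    refine pathSum_lin s.ofFull fun j t ht y => ?_
    rw [eval_add, eval_smul, smul_add, smul_comm _ c, DFinsupp.single_add, DFinsupp.single_smul c]
  { toFun φ := φ.extendTw P
    map_add' φ φ' := by simpa using hlin 1 φ φ'
    map_smul' c φ := by
      have h₀ := hlin 1 0 0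
      have := hlin c 0 φ
      rw [one_smul, one_smul, add_zero, left_eq_add] at h₀
      rwa [h₀, zero_add, zero_add] at this }

theorem extendTwₗ_apply {p : ℤ} (φ : a.Cochain p) : extendTwₗ P p φ = φ.extendTw P := rfl

variable {P}

theorem eval_extendTw_congr {p : ℤ} {φ φ' : a.Cochain p} {A B : (Tw P).Ob} {e t : ℤ}
    (s : Seq (Tw P) A B e) (h : e + p = t)
    (hφ : ∀ {A B : a.Ob} {e t : ℤ} (y : Seq a A B e) (h : e + p = t), y.length = s.length →
      φ.eval y h = φ'.eval y h) :
    (φ.extendTw P).eval s h = (φ'.extendTw P).eval s h := by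
  funext i
  refine pathSum_congr i _ fun j t ht y hy => ?_
  rw [hφ y _ (hy.trans (Seq.length_ofFull s))]

theorem extendTw_arity {p : ℤ} (j : ℕ) (φ : a.Cochain p) :
    (φ.arity j).extendTw P = (φ.extendTw P).arity j := by
  ext A B e t s h
  rw [eval_arity]
  split_ifs with hs
  · exact eval_extendTw_congr s h fun y h hy => by rw [eval_arity, if_pos (hy.trans hs)]
  · refine (eval_extendTw_congr (φ' := 0) s h fun y h hy => ?_).trans ?_
    · rw [eval_arity, if_neg (hy ▸ hs), eval_zero]
    · rw [← extendTwₗ_apply, map_zero, eval_zero]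

end extendTw

/-! ### The terms of the series -/

section twTerm

variable (P : Set (TwOb.{u, v, w, x} a))

theorem insertSum_ofFn_const {m : ℕ} {Δ : a.Cochain 1} {A B : a.Ob} {e : ℤ} {G : Type*}
    [AddCommGroup G] (s : Seq a A B e)
    (K : ∀ t, Seq a A B t → G) :
    (insertSum (List.ofFn fun _ : Fin m => ⟨1, Δ⟩) s fun t _ y => K t y) =
      insertSum (List.replicate m ⟨1, Δ⟩) s fun t _ y => K t y := by
  rw [List.ofFn_const]

/-- The link between the two gradings of the series: `m` insertions into a sequence of length `n`
involve arity `m + n` only. -/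
theorem eval_brace_const {Δ : a.Cochain 1} {δ : ∀ A, a.Hom A A 1}
    (hΔ : IsArityZero Δ δ) {p : ℤ} (φ : a.Cochain p) (m : ℕ) {A B : a.Ob} {e t : ℤ}
    (s : Seq a A B e) (h : e + p = t) (h' : e + (p + ∑ _ : Fin m, (1 - 1)) = t) :
    (φ.brace fun _ : Fin m => Δ).eval s h' = (φ.twist δ (m + s.length)).eval s h := by
  let K : ∀ t', Seq a A B t' → a.Hom A B t :=
    fun t' y => if h' : t' + p = t then φ.susp.eval y h' else 0
  have hK : ∀ t', Seq.IsMultilinear (K t') := by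
    intro t'
    by_cases h' : t' + p = t
    · simpa only [K, h', dif_pos] using φ.susp.eval_multilinear h'
    · intro c x y z _
      simp [K, h']
  have key := hΔ.susp.insertSum_replicate m s (fun t' _ => K t') fun t' _ => hK t'
  rw [← insertSum_ofFn_const] at key
  rw [← susp_susp (φ.brace _), eval_susp, susp_brace, eval_suspBrace]
  have hs : (s.length * (p + ∑ _ : Fin m, (1 - 1) - s.length) + s.suspExp : ℤ) =
    s.length * (p - s.length) + s.suspExp := by simp
  rw [hs]
  refine congrArg _ (Eq.trans ?_ (key.trans ?_))
  · refine congrArg (insertSum _ s) ?_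
    funext t' ht' y
    rw [totalDeg_ofFn] at ht'
    exact (dif_pos (by simp at ht' h'; omega)).symm
  · exact Seq.ins_congr δ _ s fun y _ _ => dif_pos h

/-- The components `δ_M` of the canonical cochain of `Tw(a)`. -/
def twδ (M : (Tw P).Ob) : (Tw P).Hom M M 1 := (show P from M).1.δ

theorem isArityZero_canonicalδ : IsArityZero (canonicalδ P) (twδ P) where
  eval_nil _ := rfl
  eval_cons _ _ _ _ := rfl

theorem eval_twTerm {p : ℤ} (φ : a.Cochain p) (m : ℕ) {A B : (Tw P).Ob} {e t : ℤ}
    (s : Seq (Tw P) A B e) (h : e + p = t) : (twTerm P φ m).eval s h =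
      ((φ.extendTw P).twist (twδ P) (m + s.length)).eval s h :=
  eval_brace_const (isArityZero_canonicalδ P) _ m s h _

theorem length_δSeq (M : (Tw P).Ob) (m : ℕ) : (δSeq P M m).length = m := by
  induction m with
  | zero => rfl
  | succ m ih => exact congrArg (· + 1) ih

theorem suspExp_δSeq (M : (Tw P).Ob) (m : ℕ) :
    (δSeq P M m).suspExp = (m * (m - 1) / 2 : ℤ) := by
  induction m with
  | zero => rfl
  | succ m ih =>
    rw [δSeq, Seq.suspExp, length_δSeq, ih]
    have : ((m + 1 : ℕ) * ((m + 1 : ℕ) - 1) : ℤ) = m * (m - 1) + m * 2 := by push_cast; ring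
    rw [this, Int.add_mul_ediv_right _ _ (by norm_num)]
    ring

theorem ins_twδ_nil {G : Type*} [AddCommGroup G] (M : (Tw P).Ob) (m : ℕ)
    (K : Seq (Tw P) M M 0 → G) :
    (Seq.nil rfl : Seq (Tw P) M M 0).ins (twδ P) m K = K (δSeq P M m) := by
  induction m generalizing K with
  | zero => exact Seq.ins_zero_nil _ rfl K
  | succ m ih =>
    rw [Seq.ins_nil _ ((m + 1 : ℕ) : ℤ), if_neg (by omega), zero_add, Nat.cast_succ,
      add_sub_cancel_right, ih]
    rfl

/-- The empty sequence has trivial suspension sign and can be filled up in only one way. The sign is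
that of `susp` at `m` entries of degree `1`, where `(m-1) + … + 0 = m(m-1)/2`. -/
theorem eval_twTerm_nil {p : ℤ} (φ : a.Cochain p) (m : ℕ) (M : (Tw P).Ob) :
    (twTerm P φ m).eval (.nil rfl : Seq (Tw P) M M 0) (zero_add p) =
      (m * (p - m) + m * (m - 1) / 2 : ℤ).negOnePow •
        (φ.extendTw P).eval (δSeq P M m) (zero_add p) := by
  rw [eval_twTerm, ← susp_susp (twist _ _ _), eval_susp, susp_twist, eval_insert]
  simp only [Seq.length, Nat.cast_zero, add_zero, ins_twδ_nil]
  rw [eval_susp, length_δSeq, suspExp_δSeq]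
  simp [Seq.suspExp]

end twTerm

/-! ### Restriction to `a` -/

section proj

variable {P : Set (TwOb.{u, v, w, x} a)} (hP : ∀ A : a.Ob, TwOb.ofOb A ∈ P)

theorem length_inclSeq {A B : a.Ob} {e : ℤ} (s : Seq a A B e) :
    (inclSeq hP s).length = s.length := by
  induction s with
  | nil h => rfl
  | cons f s h ih => exact congrArg (· + 1) ih

/-- On objects of `a` the inserted entry is `0`, so by multilinearity only the insertion of nothing
survives. -/
theorem ins_inclSeq {A B : a.Ob} {e : ℤ} {G : Type*} [AddCommGroup G] [Module k G] (N : ℤ)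
    (s : Seq a A B e) (K : Seq (Tw P) (inclOb hP A) (inclOb hP B) e → G)
    (hK : Seq.IsMultilinear K) :
    (inclSeq hP s).ins (twδ P) N K = if N = s.length then K (inclSeq hP s) else 0 := by
  have h0 : ∀ {B : a.Ob} {e : ℤ} (s : Seq (Tw P) (inclOb hP A) (inclOb hP B) e)
      (K : Seq (Tw P) (inclOb hP A) (inclOb hP B) e → G) (_ : Seq.IsMultilinear K) (N : ℤ),
      (s.ins (twδ P) N fun y => K (y.consδ (twδ P))) = 0 := by
    intro B e s K hK N
    refine Eq.trans ?_ (Seq.ins_zero (twδ P) N s)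
    exact congrArg _ (funext fun y => hK.head_zero y _)
  induction s generalizing N with
  | nil h =>
    rw [inclSeq, Seq.ins_nil _ N, h0 _ K hK, add_zero]
    rfl
  | cons f s h ih =>
    rw [inclSeq, Seq.ins_cons _ N, ih _ _ (hK.tail _ _), h0 _ K hK, add_zero]
    have : N - 1 = s.length ↔ N = (Seq.cons f s h).length := by
      rw [Seq.length]
      omega
    simp only [this]

theorem eval_twTerm_inclSeq {p : ℤ} (φ : a.Cochain p) (m : ℕ) {A B : a.Ob} {e t : ℤ}
    (s : Seq a A B e) (h : e + p = t) : (twTerm P φ m).eval (inclSeq hP s) h =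
      if m = 0 then (φ.extendTw P).eval (inclSeq hP s) h else 0 := by
  rw [eval_twTerm, ← susp_susp (twist _ _ _), eval_susp, susp_twist, eval_insert,
    ins_inclSeq hP _ s _ ((φ.extendTw P).susp.eval_multilinear h)]
  have : (m + (inclSeq hP s).length : ℤ) = s.length ↔ m = 0 := by
    rw [length_inclSeq]
    omega
  simp only [this]
  split_ifs
  · rw [← eval_susp, susp_susp]
  · rw [smul_zero]

/-- For unshifted `1 × 1` matrices there is a single path and no sign. If an entry is zero the path
sum is empty, and multilinearity makes the other side vanish too. -/
theorem pathSum_inclSeq {A B : a.Ob} {e : ℤ} {G : Type*} [AddCommGroup G] [Module k G]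
    (s : Seq a A B e) (K : ∀ t, e = t → Seq a A B t → G)
    (hK : ∀ t h, Seq.IsMultilinear (K t h)) :
    (pathSum (M := FreeOb.ofOb.{u, v, w, x} A) (N := FreeOb.ofOb B) PUnit.unit
      (inclSeq hP s).ofFull fun _ t ht y => K t ((add_zero e).symm.trans ((sub_zero _).symm.trans ht)) y) = K e rfl s := by
  classical
  induction s with
  | nil h =>
    subst h
    rfl
  | @cons B C d e t f s h ih =>
    subst h
    refine (ih (fun t' ht' y => K (d - 1 + t') (ht' ▸ rfl) (.cons f y rfl))
      fun t' h' => (hK _ _).tail f rfl).symm.trans ?_ |>.symm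
    refine pathSum_congr (N := FreeOb.ofOb B) _ _ fun j t' ht' y _ => ?_
    refine Eq.trans ?_ (Eq.symm (DFinsupp.sum_single_index
      (β := fun _ : PUnit.{x + 1} => a.Hom B C (d + 0 - 0)) (i := PUnit.unit)
      (b := a.castHom (by simp) f) (h := fun _ g => ((d + 0 - 0 : ℤ) * (0 - 0)).negOnePow •
        K (d + 0 - 0 - 1 + t') (by change e + 0 - 0 = t' at ht'; omega)
          (.cons g y rfl)) ?_))
    · rw [sub_self, mul_zero, Int.negOnePow_zero, one_smul]
      have : ∀ d' (hd : d = d') h h', K (d - 1 + t') h (.cons f y rfl) =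
          K (d' - 1 + t') h' (.cons (a.castHom hd f) y rfl) := by
        rintro _ rfl _ _
        rfl
      exact this ..
    · have := (hK (d + 0 - 0 - 1 + t') (by change e + 0 - 0 = t' at ht'; omega)).head_zero y
        (d := d + 0 - 0) rfl
      exact (congrArg _ this).trans (smul_zero _)

theorem eval_extendTw_inclSeq {p : ℤ} (φ : a.Cochain p) {A B : a.Ob} {e t : ℤ} (s : Seq a A B e)
    (h : e + p = t) : entry hP ((φ.extendTw P).eval (inclSeq hP s) h) = φ.eval s h := by
  -- The classical instance, to match the one inside `Cochain.extend` definitionally.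
  let : DecidableEq PUnit.{x + 1} := fun i j => Classical.propDecidable (i = j)
  have key := pathSum_inclSeq hP s (fun t' ht' y => (DFinsupp.single PUnit.unit
    (((0 - 0) * (p - (inclSeq hP s).ofFull.length)).negOnePow • φ.eval y (t := t + 0 - 0) (by omega)) :
      Π₀ _ : PUnit.{x + 1}, a.Hom A B (t + 0 - 0))) (by
    intro t' ht c x y z hr
    have h1 := φ.eval_multilinear (t := t + 0 - 0) (by omega) c x y z hr
    simp only at h1 ⊢
    rw [h1, smul_add, smul_comm _ c, DFinsupp.single_add, DFinsupp.single_smul c])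
  have key' : (show PUnit.{x + 1} → Π₀ _ : PUnit.{x + 1}, a.Hom A B (t + 0 - 0) from
    (φ.extendTw P).eval (inclSeq hP s) h) PUnit.unit = _ := Eq.trans rfl key
  have hcast : ∀ t' (ht : t = t'), a.castHom ht.symm (φ.eval s (h.trans ht)) = φ.eval s h := by
    rintro _ rfl
    rfl
  refine (congrArg (fun z : Π₀ _ : PUnit.{x + 1}, a.Hom A B (t + 0 - 0) =>
    a.castHom (show t + 0 - 0 = t by simp) (z PUnit.unit)) key').trans ?_
  simp only [DFinsupp.single_eq_same, sub_zero, zero_mul, Int.negOnePow_zero, one_smul]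
  exact hcast _ (by simp)

end proj

/-! ### Braces of a twisted cochain as finite sums of braces -/

section twistBrace

variable {Δ : a.Cochain 1} {δ : ∀ A : a.Ob, a.Hom A A 1}

/-- The value `φ(s)`, extended by zero to all degrees. -/
def evalOrZero {p : ℤ} (φ : a.Cochain p) (t : ℤ) {A B : a.Ob} {e : ℤ} (s : Seq a A B e) :
    a.Hom A B t :=
  if h : e + p = t then φ.eval s h else 0

theorem evalOrZero_eq {p : ℤ} (φ : a.Cochain p) {A B : a.Ob} {e t : ℤ} (s : Seq a A B e)
    (h : e + p = t) : φ.evalOrZero t s = φ.eval s h := dif_pos h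

theorem evalOrZero_multilinear {p : ℤ} (φ : a.Cochain p) (A B : a.Ob) (e t : ℤ) :
    Seq.IsMultilinear fun s : Seq a A B e => φ.evalOrZero t s := by
  by_cases h : e + p = t
  · simpa only [evalOrZero, h, dif_pos] using φ.eval_multilinear h
  · intro c x y z _
    simp [evalOrZero, h]

/-- The degrees of the cochains of `consΔ`. -/
def consDeg {J : Type*} (q : J → ℤ) : Option J → ℤ
  | none => 1
  | some j => q j

/-- The family `χ`, extended by `Δ`. -/
def consΔ {J : Type*} {q : J → ℤ} (Δ : a.Cochain 1) (χ : ∀ j, a.Cochain (q j)) :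
    ∀ o, a.Cochain (consDeg q o)
  | none => Δ
  | some j => χ j

/-- Only `m = N - y.length` can contribute. The sum over all `m ≤ N` makes the index set independent
of `y`, which varies once other cochains have been applied. -/
theorem insert_eq_sum (hΔ : IsArityZero Δ δ) {p : ℤ} (φ : a.Cochain p) (N : ℕ) {A B : a.Ob}
    {e t : ℤ} (y : Seq a A B e) (h : e + p = t) : (φ.insert δ N).eval y h =
      ∑ m ∈ Finset.range (N + 1), insertSum (List.replicate m ⟨1, Δ⟩) y
        fun _ _ y' => (φ.arity N).evalOrZero t y' := by
  have hm : ∀ m, (insertSum (List.replicate m ⟨1, Δ⟩) y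
        fun _ _ y' => (φ.arity N).evalOrZero t y') =
      if m + y.length = N then (φ.insert δ N).eval y h else 0 := by
    intro m
    rw [hΔ.insertSum_replicate m y (fun t' _ y' => (φ.arity N).evalOrZero t y')
      fun t' _ => evalOrZero_multilinear (φ.arity N) A B t' t]
    split_ifs with hN
    · rw [eval_insert, ← hN, Nat.cast_add]
      refine Seq.ins_congr δ _ y fun y' hy' _ => ?_
      rw [evalOrZero_eq _ _ h, eval_arity, if_pos (by omega)]
    · rw [← Seq.ins_zero δ (m + y.length) y]
      refine Seq.ins_congr δ _ y fun y' hy' _ => ?_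
      rw [evalOrZero_eq _ _ h, eval_arity, if_neg (by omega)]
  simp only [hm]
  by_cases hN : y.length ≤ N
  · rw [Finset.sum_eq_single (N - y.length), if_pos (by omega)]
    · intro m _ hm
      rw [if_neg (by omega)]
    · intro h
      simp only [Finset.mem_range] at h
      omega
  · rw [Finset.sum_eq_zero fun m _ => if_neg (by omega), eval_insert, Seq.ins_of_lt (by omega)]

/-- The cochain `φ'{χ_1, …, χ_r}`, where `φ'` arises from `φ_N` by inserting the arity zero cochain
`Δ`, is the sum of the braces of `φ_N` with certain interleavings of the `χ_j` and copies
of `Δ`. -/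
theorem exists_eval_twist_brace (hΔ : IsArityZero Δ δ) {p : ℤ} (φ : a.Cochain p) (N : ℕ) {r : ℕ}
    (q : Fin r → ℤ) (A B : a.Ob) (t : ℤ) :
    ∃ (ι : Type) (_ : Fintype ι) (R : ι → ℕ) (o : ∀ i, Fin (R i) → Option (Fin r))
      (hR : ∀ i, ∑ n, (consDeg q (o i n) - 1) = ∑ j, (q j - 1)),
      ∀ (χ : ∀ j, a.Cochain (q j)) {e : ℤ} (s : Seq a A B e)
        (h : e + (p + ∑ j, (q j - 1)) = t),
        ((φ.twist δ N).brace χ).eval s h =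
          ∑ i, ((φ.arity N).brace fun n => consΔ Δ χ (o i n)).eval s (by rw [hR i]; exact h) := by
  choose ι _ W hW using fun m => exists_interleavings (A := A) (G := a.Hom A B t)
    (q := q) hΔ.susp m (List.finRange r)
  have hl : ∀ χ : ∀ j, a.Cochain (q j), ((List.finRange r).map fun j => ⟨q j, χ j⟩) =
      List.ofFn fun j => (⟨q j, χ j⟩ : Σ q, a.Cochain q) := fun χ => (List.ofFn_eq_map ..).symm
  have hL : ∀ (L : List (Option (Fin r))) (χ : ∀ j, a.Cochain (q j)),
      L.map (withδ Δ.susp fun j => (χ j).susp) =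
        List.ofFn fun n => ⟨consDeg q (L.get n), (consΔ Δ χ (L.get n)).susp⟩ := by
    intro L χ
    conv_lhs => rw [← List.ofFn_get L, List.map_ofFn]
    refine congrArg List.ofFn (funext fun n => ?_)
    rw [Function.comp_apply]
    cases L.get n <;> rfl
  -- Degrees do not depend on the cochains, so they can be read off from the zero family.
  have hR : ∀ m i, ∑ n, (consDeg q ((W m i).get n) - 1) = ∑ j, (q j - 1) := by
    intro m i
    have := (hW m fun j => (0 : a.Cochain (q j)).susp).1 i
    rwa [hL _ fun j => 0, hl, totalDeg_ofFn, totalDeg_ofFn] at this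
  refine ⟨Σ m : Fin (N + 1), ι m, inferInstance, fun i => (W i.1 i.2).length,
    fun i => (W i.1 i.2).get, fun i => hR i.1 i.2, fun χ e s h => ?_⟩
  rw [← susp_susp (brace _ _), eval_susp, susp_brace, eval_suspBrace, susp_twist]
  have h₁ : (insertSum (List.ofFn fun j => ⟨q j, (χ j).susp⟩) s fun t' ht' y =>
      (φ.susp.insert δ N).eval y (t := t) (by rw [totalDeg_ofFn] at ht'; omega)) =
      ∑ m ∈ Finset.range (N + 1), insertSum (List.ofFn fun j => ⟨q j, (χ j).susp⟩) s
        fun t' ht' y => insertSum (List.replicate m ⟨1, Δ.susp⟩) y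
          fun _ _ y' => (φ.susp.arity N).evalOrZero t y' := by
    rw [← insertSum_sum]
    refine congrArg (insertSum _ s) ?_
    funext t' ht' y
    exact insert_eq_sum hΔ.susp _ N y _
  rw [h₁, Finset.sum_range, Finset.smul_sum, Fintype.sum_sigma]
  refine Finset.sum_congr rfl fun m _ => ?_
  have h₂ := (hW m fun j => (χ j).susp).2 s (fun _ y => (φ.susp.arity N).evalOrZero t y)
    fun t' => evalOrZero_multilinear (φ.susp.arity N) A B t' t
  rw [hl] at h₂
  rw [h₂, Finset.smul_sum]
  refine Finset.sum_congr rfl fun i _ => ?_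
  have hsgn : (s.length * (p + ∑ n, (consDeg q ((W m i).get n) - 1) - s.length) + s.suspExp) =
    s.length * (p + ∑ j, (q j - 1) - s.length) + s.suspExp := by rw [hR m i]
  rw [hL, ← susp_susp (brace (arity N φ) _), eval_susp, hsgn, susp_brace, eval_suspBrace,
    susp_arity]
  refine congrArg _ (congrArg (insertSum _ s) ?_)
  funext t' ht' y
  rw [totalDeg_ofFn, hR] at ht'
  exact evalOrZero_eq _ _ (by omega)

end twistBrace

end Cochain

/-! ### The box topology on direct sums -/

section box

variable {J : Type*} {X : J → Type*} [∀ j, AddCommGroup (X j)] [∀ j, UniformSpace (X j)]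

attribute [local instance] boxUniformSpace

theorem mem_boxUniformity {S : Set ((Π₀ j, X j) × Π₀ j, X j)} :
    S ∈ 𝓤 (Π₀ j, X j) ↔ ∃ V : ∀ j, Set (X j × X j), (∀ j, V j ∈ 𝓤 (X j)) ∧
      {p | ∀ j, (p.1 j, p.2 j) ∈ V j} ⊆ S := by
  refine (FilterBasis.mem_filter_iff _).trans ?_
  constructor
  · rintro ⟨_, ⟨V, hV, rfl⟩, h⟩
    exact ⟨V, hV, h⟩
  · rintro ⟨V, hV, h⟩
    exact ⟨_, ⟨V, hV, rfl⟩, h⟩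

theorem uniformContinuous_box_apply (j : J) : UniformContinuous fun f : Π₀ j, X j => f j := by
  classical
  intro V hV
  refine mem_boxUniformity.2 ⟨Function.update (fun _ => Set.univ) j V, fun i => ?_, fun p hp => ?_⟩
  · by_cases h : i = j
    · subst h
      rwa [Function.update_self]
    · rw [Function.update_of_ne h]
      exact univ_mem
  · have := hp j
    rwa [Function.update_self] at this

theorem box_t2Space [∀ j, T2Space (X j)] : T2Space (Π₀ j, X j) :=
  T2Space.of_injective_continuous (f := fun f : Π₀ j, X j => (f : ∀ j, X j))
    DFunLike.coe_injective (continuous_pi fun j => (uniformContinuous_box_apply j).continuous)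

theorem box_isUniformAddGroup [∀ j, IsUniformAddGroup (X j)] :
    IsUniformAddGroup (Π₀ j, X j) := by
  refine ⟨fun S hS => ?_⟩
  obtain ⟨V, hV, hVS⟩ := mem_boxUniformity.1 hS
  have h := fun j => entourageProd_subset (uniformContinuous_sub (α := X j) (hV j))
  choose U hU U' hU' hUU' using h
  have h₁ := mem_boxUniformity.2 ⟨U, hU, subset_rfl⟩
  have h₂ := mem_boxUniformity.2 ⟨U', hU', subset_rfl⟩
  refine mem_map.2 (mem_of_superset (entourageProd_mem_uniformity h₁ h₂) fun p hp =>
    hVS fun j => ?_)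
  exact hUU' j (show ((p.1.1 j, p.1.2 j), (p.2.1 j, p.2.2 j)) ∈ _ from ⟨hp.1 j, hp.2 j⟩)

theorem box_continuousConstSMul [∀ j, Module k (X j)] [∀ j, IsUniformAddGroup (X j)]
    [∀ j, ContinuousConstSMul k (X j)] : ContinuousConstSMul k (Π₀ j, X j) := by
  refine ⟨fun c => UniformContinuous.continuous fun S hS => ?_⟩
  obtain ⟨V, hV, hVS⟩ := mem_boxUniformity.1 hS
  refine mem_boxUniformity.2 ⟨fun j => (fun p => (c • p.1, c • p.2)) ⁻¹' V j, fun j => ?_,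
    fun p hp => hVS hp⟩
  exact uniformContinuous_addMonoidHom_of_continuous
    (f := DistribSMul.toAddMonoidHom (X j) c) (continuous_const_smul c) (hV j)

/-- The coordinatewise limit `x` must be shown to have finite support. Take closed entourages `V₀ j`
which separate `x j` from `0` wherever `x j ≠ 0`. The box structure gives one `f₀` that is `V₀
j`-close to `x j` for all `j` at once, so `x` vanishes outside the finite support of `f₀`.
Closedness also carries the Cauchy condition over to the limit uniformly in `j`. -/
theorem box_completeSpace [∀ j, CompleteSpace (X j)] [∀ j, T2Space (X j)] :
    CompleteSpace (Π₀ j, X j) := by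
  classical
  refine ⟨fun {ℱ} hℱ => ?_⟩
  choose x hx using fun j => CompleteSpace.complete
    (hℱ.map (uniformContinuous_box_apply (X := X) j))
  have := hℱ.1
  -- membership in closed entourages passes to the limit
  have key : ∀ V : ∀ j, Set (X j × X j), (∀ j, V j ∈ 𝓤 (X j)) → (∀ j, IsClosed (V j)) →
      ∃ S ∈ ℱ, ∀ f ∈ S, ∀ j, (x j, f j) ∈ V j := by
    intro V hV hVc
    obtain ⟨S, hS, h⟩ := (cauchy_iff.1 hℱ).2 _ (mem_boxUniformity.2 ⟨V, hV, subset_rfl⟩)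
    refine ⟨S, hS, fun f hf j => ?_⟩
    have hc : IsClosed {y | (y, f j) ∈ V j} := (hVc j).preimage (by fun_prop)
    exact hc.mem_of_tendsto (tendsto_iff_comap.2 (map_le_iff_le_comap.1 (hx j)))
      (mem_of_superset hS fun g hg => h (Set.mk_mem_prod hg hf) j)
  have hV₀ : ∀ j, ∃ V ∈ 𝓤 (X j), IsClosed V ∧ (x j ≠ 0 → (x j, 0) ∉ V) := by
    intro j
    by_cases h : x j = 0
    · exact ⟨_, univ_mem, isClosed_univ, fun h' => (h' h).elim⟩
    · obtain ⟨V, hV, hxV⟩ : ∃ V ∈ 𝓤 (X j), (x j, 0) ∉ V := by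
        by_contra! hV
        exact h (eq_of_forall_symmetric fun hr _ => hV _ hr)
      obtain ⟨W, ⟨hW, hWc⟩, hWV⟩ := uniformity_hasBasis_closed.mem_iff.1 hV
      exact ⟨W, hW, hWc, fun _ h => hxV (hWV h)⟩
  choose V₀ hV₀ hV₀c hxV₀ using hV₀
  obtain ⟨S₀, hS₀, h₀⟩ := key V₀ hV₀ hV₀c
  obtain ⟨f₀, hf₀⟩ := ℱ.nonempty_of_mem hS₀
  let y : Π₀ j, X j := DFinsupp.mk f₀.support fun j => x j
  have hy : ∀ j, y j = x j := by
    intro j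
    rw [DFinsupp.mk_apply]
    split_ifs with hj
    · rfl
    · by_contra hne
      exact hxV₀ j (Ne.symm hne) (DFinsupp.notMem_support_iff.1 hj ▸ h₀ f₀ hf₀ j)
  refine ⟨y, fun U hU => ?_⟩
  obtain ⟨T, hT, hTU⟩ := UniformSpace.mem_nhds_iff.1 hU
  obtain ⟨V, hV, hVT⟩ := mem_boxUniformity.1 hT
  choose W hW hWV using fun j => uniformity_hasBasis_closed.mem_iff.1 (hV j)
  obtain ⟨S, hS, h⟩ := key W (fun j => (hW j).1) fun j => (hW j).2
  refine mem_of_superset hS fun f hf => hTU (hVT fun j => hWV j ?_)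
  rw [id, hy]
  exact h f hf j

end box

instance Free.isTopologicalQuiver [UniformQuiver a] [IsTopologicalQuiver a] :
    IsTopologicalQuiver (Free.{u, v, w, x} a) where
  isUniformAddGroup M N d :=
    letI := fun i : M.I => boxUniformSpace fun j : N.I =>
      a.Hom (M.obj i) (N.obj j) (d + N.deg j - M.deg i)
    haveI := fun i : M.I => box_isUniformAddGroup (J := N.I) (X := fun j =>
      a.Hom (M.obj i) (N.obj j) (d + N.deg j - M.deg i))
    inferInstanceAs (IsUniformAddGroup (∀ i : M.I, Π₀ j : N.I,
      a.Hom (M.obj i) (N.obj j) (d + N.deg j - M.deg i)))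
  continuousConstSMul M N d :=
    letI := fun i : M.I => boxUniformSpace fun j : N.I =>
      a.Hom (M.obj i) (N.obj j) (d + N.deg j - M.deg i)
    haveI := fun i : M.I => box_continuousConstSMul (k := k) (J := N.I) (X := fun j =>
      a.Hom (M.obj i) (N.obj j) (d + N.deg j - M.deg i))
    inferInstanceAs (ContinuousConstSMul k (∀ i : M.I, Π₀ j : N.I,
      a.Hom (M.obj i) (N.obj j) (d + N.deg j - M.deg i)))
  completeSpace M N d :=
    letI := fun i : M.I => boxUniformSpace fun j : N.I =>
      a.Hom (M.obj i) (N.obj j) (d + N.deg j - M.deg i)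
    haveI := fun i : M.I => box_completeSpace (J := N.I) (X := fun j =>
      a.Hom (M.obj i) (N.obj j) (d + N.deg j - M.deg i))
    inferInstanceAs (CompleteSpace (∀ i : M.I, Π₀ j : N.I,
      a.Hom (M.obj i) (N.obj j) (d + N.deg j - M.deg i)))
  t2Space M N d :=
    letI := fun i : M.I => boxUniformSpace fun j : N.I =>
      a.Hom (M.obj i) (N.obj j) (d + N.deg j - M.deg i)
    haveI := fun i : M.I => box_t2Space (J := N.I) (X := fun j =>
      a.Hom (M.obj i) (N.obj j) (d + N.deg j - M.deg i))
    inferInstanceAs (T2Space (∀ i : M.I, Π₀ j : N.I,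
      a.Hom (M.obj i) (N.obj j) (d + N.deg j - M.deg i)))

instance Tw.isTopologicalQuiver [UniformQuiver a] [IsTopologicalQuiver a]
    (P : Set (TwOb.{u, v, w, x} a)) : IsTopologicalQuiver (Tw P) where
  isUniformAddGroup M N d := Free.isTopologicalQuiver.isUniformAddGroup M.1.base N.1.base d
  continuousConstSMul M N d := Free.isTopologicalQuiver.continuousConstSMul M.1.base N.1.base d
  completeSpace M N d := Free.isTopologicalQuiver.completeSpace M.1.base N.1.base d
  t2Space M N d := Free.isTopologicalQuiver.t2Space M.1.base N.1.base d

/-! ### Pointwise topology and continuity of braces -/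

namespace Cochain

section continuity

theorem tendsto_cochain_iff [UniformQuiver a] {p : ℤ} {ι : Type*} {l : Filter ι}
    {φ : ι → a.Cochain p} {ψ : a.Cochain p} :
    Tendsto φ l (𝓝 ψ) ↔ ∀ {A B : a.Ob} {e t : ℤ} (s : Seq a A B e) (h : e + p = t),
      Tendsto (fun i => (φ i).eval s h) l (𝓝 (ψ.eval s h)) := by
  rw [tendsto_subtype_rng]
  simp only [tendsto_pi_nhds]
  exact ⟨fun h A B e t s ht => h A B e s ⟨t, ht⟩, fun h A B e s t => h s t.2⟩

theorem uniformContinuous_eval [UniformQuiver a] {p : ℤ} {A B : a.Ob} {e t : ℤ}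
    (s : Seq a A B e) (h : e + p = t) :
    UniformContinuous fun φ : a.Cochain p => φ.eval s h := by
  have : UniformContinuous fun φ : ∀ (A B : a.Ob) (e : ℤ) (_ : Seq a A B e)
      (t : {t : ℤ // e + p = t}), a.Hom A B t => φ A B e s ⟨t, h⟩ :=
    (Pi.uniformContinuous_proj _ _).comp <| (Pi.uniformContinuous_proj _ s).comp <|
      (Pi.uniformContinuous_proj _ e).comp <| (Pi.uniformContinuous_proj _ B).comp <|
        Pi.uniformContinuous_proj _ A
  exact this.comp uniformContinuous_subtype_val

/-- The neighbourhood filter of `ψ` is Cauchy, hence so is its image. The image has the value at `ψ`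
as a cluster point, because it lies above the principal filter there, and a Cauchy filter converges
to each of its cluster points. -/
theorem continuous_extendTw_brace [UniformQuiver a] {P : Set (TwOb.{u, v, w, x} a)}
    (hbr : BracesPreserveCauchy P) {p : ℤ} (φ : a.Cochain p) {r : ℕ} (q : Fin r → ℤ) :
    Continuous fun ψ : ∀ j, (Tw P).Cochain (q j) => (φ.extendTw P).brace ψ := by
  refine continuous_iff_continuousAt.2 fun ψ => ?_
  refine le_nhds_of_cauchy_adhp (hbr p φ r q _ cauchy_nhds) ?_
  refine NeBot.mono (f := pure ((φ.extendTw P).brace ψ)) inferInstance (le_inf (pure_le_nhds _) ?_)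
  rw [← map_pure]
  exact map_mono (pure_le_nhds _)

end continuity

end Cochain

/-- If all subseries of a countable series have Cauchy partial sums, then it is unconditionally
summable. -/
theorem summable_of_forall_cauchySeq {ι G : Type*} [AddCommGroup G] [UniformSpace G]
    [IsUniformAddGroup G] [CompleteSpace G] {b : ι → G} {S : ℕ → Finset ι} (hS : Monotone S)
    (hS' : ∀ i, ∃ n, i ∈ S n)
    (h : ∀ A : Set ι, CauchySeq fun n => ∑ i ∈ S n, A.indicator b i) : Summable b := by
  classical
  rw [summable_iff_vanishing]
  by_contra! hne
  obtain ⟨e, he, hne⟩ := hne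
  have hfin : ∀ t : Finset ι, ∃ n, t ⊆ S n := by
    intro t
    -- Any finite set is contained in one `S n`, as the `S n` increase to the whole index set.
    choose f hf using hS'
    exact ⟨t.sup f, fun i hi => hS (Finset.le_sup hi) (hf i)⟩
  choose t ht hte using fun n => hne (S n)
  choose m hm using fun n => hfin (t n)
  -- Each `t n` avoids `S n` and has sum outside `e`. The stages are chosen so that the bad block `t
  -- (N i)` lies in `S (N (i + 1))`, which makes the blocks disjoint.
  let N : ℕ → ℕ := fun i => (fun n => max (n + 1) (m n))^[i] 0
  have hN : ∀ i, N (i + 1) = max (N i + 1) (m (N i)) := fun i => Function.iterate_succ_apply' ..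
  have hNmono : StrictMono N := strictMono_nat_of_lt_succ fun i => by rw [hN]; omega
  have htN : ∀ i, t (N i) ⊆ S (N (i + 1)) := fun i =>
    (hm _).trans (hS (by rw [hN]; exact le_max_right _ _))
  -- The subseries supported on all bad blocks: its partial sums jump by exactly one block between
  -- consecutive stages, so they cannot be Cauchy.
  let A : Set ι := {i | ∃ l, i ∈ t (N l)}
  have hdiff : ∀ l, ∑ i ∈ S (N (l + 1)), A.indicator b i - ∑ i ∈ S (N l), A.indicator b i =
      ∑ i ∈ t (N l), b i := by
    intro l
    rw [← Finset.sum_sdiff (hS (hNmono l.lt_succ_self).le), add_sub_cancel_right]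
    have hsub : t (N l) ⊆ S (N (l + 1)) \ S (N l) := fun i hi =>
      Finset.mem_sdiff.2 ⟨htN l hi, Finset.disjoint_left.1 (ht _) hi⟩
    rw [← Finset.sum_subset hsub]
    · exact Finset.sum_congr rfl fun i hi => Set.indicator_of_mem (show i ∈ A from ⟨l, hi⟩) b
    · intro i hi hit
      refine Set.indicator_of_notMem ?_ b
      rintro ⟨l', hl'⟩
      obtain ⟨h₁, h₂⟩ := Finset.mem_sdiff.1 hi
      rcases lt_trichotomy l' l with hlt | rfl | hlt
      · exact h₂ (hS (hNmono.monotone (Nat.succ_le_of_lt hlt)) (htN l' hl'))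
      · exact hit hl'
      · exact Finset.disjoint_left.1 (ht _) hl' (hS (hNmono.monotone (Nat.succ_le_of_lt hlt)) h₁)
  have hV : {p : G × G | p.2 - p.1 ∈ e} ∈ 𝓤 G := by
    rw [uniformity_eq_comap_nhds_zero]
    exact preimage_mem_comap he
  obtain ⟨n, hn⟩ := cauchySeq_iff.1 (h A) _ hV
  have hmem : ∑ i ∈ S (N (n + 1)), A.indicator b i - ∑ i ∈ S (N n), A.indicator b i ∈ e :=
    hn (N n) hNmono.le_apply (N (n + 1)) ((Nat.le_succ n).trans hNmono.le_apply)
  rw [hdiff] at hmem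
  exact hte _ hmem

/-! ### Components of the series and of braces -/

namespace Cochain

section components

variable (P : Set (TwOb.{u, v, w, x} a))

/-- The cochain of `Tw(a)` that arises from the arity `N` component of a cochain of `a` by
inserting `δ` in all possible ways. -/
noncomputable def twistTw (N : ℤ) {p : ℤ} : a.Cochain p →ₗ[k] (Tw P).Cochain p :=
  (twist (twδ P) N).comp (extendTwₗ P p)

variable {P} {A B : (Tw P).Ob} {e t p : ℤ} (s : Seq (Tw P) A B e)

theorem eval_twTerm_eq_twistTw (φ : a.Cochain p) (m : ℕ) (h : e + p = t) :
    (twTerm P φ m).eval s h = (φ.twistTw P (m + s.length)).eval s h :=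
  eval_twTerm ..

theorem twistTw_of_neg {N : ℤ} (hN : N < 0) (φ : a.Cochain p) : φ.twistTw P N = 0 :=
  twist_of_neg _ _ hN

/-- The substitution `N = m + s.length`; the terms with `N < s.length` vanish because insertion
never shortens a sequence. -/
theorem sum_eval_twistTw (φ : a.Cochain p) (h : e + p = t) (n : ℕ) :
    ∑ N ∈ Finset.range (n + s.length), (φ.twistTw P N).eval s h =
      ∑ m ∈ Finset.range n, (twTerm P φ m).eval s h := by
  rw [add_comm, Finset.sum_range_add, Finset.sum_eq_zero, zero_add]
  · refine Finset.sum_congr rfl fun m _ => ?_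
    rw [eval_twTerm_eq_twistTw, add_comm, Nat.cast_add]
  · intro N hN
    exact eval_twist_of_lt _ _ (by simpa using hN) h

theorem eval_twistTw_congr {φ φ' : a.Cochain p} {N : ℕ} (h : e + p = t)
    (hφ : ∀ {A B : a.Ob} {e t : ℤ} (y : Seq a A B e) (h : e + p = t), y.length = N →
      φ.eval y h = φ'.eval y h) :
    (φ.twistTw P N).eval s h = (φ'.twistTw P N).eval s h :=
  eval_twist_congr _ s h fun y hy => eval_extendTw_congr y h fun z hz hzy =>
    hφ z hz (by omega)

theorem twistTw_brace {r : ℕ} {q : Fin r → ℤ} (φ : a.Cochain p) (ψ : ∀ l, a.Cochain (q l))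
    (j : Fin r → ℕ) (N : ℤ) : (φ.brace fun l => (ψ l).arity (j l)).twistTw P N =
      (φ.twistTw P (N + (r - ∑ l, (j l : ℤ)))).brace fun l => (ψ l).twistTw P (j l) := by
  refine Eq.trans ?_ (twist_brace (twδ P) (φ.extendTw P) (fun l => (ψ l).extendTw P) j N)
  refine congrArg (twist (twδ P) N) ((extendTw_brace P φ _).trans ?_)
  simp only [extendTw_arity]

/-- The cochain whose arity `N` component is the one of `χ N`. -/
def ofArity (χ : ℕ → a.Cochain p) : a.Cochain p :=
  ⟨fun _ _ _ s t => (χ s.length).eval s t.2, fun _ _ _ t c x y z h => by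
    have := (χ z.length).eval_multilinear t.2 c x y z h
    simp only at this ⊢
    rw [h.length_eq.1, h.length_eq.2, this]⟩

theorem eval_ofArity (χ : ℕ → a.Cochain p) {A B : a.Ob} {e t : ℤ} (s : Seq a A B e)
    (h : e + p = t) : (ofArity χ).eval s h = (χ s.length).eval s h := rfl

theorem eval_brace_arity_of_lt {r : ℕ} {q : Fin r → ℤ} (φ : a.Cochain p)
    (ψ : ∀ l, a.Cochain (q l)) (j : Fin r → ℕ) {A B : a.Ob} {e t : ℤ} (s : Seq a A B e)
    (h : e + (p + ∑ l, (q l - 1)) = t) (l : Fin r) (hl : s.length < j l) :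
    (φ.brace fun l => (ψ l).arity (j l)).eval s h = 0 := by
  rw [eval_brace_congr φ (ψ' := Function.update (fun l => (ψ l).arity (j l)) l 0) s h]
  · have : φ.brace (Function.update (fun l => (ψ l).arity (j l)) l 0) = 0 :=
      (braceₘ q φ).map_update_zero _ l
    rw [this, eval_zero]
  · intro l' A B e t y hy hys
    by_cases hll : l' = l
    · subst hll
      rw [Function.update_self, eval_arity, if_neg (by omega), eval_zero]
    · rw [Function.update_of_ne hll]

/-- Multilinear expansion of the `ψ_l` into arity components. It is finite at `s`, since no segment
is longer than `s`. -/
theorem sum_eval_brace_arity {r : ℕ} {q : Fin r → ℤ} (φ : a.Cochain p)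
    (ψ : ∀ l, a.Cochain (q l)) {A B : a.Ob} {e t : ℤ} (s : Seq a A B e)
    (h : e + (p + ∑ l, (q l - 1)) = t) :
    ∑ j ∈ Fintype.piFinset fun _ : Fin r => Finset.range (s.length + 1),
      (φ.brace fun l => (ψ l).arity (j l)).eval s h = (φ.brace ψ).eval s h := by
  have := (braceₘ q φ).map_sum_finset (fun l i => (ψ l).arity i)
    fun _ => Finset.range (s.length + 1)
  rw [← eval_sum]
  refine (congrArg (fun χ => eval χ s h) this.symm).trans ?_
  refine eval_brace_congr φ s h fun l A B e t y hy hys => ?_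
  rw [eval_sum, Finset.sum_eq_single y.length]
  · rw [eval_arity, if_pos rfl]
  · intro i _ hi
    rw [eval_arity, if_neg hi.symm]
  · intro hy'
    simp only [Finset.mem_range] at hy'
    omega

end components

/-! ### Completeness of cochains and continuity of twisted braces -/

section convergence

variable [UniformQuiver a] [IsTopologicalQuiver a] {P : Set (TwOb.{u, v, w, x} a)}

instance completeSpace (p : ℤ) : CompleteSpace (a.Cochain p) := by
  refine @IsClosed.completeSpace_coe _ _ _ (a.cochains p : Set (∀ (A B : a.Ob) (e : ℤ)
    (_ : Seq a A B e) (t : {t : ℤ // e + p = t}), a.Hom A B t)) ?_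
  have : (a.cochains p : Set (∀ (A B : a.Ob) (e : ℤ) (_ : Seq a A B e)
      (t : {t : ℤ // e + p = t}), a.Hom A B t)) = ⋂ (A) (B) (e) (t : {t // e + p = t}) (c : k) (x) (y) (z)
      (_ : Seq.LinRel c x y z), {φ | φ A B e z t = φ A B e x t + c • φ A B e y t} := by
    ext φ
    simp only [Set.mem_iInter]
    rfl
  rw [this]
  refine isClosed_iInter fun A => isClosed_iInter fun B => isClosed_iInter fun e =>
    isClosed_iInter fun t => isClosed_iInter fun c => isClosed_iInter fun x =>
    isClosed_iInter fun y => isClosed_iInter fun z => isClosed_iInter fun _ => isClosed_eq ?_ ?_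
  · fun_prop
  · fun_prop

/-- The hypothesis on Cauchy nets concerns outer cochains extended from `a`, and a twisted cochain
need not be of this form. Its brace is, however, a finite sum of braces of the extension of `φ_N`
whose entries are the `χ_l` and constant copies of `δ`. -/
theorem continuous_eval_twistTw_brace (hbr : BracesPreserveCauchy P) {p : ℤ} (φ : a.Cochain p)
    (N : ℕ) {r : ℕ} (q : Fin r → ℤ) {A B : (Tw P).Ob} {e t : ℤ} (s : Seq (Tw P) A B e)
    (h : e + (p + ∑ l, (q l - 1)) = t) :
    Continuous fun χ : ∀ l, (Tw P).Cochain (q l) => ((φ.twistTw P N).brace χ).eval s h := by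
  obtain ⟨ι, _, R, o, hR, H⟩ := exists_eval_twist_brace (isArityZero_canonicalδ P)
    (φ.extendTw P) N q A B t
  refine (continuous_congr fun χ => H χ s h).2 (continuous_finsetSum _ fun i _ => ?_)
  rw [← extendTw_arity]
  refine (uniformContinuous_eval s _).continuous.comp
    ((continuous_extendTw_brace hbr (φ.arity N) _).comp (continuous_pi fun n => ?_))
  have hc : ∀ o', Continuous fun χ : ∀ l, (Tw P).Cochain (q l) => consΔ (canonicalδ P) χ o' := by
    rintro (_ | l)
    · exact continuous_const
    · exact continuous_apply l
  exact hc _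

end convergence

/-! ### Unconditional summation and compatibility with braces -/

section braces

variable {P : Set (TwOb.{u, v, w, x} a)} {p : ℤ} {A B : (Tw P).Ob} {e t : ℤ}

/-- At each sequence the partial sums agree up to an index shift by its length. The shift varies
with the sequence, which is harmless for pointwise convergence. -/
theorem tendsto_twTerm_iff [UniformQuiver a] {φ : a.Cochain p} {χ : (Tw P).Cochain p} :
    Tendsto (fun n => ∑ m ∈ Finset.range n, twTerm P φ m) atTop (𝓝 χ) ↔
      Tendsto (fun n => ∑ N ∈ Finset.range n, φ.twistTw P N) atTop (𝓝 χ) := by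
  simp only [tendsto_cochain_iff, eval_sum]
  refine forall_congr' fun A => forall_congr' fun B => forall_congr' fun e => forall_congr' fun t =>
    forall_congr' fun s => forall_congr' fun h => ?_
  simp only [← sum_eval_twistTw s φ h]
  exact tendsto_add_atTop_iff_nat (f := fun n => ∑ N ∈ Finset.range n,
    (φ.twistTw P N).eval s h) s.length

theorem cauchySeq_sum_eval_twistTw [UniformQuiver a] (hP : IsQuiverOfTwistedObjects P) (φ : a.Cochain p)
    (s : Seq (Tw P) A B e) (h : e + p = t) :
    CauchySeq fun n => ∑ N ∈ Finset.range n, (φ.twistTw P N).eval s h := by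
  rw [← cauchySeq_shift s.length]
  simp only [sum_eval_twistTw s φ h, ← eval_sum]
  exact (uniformContinuous_eval s h).comp_cauchySeq (hP.cauchySeq p φ)

variable {r : ℕ} {q : Fin r → ℤ} (φ : a.Cochain p) (ψ : ∀ l, a.Cochain (q l))
  (s : Seq (Tw P) A B e) (h : e + (p + ∑ l, (q l - 1)) = t)

/-- The finite sets `{0, …, n - 1} × {0, …, n - 1}^r`. -/
def box (r n : ℕ) : Finset (ℕ × (Fin r → ℕ)) :=
  Finset.range n ×ˢ Fintype.piFinset fun _ => Finset.range n

theorem monotone_piFinset_range (r : ℕ) :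
    Monotone fun n => Fintype.piFinset fun _ : Fin r => Finset.range n :=
  fun _ _ h => Fintype.piFinset_subset _ _ fun _ => Finset.range_mono h

theorem exists_mem_piFinset_range {r : ℕ} (j : Fin r → ℕ) :
    ∃ n, j ∈ Fintype.piFinset fun _ : Fin r => Finset.range n :=
  ⟨Finset.univ.sup j + 1, Fintype.mem_piFinset.2 fun l =>
    Finset.mem_range.2 (Nat.lt_succ_of_le (Finset.le_sup (Finset.mem_univ l)))⟩

theorem monotone_box (r : ℕ) : Monotone (box r) := fun _ _ h =>
  Finset.product_subset_product (Finset.range_mono h) (monotone_piFinset_range r h)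

theorem exists_mem_box {r : ℕ} (i : ℕ × (Fin r → ℕ)) : ∃ n, i ∈ box r n := by
  obtain ⟨n, hn⟩ := exists_mem_piFinset_range i.2
  exact ⟨max (i.1 + 1) n, Finset.mem_product.2 ⟨Finset.mem_range.2 (by omega),
    monotone_piFinset_range r (le_max_right _ _) hn⟩⟩

theorem eval_twistTw_brace_of_lt (N : ℕ) (j : Fin r → ℕ) (l : Fin r) (hl : N < j l) :
    ((φ.brace fun l => (ψ l).arity (j l)).twistTw P N).eval s h = 0 := by
  rw [eval_twistTw_congr (φ' := 0) s h fun y hy hyN => ?_, map_zero, eval_zero]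
  rw [eval_brace_arity_of_lt φ ψ j y hy l (by omega), eval_zero]

open Classical in
/-- The part of the family of all `φ{(ψ_1)_{j_1}, …, (ψ_r)_{j_r}}_N` with `(N, j) ∈ S`. -/
noncomputable def subseries (S : Set (ℕ × (Fin r → ℕ))) : a.Cochain (p + ∑ l, (q l - 1)) :=
  ofArity fun N => ∑ j ∈ Fintype.piFinset fun _ : Fin r => Finset.range (N + 1),
    if (N, j) ∈ S then φ.brace fun l => (ψ l).arity (j l) else 0

theorem subseries_univ : subseries φ ψ Set.univ = φ.brace ψ := by
  ext A B e t s h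
  rw [subseries, eval_ofArity, eval_sum]
  simp only [Set.mem_univ, if_true]
  exact sum_eval_brace_arity φ ψ s h

/-- Terms with some `j l > N` vanish, so for fixed `N` only finitely many `j` matter. An arbitrary
subseries is thus again the series of a cochain of `a`, and its convergence is part of the
hypothesis on twisted objects. -/
theorem sum_box_indicator (S : Set (ℕ × (Fin r → ℕ))) (n : ℕ) :
    ∑ i ∈ box r n, S.indicator (fun i : ℕ × (Fin r → ℕ) =>
        ((φ.brace fun l => (ψ l).arity (i.2 l)).twistTw P i.1).eval s h) i =
      ∑ N ∈ Finset.range n, ((subseries φ ψ S).twistTw P N).eval s h := by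
  classical
  rw [box, Finset.sum_product]
  refine Finset.sum_congr rfl fun N hN => ?_
  rw [Finset.mem_range] at hN
  rw [eval_twistTw_congr (φ' := ∑ j ∈ Fintype.piFinset fun _ : Fin r => Finset.range (N + 1),
    if (N, j) ∈ S then φ.brace fun l => (ψ l).arity (j l) else 0) s h fun y hy hyN => ?_]
  · rw [map_sum, eval_sum, ← Finset.sum_subset (monotone_piFinset_range r hN)]
    · refine Finset.sum_congr rfl fun j _ => ?_
      rw [Set.indicator_apply]
      split_ifs
      · rfl
      · rw [map_zero, eval_zero]
    · intro j _ hj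
      simp only [Fintype.mem_piFinset, not_forall, Finset.mem_range, not_lt] at hj
      obtain ⟨l, hl⟩ := hj
      refine Set.indicator_apply_eq_zero.2 fun _ => eval_twistTw_brace_of_lt φ ψ s h N j l ?_
      omega
  · rw [subseries, eval_ofArity, hyN]

variable [UniformQuiver a] [IsTopologicalQuiver a]

theorem hasSum_eval_twistTw_brace (hP : IsQuiverOfTwistedObjects P)
    {χ : (Tw P).Cochain (p + ∑ l, (q l - 1))}
    (hχ : Tendsto (fun n => ∑ N ∈ Finset.range n, (φ.brace ψ).twistTw P N) atTop (𝓝 χ)) :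
    HasSum (fun i : ℕ × (Fin r → ℕ) =>
      ((φ.brace fun l => (ψ l).arity (i.2 l)).twistTw P i.1).eval s h) (χ.eval s h) := by
  have hsum : Summable (fun i : ℕ × (Fin r → ℕ) =>
      ((φ.brace fun l => (ψ l).arity (i.2 l)).twistTw P i.1).eval s h) := by
    refine summable_of_forall_cauchySeq (monotone_box r) exists_mem_box fun S => ?_
    simp only [sum_box_indicator]
    exact cauchySeq_sum_eval_twistTw hP _ s h
  obtain ⟨z, hz⟩ := hsum
  have h₁ := Tendsto.comp hz (tendsto_atTop_finset_of_monotone (monotone_box r) exists_mem_box)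
  have h₂ := tendsto_cochain_iff.1 hχ s h
  have h₃ := fun n => sum_box_indicator φ ψ s h Set.univ n
  simp only [subseries_univ, Set.indicator_univ] at h₃
  simp only [eval_sum, ← h₃] at h₂
  rwa [tendsto_nhds_unique h₂ h₁]

theorem hasSum_eval_brace_twistTw (hP : IsQuiverOfTwistedObjects P)
    {χ : (Tw P).Cochain (p + ∑ l, (q l - 1))}
    (hχ : Tendsto (fun n => ∑ N ∈ Finset.range n, (φ.brace ψ).twistTw P N) atTop (𝓝 χ)) :
    HasSum (fun i : ℕ × (Fin r → ℕ) =>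
      ((φ.twistTw P i.1).brace fun l => (ψ l).twistTw P (i.2 l)).eval s h) (χ.eval s h) := by
  let b : ℤ × (Fin r → ℕ) → (Tw P).Hom A B t := fun i =>
    ((φ.twistTw P i.1).brace fun l => (ψ l).twistTw P (i.2 l)).eval s h
  let g : ℕ × (Fin r → ℕ) → ℤ × (Fin r → ℕ) := fun i => (i.1, i.2)
  have hg : Function.Injective g := fun i i' hi => by
    simp only [g, Prod.mk.injEq, Nat.cast_inj] at hi
    exact Prod.ext hi.1 hi.2
  have hrange : ∀ i ∉ Set.range g, i.1 < 0 := by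
    intro i hi
    by_contra! h0
    exact hi ⟨(i.1.toNat, i.2), Prod.ext (Int.toNat_of_nonneg h0) rfl⟩
  -- The shift `N ↦ N + r - ∑ j_l` of `twistTw_brace` is bijective only over `ℤ`. On either side,
  -- the terms with negative first index vanish, so the passage from `ℕ` to `ℤ` and back costs
  -- nothing.
  let σ : ℤ × (Fin r → ℕ) ≃ ℤ × (Fin r → ℕ) :=
    { toFun i := (i.1 + (r - ∑ l, (i.2 l : ℤ)), i.2)
      invFun i := (i.1 - (r - ∑ l, (i.2 l : ℤ)), i.2)
      left_inv i := by simp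
      right_inv i := by simp }
  change HasSum (b ∘ g) _
  rw [hg.hasSum_iff, ← σ.hasSum_iff, ← hg.hasSum_iff]
  · convert hasSum_eval_twistTw_brace φ ψ s h hP hχ using 1
    funext i
    rw [twistTw_brace]
    rfl
  · intro i hi
    change eval (brace (twistTw P (i.1 + (r - ∑ l, (i.2 l : ℤ))) φ)
      fun l => (ψ l).twistTw P (i.2 l)) s h = 0
    rw [← twistTw_brace, twistTw_of_neg (hrange i hi), eval_zero]
  · intro i hi
    change eval (brace (twistTw P i.1 φ) _) s h = 0
    rw [twistTw_of_neg (hrange i hi)]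
    exact map_zero (evalBraceₗ _ s h)

theorem eval_brace_of_tendsto (hbr : BracesPreserveCauchy P) (hP : IsQuiverOfTwistedObjects P)
    {χ : (Tw P).Cochain (p + ∑ l, (q l - 1))} {φ' : (Tw P).Cochain p}
    {ψ' : ∀ l, (Tw P).Cochain (q l)}
    (hχ : Tendsto (fun n => ∑ N ∈ Finset.range n, (φ.brace ψ).twistTw P N) atTop (𝓝 χ))
    (hφ : Tendsto (fun n => ∑ N ∈ Finset.range n, φ.twistTw P N) atTop (𝓝 φ'))
    (hψ : ∀ l, Tendsto (fun n => ∑ N ∈ Finset.range n, (ψ l).twistTw P N) atTop (𝓝 (ψ' l))) :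
    χ = φ'.brace ψ' := by
  ext A B e t s h
  have hsum := hasSum_eval_brace_twistTw φ ψ s h hP hχ
  -- The inner sum of Fubini: over cubes in `j`, the partial sums are the brace at the partial sums
  -- of the `ψ_l`, which converges by continuity.
  have hfib : ∀ N : ℕ, HasSum (fun j : Fin r → ℕ =>
      ((φ.twistTw P N).brace fun l => (ψ l).twistTw P (j l)).eval s h)
      (((φ.twistTw P N).brace ψ').eval s h) := by
    intro N
    obtain ⟨z, hz⟩ := hsum.summable.prod_factor N
    have h₁ := Tendsto.comp hz (tendsto_atTop_finset_of_monotone (monotone_piFinset_range r)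
      exists_mem_piFinset_range)
    have h₂ := ((continuous_eval_twistTw_brace hbr φ N q s h).tendsto ψ').comp
      (tendsto_pi_nhds.2 hψ)
    have h₃ : ∀ n, ((φ.twistTw P N).brace fun l => ∑ i ∈ Finset.range n,
        (ψ l).twistTw P i).eval s h = ∑ j ∈ Fintype.piFinset fun _ : Fin r => Finset.range n,
          ((φ.twistTw P N).brace fun l => (ψ l).twistTw P (j l)).eval s h := by
      intro n
      have := (braceₘ q (φ.twistTw P N)).map_sum_finset (fun l (i : ℕ) => (ψ l).twistTw P i)
        fun _ => Finset.range n
      exact (congrArg (fun χ => eval χ s h) this).trans (eval_sum ..)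
    simp only [Function.comp_def, h₃] at h₂
    rwa [tendsto_nhds_unique h₂ h₁]
  -- The outer sum over `N`, by continuity in the outer cochain.
  refine tendsto_nhds_unique (hsum.prod_fiberwise hfib).tendsto_sum_nat ?_
  have := tendsto_eval_brace ψ' s h fun {e'} y hy => tendsto_cochain_iff.1 hφ y hy
  refine this.congr fun n => ?_
  exact map_sum (evalBraceₗ ψ' s h) _ _

end braces

end Cochain

end GradedQuiver

theorem mainTheorem5 {k : Type u} [CommRing k] (a : GradedQuiver.{u, v, w} k)
    [UniformQuiver a] [IsTopologicalQuiver a] (P : Set (TwOb.{u, v, w, x} a))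
    (hbr : BracesPreserveCauchy P) (hP : IsQuiverOfTwistedObjects P) :
    ∃ embr : ∀ p : ℤ, a.Cochain p →ₗ[k] (Tw P).Cochain p,
      (∀ (p : ℤ) (φ : a.Cochain p),
        Tendsto (fun n => ∑ m ∈ Finset.range n, twTerm P φ m) atTop (𝓝 (embr p φ))) ∧
      (∀ (p : ℤ) (φ : a.Cochain p), proj hP.ofOb_mem (embr p φ) = φ) ∧
      (∀ (p : ℤ) (r : ℕ) (q : Fin r → ℤ) (φ : a.Cochain p) (ψ : ∀ j, a.Cochain (q j)),
        embr _ (φ.brace ψ) = (embr p φ).brace fun j => embr (q j) (ψ j)) ∧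
      (∀ (p : ℤ) (φ : a.Cochain p) (M : (Tw P).Ob),
        Tendsto (fun n => ∑ m ∈ Finset.range n,
            ((m * (p - m) + m * (m - 1) / 2 : ℤ)).negOnePow •
              (φ.extendTw P).eval (δSeq P M m) (zero_add p))
          atTop (𝓝 ((embr p φ).eval (.nil rfl : Seq (Tw P) M M 0) (zero_add p)))) := by
  choose embr hembr using fun (p : ℤ) (φ : a.Cochain p) =>
    cauchySeq_tendsto_of_complete (hP.cauchySeq p φ)
  have hN := fun p φ => Cochain.tendsto_twTerm_iff.1 (hembr p φ)
  refine ⟨fun p => ⟨⟨embr p, fun φ φ' => ?_⟩, fun c φ => ?_⟩, hembr, fun p φ => ?_,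
    fun p r q φ ψ => Cochain.eval_brace_of_tendsto φ ψ hbr hP (hN _ _) (hN p φ) fun l => hN (q l) (ψ l),
    fun p φ M => ?_⟩
  · refine Cochain.ext fun {A B e t} s h => ?_
    -- Linearity passes to the limit, as each `twistTw P N` is linear and the morphism modules are
    -- Hausdorff.
    refine tendsto_nhds_unique (Cochain.tendsto_cochain_iff.1 (hN p (φ + φ')) s h) ?_
    refine ((Cochain.tendsto_cochain_iff.1 (hN p φ) s h).add
      (Cochain.tendsto_cochain_iff.1 (hN p φ') s h)).congr fun n => ?_
    simp only [map_add, Finset.sum_add_distrib, Cochain.eval_add]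
  · refine Cochain.ext fun {A B e t} s h => ?_
    refine tendsto_nhds_unique (Cochain.tendsto_cochain_iff.1 (hN p (c • φ)) s h) ?_
    refine ((Cochain.tendsto_cochain_iff.1 (hN p φ) s h).const_smul c).congr fun n => ?_
    simp only [map_smul, ← Finset.smul_sum, Cochain.eval_smul]
  · refine Cochain.ext fun {A B e t} s h => ?_
    have hlim : Tendsto (fun n => (∑ m ∈ Finset.range n, twTerm P φ m).eval
        (inclSeq hP.ofOb_mem s) h) atTop (𝓝 ((φ.extendTw P).eval (inclSeq hP.ofOb_mem s) h)) := by
      -- On sequences of `a` the partial sums are constant as soon as they contain the term `m = 0`.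
      refine tendsto_atTop_of_eventually_const (i₀ := 1) fun n hn => ?_
      simp only [Cochain.eval_sum, Cochain.eval_twTerm_inclSeq]
      rw [Finset.sum_ite_eq' (Finset.range n) 0, if_pos (Finset.mem_range.2 hn)]
    have := tendsto_nhds_unique (Cochain.tendsto_cochain_iff.1 (hembr p φ) _ h) hlim
    exact (congrArg (entry hP.ofOb_mem) this).trans (Cochain.eval_extendTw_inclSeq hP.ofOb_mem φ s h)
  · refine (Cochain.tendsto_cochain_iff.1 (hembr p φ) (.nil rfl : Seq (Tw P) M M 0) (zero_add p)).congr
      fun n => ?_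
    simp only [Cochain.eval_sum, Cochain.eval_twTerm_nil]
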